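/- **Conventions.** Let $k$ be a field. Graded vector spaces $V=(V_n)_{n\in\mathbb Z}$ carry lower gradings, differentials have degree $-1$, $V^t=V_{-t}$, and $(\Sigma^tV)_n=V_{n-t}$. A (small) differential graded category $A$ has chain complexes $A(x,y)$ of morphisms and associative unital compositions that satisfy the Leibniz rule; a graded category is the same without differentials. An $(A,A)$-bimodule $M$ has chain complexes $M(x,y)$ with commuting associative unital left and right actions that satisfy the Leibniz rule. $\mathrm H_\bullet A$ is the graded homology category and $\mathrm H_\bullet M$ the induced $(\mathrm H_\bullet A,\mathrm H_\bullet A)$-bimodule; in $\Sigma^tN$ the left action of $f$ carries the sign $(-1)^{t|f|}$. Put, for $s\ge 0$ and $t\in\mathbb Z$, $$E_0^{s,t}(A;M)=\prod_{x_0,\dots,x_s}\mathrm{Hom}\bigl(A(x_1,x_0)\otimes\cdots\otimes A(x_s,x_{s-1}),\,M(x_s,x_0)\bigr)^t ,$$ with internal differential $\delta\varphi=d\varphi-(-1)^t\varphi d$ and Hochschild coboundary $$(b\varphi)(f_1,\dots,f_{s+1})=(-1)^{t|f_1|}f_1\varphi(f_2,\dots)+\sum_{i=1}^{s}(-1)^i\varphi(\dots,f_if_{i+1},\dots)+(-1)^{s+1}\varphi(f_1,\dots,f_s)f_{s+1}.$$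 $\mathrm{HH}_{\mathrm{dg}}^n(A;M)$ is the cohomology of the product total complex $\mathrm{Tot}^n=\prod_{s+t=n}E_0^{s,t}$ with $D=b+(-1)^s\delta$. For a graded category $C$ and a graded bimodule $N$, $\mathrm{HH}^s_{\mathrm{gr}}(C;N)$ denotes the cohomology at $s$ of the complex $(E_0^{\bullet,0}(C;N),b)$ of cochains of internal degree $0$. Let $F^p\mathrm{Tot}$ consist of the elements with vanishing components in columns $s<p$. For a double complex $K$ concentrated in columns $s\ge 0$, with product total complex $\mathrm{Tot}$ and column filtration $F^p$, put $F^pH^n=\mathrm{im}(H^n(F^p\mathrm{Tot})\to H^n(\mathrm{Tot}))$ and $Z_r^p=\{x\in F^p\mathrm{Tot}: Dx\in F^{p+r}\mathrm{Tot}\}$. We say that the spectral sequence of the column filtration *converges* to $H^\bullet(\mathrm{Tot})$ if the following hold. * (Conditional convergence.) $F^0H^n=H^n(\mathrm{Tot})$, and $\lim_p H^n(F^p\mathrm{Tot})=0=\lim^1_p H^n(F^p\mathrm{Tot})$ for all $n$. * The canonical maps $F^pH^n/F^{p+1}H^n\to E_\infty^{p,n-p}$ exist and are injective. * If $\lim^1_r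 Z_r^{p}=0$ in every bidegree, where $Z_r^p$ is regarded as a subspace of $E_0^{p,\bullet}=F^p/F^{p+1}$, then the convergence is strong: the filtration of $H^n(\mathrm{Tot})$ is exhaustive, Hausdorff and complete, and $F^pH^n/F^{p+1}H^n\to E_\infty^{p,n-p}$ is an isomorphism for all $p,n$. **Theorem.** (1) Let $A$ be a differential graded category over $k$ and $M$ an $(A,A)$-bimodule. The spectral sequence of the column filtration of the product total complex of the double complex $E_0(A;M)$ (so that internal cohomology is taken first, and $d_r\colon E_r^{s,t}\to E_r^{s+r,t-r+1}$) is a cohomological spectral sequence in the right half-plane $s\ge 0$ with $$E_2^{s,t}\;\cong\;\mathrm{HH}^s_{\mathrm{gr}}(\mathrm H_\bullet A;\Sigma^t\mathrm H_\bullet M),$$ which converges, in the above sense, to $\mathrm{HH}_{\mathrm{dg}}^{s+t}(A;M)$. The isomorphism is induced by the Künneth map that sends a cochain $\varphi$ with $\delta\varphi=0$ to the cochain $([f_1],\dots,[f_s])\mapsto[\varphi(f_1,\dots,f_s)]$. If $A$ has a single object, this is the case of a differential graded algebra and a bimodule over it. (2) Let $T$ be an automorphism of the underlying graded category of $A$ with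 $Td=-dT$ (such as the parity functor $f\mapsto(-1)^{|f|}f$, or the shift functor on a category of complexes). Let $E_0(A,T)\subseteq E_0(A;A)$ be the double complex of the cochains with $\varphi(Tf_1,\dots,Tf_s)=(-1)^{t}\,T\varphi(f_1,\dots,f_s)$, where $t$ is the internal degree of $\varphi$, and let $\mathrm{HH}_{\mathrm{dg}}^\bullet(A,T)$ be the cohomology of its product total complex. The spectral sequence of the column filtration of this total complex is a cohomological spectral sequence in the right half-plane with $E_2^{s,t}\cong H^s_b\bigl(H^t_\delta(E_0(A,T))\bigr)$, which converges, in the above sense, to $\mathrm{HH}_{\mathrm{dg}}^{s+t}(A,T)$. -/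

import Mathlib

/-- The sign `(-1)^n`, for an integer `n`, as a scalar. -/
def sgn (k : Type*) [Field k] (n : ℤ) : k := (-1) ^ n

theorem sgn_add (k : Type*) [Field k] (m n : ℤ) : sgn k (m + n) = sgn k m * sgn k n :=
  zpow_add₀ (by simp) m n

theorem sgn_mul_self (k : Type*) [Field k] (n : ℤ) : sgn k n * sgn k n = 1 := by
  unfold sgn
  rw [← mul_zpow]
  simp

theorem sgn_zero (k : Type*) [Field k] : sgn k 0 = 1 := by simp [sgn]

theorem sgn_one (k : Type*) [Field k] : sgn k 1 = -1 := by simp [sgn]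

theorem sgn_neg (k : Type*) [Field k] (n : ℤ) : sgn k (-n) = sgn k n := by
  rw [sgn, zpow_neg, ← inv_zpow, sgn]
  simp

theorem sgn_sub (k : Type*) [Field k] (m n : ℤ) : sgn k (m - n) = sgn k m * sgn k n := by
  rw [sub_eq_add_neg, sgn_add, sgn_neg]

theorem sgn_sub_one (k : Type*) [Field k] (n : ℤ) : sgn k (n - 1) = - sgn k n := by
  rw [sgn, zpow_sub_one₀ (by simp), sgn]
  simp

/-! ### Homology of differential graded vector spaces (lower grading, differential of degree `-1`) -/

section Homology

variable {k : Type*} [Field k]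

/-- The `n`-cycles of `(X, d)`. -/
abbrev Cyc {X : ℤ → Type*} [∀ n, AddCommGroup (X n)] [∀ n, Module k (X n)]
    (d : ∀ n m : ℤ, m + 1 = n → (X n →ₗ[k] X m)) (n : ℤ) : Submodule k (X n) :=
  LinearMap.ker (d n (n - 1) (Int.sub_add_cancel n 1))

/-- The homology `H_n`: `n`-cycles modulo `n`-boundaries of `(X, d)`. -/
def Hlgy {X : ℤ → Type*} [∀ n, AddCommGroup (X n)] [∀ n, Module k (X n)]
    (d : ∀ n m : ℤ, m + 1 = n → (X n →ₗ[k] X m)) (n : ℤ) : Type _ :=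
  Cyc d n ⧸ (LinearMap.range (d (n + 1) n rfl)).submoduleOf (Cyc d n)

namespace Hlgy

section

variable {X : ℤ → Type*} [∀ n, AddCommGroup (X n)] [∀ n, Module k (X n)]
  (d : ∀ n m : ℤ, m + 1 = n → (X n →ₗ[k] X m))

instance (n : ℤ) : AddCommGroup (Hlgy d n) := by unfold Hlgy; infer_instance

instance (n : ℤ) : Module k (Hlgy d n) := by unfold Hlgy; infer_instance

/-- The homology class of a cycle. -/
def mk (n : ℤ) : Cyc d n →ₗ[k] Hlgy d n :=
  Submodule.mkQ _

theorem mk_surjective (n : ℤ) : Function.Surjective (mk d n) := Submodule.mkQ_surjective _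

theorem mk_eq_zero (n : ℤ) (x : Cyc d n)
    (y : X (n + 1)) (h : d (n + 1) n rfl y = x) : mk d n x = 0 :=
  (Submodule.Quotient.mk_eq_zero _).2 ⟨y, h⟩

end

section Pair

variable {X Y Z : ℤ → Type*} [∀ n, AddCommGroup (X n)] [∀ n, Module k (X n)]
  [∀ n, AddCommGroup (Y n)] [∀ n, Module k (Y n)]
  [∀ n, AddCommGroup (Z n)] [∀ n, Module k (Z n)]
  (dX : ∀ n m : ℤ, m + 1 = n → (X n →ₗ[k] X m))
  (dY : ∀ n m : ℤ, m + 1 = n → (Y n →ₗ[k] Y m))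
  (dZ : ∀ n m : ℤ, m + 1 = n → (Z n →ₗ[k] Z m))
  (μ : ∀ i j n : ℤ, i + j = n → (X i →ₗ[k] Y j →ₗ[k] Z n))

/-- The Leibniz rule for a pairing of differential graded vector spaces. -/
def Leibniz : Prop :=
  ∀ (i j n i' j' n' : ℤ) (h : i + j = n) (hi : i' + 1 = i) (hj : j' + 1 = j) (hn : n' + 1 = n)
    (x : X i) (y : Y j),
    dZ n n' hn (μ i j n h x y) =
      μ i' j n' (by omega) (dX i i' hi x) y +
        sgn k i • μ i j' n' (by omega) x (dY j j' hj y)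

variable (hμ : Leibniz dX dY dZ μ)

variable {dX dY dZ μ}

/-- The pairing on cycles. -/
def pairCyc (i j n : ℤ) (h : i + j = n) :
    Cyc dX i →ₗ[k] Cyc dY j →ₗ[k]
      Cyc dZ n :=
  LinearMap.mk₂ k
    (fun x y => ⟨μ i j n h x y, by
      have hx := x.2
      have hy := y.2
      rw [LinearMap.mem_ker] at hx hy ⊢
      rw [hμ i j n (i - 1) (j - 1) (n - 1) h (by omega) (by omega) (by omega), hx, hy]
      simp⟩)
    (fun _ _ _ => Subtype.ext (by simp)) (fun _ _ _ => Subtype.ext (by simp))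
    (fun _ _ _ => Subtype.ext (by simp)) (fun _ _ _ => Subtype.ext (by simp))

/-- Pairing a cycle with a homology class. -/
def pairRight (i j n : ℤ) (h : i + j = n) (x : Cyc dX i) : Hlgy dY j →ₗ[k] Hlgy dZ n :=
  Submodule.liftQ _ ((mk dZ n).comp (pairCyc hμ i j n h x)) (by
    rintro ⟨y, hy⟩ ⟨w, hw⟩
    refine mk_eq_zero dZ n _ (sgn k i • μ i (j + 1) (n + 1) (by omega) (x : X i) w) ?_
    have hx := x.2
    rw [LinearMap.mem_ker] at hx
    have hw' : dY (j + 1) j rfl w = y := hw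
    rw [map_smul, hμ i (j + 1) (n + 1) (i - 1) j n _ (by omega) rfl rfl, hx, hw',
      map_zero, LinearMap.zero_apply, zero_add, smul_smul, sgn_mul_self, one_smul]
    rfl)

theorem pairRight_mk (i j n : ℤ) (h : i + j = n) (x : Cyc dX i) (y : Cyc dY j) :
    pairRight hμ i j n h x (mk dY j y) = mk dZ n (pairCyc hμ i j n h x y) := rfl

/-- Pairing a cycle with a homology class, linearly in the cycle. -/
def pairLeft (i j n : ℤ) (h : i + j = n) : Cyc dX i →ₗ[k] Hlgy dY j →ₗ[k] Hlgy dZ n where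
  toFun := pairRight hμ i j n h
  map_add' x x' := by
    ext y
    obtain ⟨y, rfl⟩ := mk_surjective _ _ y
    simp only [LinearMap.add_apply, pairRight_mk, map_add]
  map_smul' c x := by
    ext y
    obtain ⟨y, rfl⟩ := mk_surjective _ _ y
    simp only [LinearMap.smul_apply, pairRight_mk, map_smul, RingHom.id_apply]

/-- The pairing induced on homology: `[x] ⊗ [y] ↦ [μ x y]`. -/
def pair (i j n : ℤ) (h : i + j = n) : Hlgy dX i →ₗ[k] Hlgy dY j →ₗ[k] Hlgy dZ n :=
  Submodule.liftQ _ (pairLeft hμ i j n h) (by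
    rintro ⟨x, hx0⟩ ⟨w, hw⟩
    rw [LinearMap.mem_ker]
    ext y
    obtain ⟨y, rfl⟩ := mk_surjective _ _ y
    refine mk_eq_zero dZ n _ (μ (i + 1) j (n + 1) (by omega) w (y : Y j)) ?_
    have hy := y.2
    rw [LinearMap.mem_ker] at hy
    have hw' : dX (i + 1) i rfl w = x := hw
    rw [hμ (i + 1) j (n + 1) i (j - 1) n _ rfl (by omega) rfl, hy, hw', map_zero, smul_zero,
      add_zero]
    rfl)

theorem pair_mk (i j n : ℤ) (h : i + j = n) (x : Cyc dX i) (y : Cyc dY j) :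
    pair hμ i j n h (mk dX i x) (mk dY j y) = mk dZ n (pairCyc hμ i j n h x y) := rfl

end Pair

end Hlgy

end Homology

/-! ### Graded categories, differential graded categories and bimodules -/

universe uk u v w

/-- A (small) graded category over the field `k`: graded vector spaces of morphisms `Hom x y`,
with an associative and unital composition `Hom y z ⊗ Hom x y ⟶ Hom x z` of degree zero. -/
structure GrCat (k : Type uk) [Field k] where
  Obj : Type u
  Hom : Obj → Obj → ℤ → Type v
  [addCommGroup : ∀ x y n, AddCommGroup (Hom x y n)]
  [module : ∀ x y n, Module k (Hom x y n)]
  id : ∀ x, Hom x x 0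
  comp : ∀ (x y z : Obj) (i j n : ℤ), i + j = n → (Hom y z i →ₗ[k] Hom x y j →ₗ[k] Hom x z n)
  id_comp : ∀ (x y : Obj) (n : ℤ) (f : Hom x y n), comp x y y 0 n n (zero_add n) (id y) f = f
  comp_id : ∀ (x y : Obj) (n : ℤ) (f : Hom x y n), comp x x y n 0 n (add_zero n) f (id x) = f
  assoc : ∀ (x y z w : Obj) (a b c ab bc abc : ℤ) (h₁ : a + b = ab) (h₂ : b + c = bc)
    (h₃ : ab + c = abc) (h₄ : a + bc = abc) (f : Hom z w a) (g : Hom y z b) (h : Hom x y c),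
    comp x y w ab c abc h₃ (comp y z w a b ab h₁ f g) h =
      comp x z w a bc abc h₄ f (comp x y z b c bc h₂ g h)

attribute [instance] GrCat.addCommGroup GrCat.module

/-- A differential graded category over `k`: a graded category with differentials of degree `-1`
on its morphism spaces that satisfy the Leibniz rule. -/
structure DGCat (k : Type uk) [Field k] extends GrCat.{uk, u, v} k where
  d : ∀ (x y : Obj) (n m : ℤ), m + 1 = n → (Hom x y n →ₗ[k] Hom x y m)
  d_d : ∀ (x y : Obj) (n m l : ℤ) (h : m + 1 = n) (h' : l + 1 = m) (f : Hom x y n),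
    d x y m l h' (d x y n m h f) = 0
  leibniz : ∀ x y z : Obj, Hlgy.Leibniz (d y z) (d x y) (d x z) (comp x y z)

/-- A bimodule over a graded category: graded vector spaces `obj x y`, contravariant in `x` and
covariant in `y`, with commuting left and right actions of the morphisms. -/
structure GrBimod {k : Type uk} [Field k] (A : GrCat.{uk, u, v} k) where
  obj : A.Obj → A.Obj → ℤ → Type w
  [addCommGroup : ∀ x y n, AddCommGroup (obj x y n)]
  [module : ∀ x y n, Module k (obj x y n)]
  left : ∀ (x y z : A.Obj) (i j n : ℤ), i + j = n →
    (A.Hom y z i →ₗ[k] obj x y j →ₗ[k] obj x z n)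
  right : ∀ (x y z : A.Obj) (i j n : ℤ), i + j = n →
    (obj y z i →ₗ[k] A.Hom x y j →ₗ[k] obj x z n)
  id_left : ∀ (x y : A.Obj) (n : ℤ) (m : obj x y n),
    left x y y 0 n n (zero_add n) (A.id y) m = m
  right_id : ∀ (x y : A.Obj) (n : ℤ) (m : obj x y n),
    right x x y n 0 n (add_zero n) m (A.id x) = m
  left_left : ∀ (x y z w : A.Obj) (a b c ab bc abc : ℤ) (h₁ : a + b = ab) (h₂ : b + c = bc)
    (h₃ : ab + c = abc) (h₄ : a + bc = abc) (f : A.Hom z w a) (g : A.Hom y z b) (m : obj x y c),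
    left x y w ab c abc h₃ (A.comp y z w a b ab h₁ f g) m =
      left x z w a bc abc h₄ f (left x y z b c bc h₂ g m)
  left_right : ∀ (x y z w : A.Obj) (a b c ab bc abc : ℤ) (h₁ : a + b = ab) (h₂ : b + c = bc)
    (h₃ : ab + c = abc) (h₄ : a + bc = abc) (f : A.Hom z w a) (m : obj y z b) (h : A.Hom x y c),
    right x y w ab c abc h₃ (left y z w a b ab h₁ f m) h =
      left x z w a bc abc h₄ f (right x y z b c bc h₂ m h)
  right_right : ∀ (x y z w : A.Obj) (a b c ab bc abc : ℤ) (h₁ : a + b = ab) (h₂ : b + c = bc)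
    (h₃ : ab + c = abc) (h₄ : a + bc = abc) (m : obj z w a) (g : A.Hom y z b) (h : A.Hom x y c),
    right x y w ab c abc h₃ (right y z w a b ab h₁ m g) h =
      right x z w a bc abc h₄ m (A.comp x y z b c bc h₂ g h)

attribute [instance] GrBimod.addCommGroup GrBimod.module

/-- A bimodule over a differential graded category. -/
structure DGBimod {k : Type uk} [Field k] (A : DGCat.{uk, u, v} k) extends
    GrBimod.{uk, u, v, w} A.toGrCat where
  d : ∀ (x y : A.Obj) (n m : ℤ), m + 1 = n → (obj x y n →ₗ[k] obj x y m)
  d_d : ∀ (x y : A.Obj) (n m l : ℤ) (h : m + 1 = n) (h' : l + 1 = m) (a : obj x y n),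
    d x y m l h' (d x y n m h a) = 0
  leibniz_left : ∀ x y z : A.Obj, Hlgy.Leibniz (A.d y z) (d x y) (d x z) (left x y z)
  leibniz_right : ∀ x y z : A.Obj, Hlgy.Leibniz (d y z) (A.d x y) (d x z) (right x y z)

section Constructions

variable {k : Type uk} [Field k]

/-- The standard bimodule `A` over the differential graded category `A`. -/
def DGCat.self (A : DGCat.{uk, u, v} k) : DGBimod.{uk, u, v, v} A where
  obj := A.Hom
  left := A.comp
  right := A.comp
  id_left := A.id_comp
  right_id := A.comp_id
  left_left := A.assoc
  left_right := A.assoc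
  right_right := A.assoc
  d := A.d
  d_d := A.d_d
  leibniz_left := A.leibniz
  leibniz_right := A.leibniz

/-- The suspension `Σ^t M` of a graded bimodule: `(Σ^t M)_m = M_{m - t}`, with the Koszul sign
`(-1)^{t |f|}` in the left action of `f`. -/
def GrBimod.shift {A : GrCat.{uk, u, v} k} (M : GrBimod.{uk, u, v, w} A) (t : ℤ) :
    GrBimod.{uk, u, v, w} A where
  obj x y m := M.obj x y (m - t)
  left x y z i j n h := sgn k (i * t) • M.left x y z i (j - t) (n - t) (by omega)
  right x y z i j n h := M.right x y z (i - t) j (n - t) (by omega)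
  id_left x y n m := by
    simp only [zero_mul, sgn_zero, one_smul]
    exact M.id_left _ _ _ _
  right_id x y n m := M.right_id _ _ _ _
  left_left x y z w a b c ab bc abc h₁ h₂ h₃ h₄ f g m := by
    subst h₁
    simp only [LinearMap.smul_apply, map_smul, smul_smul, add_mul, sgn_add, mul_comm (sgn k (b * t))]
    rw [M.left_left x y z w a b (c - t) (a + b) (bc - t) (abc - t) rfl (by omega) (by omega)
      (by omega)]
  left_right x y z w a b c ab bc abc h₁ h₂ h₃ h₄ f m h := by
    simp only [LinearMap.smul_apply, map_smul]
    rw [M.left_right x y z w a (b - t) c (ab - t) (bc - t) (abc - t) (by omega) (by omega)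
      (by omega) (by omega)]
  right_right x y z w a b c ab bc abc h₁ h₂ h₃ h₄ m g h :=
    M.right_right x y z w (a - t) b c (ab - t) bc (abc - t) (by omega) h₂ (by omega) (by omega)
      m g h

theorem DGCat.d_id (A : DGCat.{uk, u, v} k) (x : A.Obj) :
    A.d x x 0 (0 - 1) (by omega) (A.id x) = 0 := by
  have h := A.leibniz x x x 0 0 0 (0 - 1) (0 - 1) (0 - 1) (add_zero 0) (by omega) (by omega)
    (by omega) (A.id x) (A.id x)
  have e₁ : A.comp x x x 0 0 0 (add_zero 0) (A.id x) (A.id x) = A.id x := A.comp_id _ _ _ _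
  have e₂ : A.comp x x x (0 - 1) 0 (0 - 1) (by omega) (A.d x x 0 (0 - 1) (by omega) (A.id x))
      (A.id x) = A.d x x 0 (0 - 1) (by omega) (A.id x) := A.comp_id _ _ _ _
  have e₃ : A.comp x x x 0 (0 - 1) (0 - 1) (by omega) (A.id x)
      (A.d x x 0 (0 - 1) (by omega) (A.id x)) = A.d x x 0 (0 - 1) (by omega) (A.id x) :=
    A.id_comp _ _ _ _
  rw [e₁, e₂, e₃, sgn_zero, one_smul] at h
  simpa using h

/-- The homology category `H_• A`. -/
def DGCat.homology (A : DGCat.{uk, u, v} k) : GrCat.{uk, u, v} k where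
  Obj := A.Obj
  Hom x y n := Hlgy (A.d x y) n
  id x := Hlgy.mk (A.d x x) 0 ⟨A.id x, A.d_id x⟩
  comp x y z i j n h := Hlgy.pair (A.leibniz x y z) i j n h
  id_comp x y n f := by
    obtain ⟨f, rfl⟩ := Hlgy.mk_surjective _ _ f
    rw [Hlgy.pair_mk]
    exact congrArg _ (Subtype.ext (A.id_comp _ _ _ _))
  comp_id x y n f := by
    obtain ⟨f, rfl⟩ := Hlgy.mk_surjective _ _ f
    rw [Hlgy.pair_mk]
    exact congrArg _ (Subtype.ext (A.comp_id _ _ _ _))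
  assoc x y z w a b c ab bc abc h₁ h₂ h₃ h₄ f g h := by
    obtain ⟨f, rfl⟩ := Hlgy.mk_surjective _ _ f
    obtain ⟨g, rfl⟩ := Hlgy.mk_surjective _ _ g
    obtain ⟨h, rfl⟩ := Hlgy.mk_surjective _ _ h
    simp only [Hlgy.pair_mk]
    exact congrArg _ (Subtype.ext (A.assoc _ _ _ _ _ _ _ _ _ _ h₁ h₂ h₃ h₄ _ _ _))

/-- The homology bimodule `H_• M` over the homology category. -/
def DGBimod.homology {A : DGCat.{uk, u, v} k} (M : DGBimod.{uk, u, v, w} A) :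
    GrBimod.{uk, u, v, w} A.homology where
  obj := fun (x y : A.Obj) n => Hlgy (M.d x y) n
  left := fun (x y z : A.Obj) i j n h => Hlgy.pair (M.leibniz_left x y z) i j n h
  right := fun (x y z : A.Obj) i j n h => Hlgy.pair (M.leibniz_right x y z) i j n h
  id_left := fun (x y : A.Obj) n m => by
    obtain ⟨m, rfl⟩ := Hlgy.mk_surjective (M.d _ _) _ m
    exact congrArg (Hlgy.mk _ _) (Subtype.ext (M.id_left _ _ _ _))
  right_id := fun (x y : A.Obj) n m => by
    obtain ⟨m, rfl⟩ := Hlgy.mk_surjective (M.d _ _) _ m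
    exact congrArg (Hlgy.mk _ _) (Subtype.ext (M.right_id _ _ _ _))
  left_left := fun (x y z w : A.Obj) a b c ab bc abc h₁ h₂ h₃ h₄ f g m => by
    obtain ⟨f, rfl⟩ := Hlgy.mk_surjective (A.d _ _) _ f
    obtain ⟨g, rfl⟩ := Hlgy.mk_surjective (A.d _ _) _ g
    obtain ⟨m, rfl⟩ := Hlgy.mk_surjective (M.d _ _) _ m
    exact congrArg (Hlgy.mk _ _)
      (Subtype.ext (M.left_left _ _ _ _ _ _ _ _ _ _ h₁ h₂ h₃ h₄ _ _ _))
  left_right := fun (x y z w : A.Obj) a b c ab bc abc h₁ h₂ h₃ h₄ f m h => by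
    obtain ⟨f, rfl⟩ := Hlgy.mk_surjective (A.d _ _) _ f
    obtain ⟨m, rfl⟩ := Hlgy.mk_surjective (M.d _ _) _ m
    obtain ⟨h, rfl⟩ := Hlgy.mk_surjective (A.d _ _) _ h
    exact congrArg (Hlgy.mk _ _)
      (Subtype.ext (M.left_right _ _ _ _ _ _ _ _ _ _ h₁ h₂ h₃ h₄ _ _ _))
  right_right := fun (x y z w : A.Obj) a b c ab bc abc h₁ h₂ h₃ h₄ m g h => by
    obtain ⟨m, rfl⟩ := Hlgy.mk_surjective (M.d _ _) _ m
    obtain ⟨g, rfl⟩ := Hlgy.mk_surjective (A.d _ _) _ g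
    obtain ⟨h, rfl⟩ := Hlgy.mk_surjective (A.d _ _) _ h
    exact congrArg (Hlgy.mk _ _)
      (Subtype.ext (M.right_right _ _ _ _ _ _ _ _ _ _ h₁ h₂ h₃ h₄ _ _ _))

end Constructions

/-! ### Hochschild cochains -/

section Hochschild

variable {k : Type uk} [Field k]

/-- Composable strings `f_1 ⊗ ⋯ ⊗ f_s` of homogeneous morphisms `f_i : x_i ⟶ x_{i-1}` in `A`.
In `A.Str s x y n` the source is `x = x_s`, the target is `y = x_0`, and `n` is the total degree.
The string `cons f σ` is `f ⊗ σ`. -/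
inductive GrCat.Str (A : GrCat.{uk, u, v} k) : ℕ → A.Obj → A.Obj → ℤ → Type (max u v)
  | nil (x : A.Obj) : GrCat.Str A 0 x x 0
  | cons {s : ℕ} {x z y : A.Obj} {i j n : ℤ} (f : A.Hom z y i) (σ : GrCat.Str A s x z j)
      (h : i + j = n) : GrCat.Str A (s + 1) x y n

namespace GrCat.Str

variable {A : GrCat.{uk, u, v} k}

/-- `IsAdd σ τ ρ`: the strings agree in all positions but one, where the entry of `ρ` is the sum
of the entries of `σ` and `τ`. -/
inductive IsAdd : ∀ {s : ℕ} {x y : A.Obj} {n : ℤ},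
    A.Str s x y n → A.Str s x y n → A.Str s x y n → Prop
  | head {s : ℕ} {x z y : A.Obj} {i j n : ℤ} (f g : A.Hom z y i) (σ : A.Str s x z j)
      (h : i + j = n) : IsAdd (cons f σ h) (cons g σ h) (cons (f + g) σ h)
  | tail {s : ℕ} {x z y : A.Obj} {i j n : ℤ} (f : A.Hom z y i) {σ τ ρ : A.Str s x z j}
      (h : i + j = n) : IsAdd σ τ ρ → IsAdd (cons f σ h) (cons f τ h) (cons f ρ h)

/-- `IsSMul c σ τ`: the strings agree in all positions but one, where the entry of `τ` is `c`
times the entry of `σ`. -/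
inductive IsSMul (c : k) : ∀ {s : ℕ} {x y : A.Obj} {n : ℤ},
    A.Str s x y n → A.Str s x y n → Prop
  | head {s : ℕ} {x z y : A.Obj} {i j n : ℤ} (f : A.Hom z y i) (σ : A.Str s x z j)
      (h : i + j = n) : IsSMul c (cons f σ h) (cons (c • f) σ h)
  | tail {s : ℕ} {x z y : A.Obj} {i j n : ℤ} (f : A.Hom z y i) {σ τ : A.Str s x z j}
      (h : i + j = n) : IsSMul c σ τ → IsSMul c (cons f σ h) (cons f τ h)

/-- `merge i (f_1 ⊗ ⋯ ⊗ f_{s+1})` composes the neighbours in positions `i` and `i + 1`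
(positions are counted from `0`). -/
def merge : ∀ {s : ℕ} {x y : A.Obj} {n : ℤ}, Fin s → A.Str (s + 1) x y n → A.Str s x y n
  | _ + 1, x, y, n, ⟨0, _⟩, @cons _ _ _ _ _ z _ a _ _ f (@cons _ _ _ _ _ z' _ b c _ g σ h) h' =>
      cons (A.comp z' z y a b (a + b) rfl f g) σ (by omega)
  | _ + 1, _, _, _, ⟨i + 1, hi⟩, cons f σ h => cons f (merge ⟨i, by omega⟩ σ) h

/-- A string of length `s + 1`, split into its first `s` entries and its last entry. -/
structure Split (A : GrCat.{uk, u, v} k) (s : ℕ) (x y : A.Obj) (n : ℤ) where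
  mid : A.Obj
  i : ℤ
  j : ℤ
  init : A.Str s mid y i
  last : A.Hom x mid j
  add_eq : i + j = n

/-- Splitting off the last entry of a string. -/
def split : ∀ {s : ℕ} {x y : A.Obj} {n : ℤ}, A.Str (s + 1) x y n → Split A s x y n
  | 0, _, y, _, @cons _ _ _ _ _ _ _ i _ _ f (nil _) _ => ⟨y, 0, i, nil y, f, by omega⟩
  | _ + 1, _, _, _, cons f σ h =>
      ⟨(split σ).mid, _, (split σ).j, cons f (split σ).init rfl, (split σ).last, by
        have := (split σ).add_eq
        omega⟩

/-- The total degree of the first `p` entries of a string. -/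
def prefixDeg : ∀ {s : ℕ} {x y : A.Obj} {n : ℤ}, ℕ → A.Str s x y n → ℤ
  | _, _, _, _, 0, _ => 0
  | _, _, _, _, _ + 1, nil _ => 0
  | _, _, _, _, p + 1, cons (i := i) _ σ _ => i + prefixDeg p σ

end GrCat.Str

/-- `A.dAt p σ` applies the differential of `A` to the entry in position `p` of `σ`. -/
def DGCat.dAt (A : DGCat.{uk, u, v} k) : ∀ {s : ℕ} {x y : A.Obj} {n : ℤ},
    Fin s → A.toGrCat.Str s x y n → A.toGrCat.Str s x y (n - 1)
  | _ + 1, _, y, _, ⟨0, _⟩, @GrCat.Str.cons _ _ _ _ _ z _ i _ _ f σ h =>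
      .cons (A.d z y i (i - 1) (Int.sub_add_cancel i 1) f) σ (by omega)
  | _ + 1, _, _, _, ⟨p + 1, hp⟩, .cons f σ h => .cons f (A.dAt ⟨p, by omega⟩ σ) (by omega)

namespace GrBimod

variable {A : GrCat.{uk, u, v} k} (M : GrBimod.{uk, u, v, w} A)

/-- Families of functions on strings of length `s` with values in `M`; a string of total degree
`n` from `x` to `y` has a value in `M(x, y)_m` for every `m`. -/
abbrev Raw (s : ℕ) : Type (max u v w) :=
  ∀ (x y : A.Obj) (n m : ℤ), A.Str s x y n → M.obj x y m

/-- The space `∏_{x_0, …, x_s} Hom(A(x_1, x_0) ⊗ ⋯ ⊗ A(x_s, x_{s-1}), M(x_s, x_0))^t`: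
multilinear functions on strings of length `s` that send strings of total degree `n` to
`M_{n - t}`. -/
def cochain (s : ℕ) (t : ℤ) : Submodule k (M.Raw s) where
  carrier := {φ |
    (∀ (x y : A.Obj) (n m : ℤ) (σ τ ρ : A.Str s x y n), GrCat.Str.IsAdd σ τ ρ →
      φ x y n m ρ = φ x y n m σ + φ x y n m τ) ∧
    (∀ (c : k) (x y : A.Obj) (n m : ℤ) (σ τ : A.Str s x y n), GrCat.Str.IsSMul c σ τ →
      φ x y n m τ = c • φ x y n m σ) ∧
    (∀ (x y : A.Obj) (n m : ℤ) (σ : A.Str s x y n), m + t ≠ n → φ x y n m σ = 0)}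
  add_mem' := by
    rintro φ ψ ⟨h₁, h₂, h₃⟩ ⟨h₁', h₂', h₃'⟩
    refine ⟨fun x y n m σ τ ρ h => ?_, fun c x y n m σ τ h => ?_, fun x y n m σ h => ?_⟩
    · simp only [Pi.add_apply, h₁ _ _ _ _ _ _ _ h, h₁' _ _ _ _ _ _ _ h]
      abel
    · simp only [Pi.add_apply, h₂ _ _ _ _ _ _ _ h, h₂' _ _ _ _ _ _ _ h, smul_add]
    · simp only [Pi.add_apply, h₃ _ _ _ _ _ h, h₃' _ _ _ _ _ h, add_zero]
  zero_mem' := ⟨by simp, by simp, by simp⟩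
  smul_mem' := by
    rintro c φ ⟨h₁, h₂, h₃⟩
    refine ⟨fun x y n m σ τ ρ h => ?_, fun c x y n m σ τ h => ?_, fun x y n m σ h => ?_⟩
    · simp only [Pi.smul_apply, h₁ _ _ _ _ _ _ _ h, smul_add]
    · simp only [Pi.smul_apply, h₂ _ _ _ _ _ _ _ h]
      rw [smul_comm]
    · simp only [Pi.smul_apply, h₃ _ _ _ _ _ h, smul_zero]

variable {M}

/-- `f_1 ⊗ ⋯ ⊗ f_{s+1} ↦ (-1)^{t |f_1|} f_1 · φ(f_2 ⊗ ⋯ ⊗ f_{s+1})`. -/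
def leftTerm {s : ℕ} (t : ℤ) (φ : M.Raw s) : M.Raw (s + 1)
  | x, y, n, m, @GrCat.Str.cons _ _ _ _ _ z _ i j _ f σ _ =>
      sgn k (t * i) • M.left x z y i (m - i) m (by omega) f (φ x z j (m - i) σ)

variable (M) in
/-- `f_1 ⊗ ⋯ ⊗ f_{s+1} ↦
∑_{i=1}^{s} (-1)^i φ(f_1 ⊗ ⋯ ⊗ f_i f_{i+1} ⊗ ⋯ ⊗ f_{s+1}) + (-1)^{s+1} φ(f_1 ⊗ ⋯ ⊗ f_s) · f_{s+1}`
for functions `φ` on the strings with a fixed target `z`. -/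
def innerTerm {s : ℕ} {y z : A.Obj} (φ : ∀ (x : A.Obj) (n m : ℤ), A.Str s x z n → M.obj x y m)
    (x : A.Obj) (n m : ℤ) (σ : A.Str (s + 1) x z n) : M.obj x y m :=
  (∑ i : Fin s, sgn k (i + 1) • φ x n m (σ.merge i)) +
    sgn k (s + 1) • M.right x σ.split.mid y (m - σ.split.j) σ.split.j m (by omega)
      (φ σ.split.mid σ.split.i (m - σ.split.j) σ.split.init) σ.split.last

/-- The Hochschild coboundary of a cochain of internal degree `t`: the alternating sum of the
cosimplicial coface maps
`φ ↦ (-1)^{t |f_1|} f_1 · φ(f_2 ⊗ ⋯) - φ(f_1 f_2 ⊗ ⋯) + ⋯ ± φ(⋯ ⊗ f_s) · f_{s+1}`. -/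
def bRaw {s : ℕ} (t : ℤ) (φ : M.Raw s) : M.Raw (s + 1) := fun x y n m σ =>
  leftTerm t φ x y n m σ + M.innerTerm (fun x' n' m' τ => φ x' y n' m' τ) x n m σ

end GrBimod

namespace DGBimod

variable {A : DGCat.{uk, u, v} k} (M : DGBimod.{uk, u, v, w} A)

/-- `f_1 ⊗ ⋯ ⊗ f_s ↦ ∑_p (-1)^{|f_1| + ⋯ + |f_{p-1}|} φ(f_1 ⊗ ⋯ ⊗ d f_p ⊗ ⋯ ⊗ f_s)`, for functions
`φ` on the strings with a fixed target `z`. -/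
def sourceTerm {s : ℕ} {y z : A.Obj}
    (φ : ∀ (x : A.Obj) (n m : ℤ), A.toGrCat.Str s x z n → M.obj x y m)
    (x : A.Obj) (n m : ℤ) (σ : A.toGrCat.Str s x z n) : M.obj x y m :=
  ∑ p : Fin s, sgn k (σ.prefixDeg p) • φ x (n - 1) m (A.dAt p σ)

variable {M}

/-- The internal differential `d ∘ φ - (-1)^t φ ∘ d` of a cochain of internal degree `t`. -/
def dRaw {s : ℕ} (t : ℤ) (φ : M.toGrBimod.Raw s) : M.toGrBimod.Raw s := fun x y n m σ =>
  M.d x y (m + 1) m rfl (φ x y n (m + 1) σ) -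
    sgn k t • M.sourceTerm (fun x' n' m' τ => φ x' y n' m' τ) x n m σ

end DGBimod

/-! Recursive formulas for the terms, and the identities between the differentials. -/

namespace GrBimod

variable {A : GrCat.{uk, u, v} k} {M : GrBimod.{uk, u, v, w} A}

/-- Partial evaluation at the first entry. -/
def pre {s : ℕ} {x₀ y z : A.Obj} {i : ℤ} (f : A.Hom y z i)
    (φ : ∀ (x : A.Obj) (n m : ℤ), A.Str (s + 1) x z n → M.obj x x₀ m) :
    ∀ (x : A.Obj) (n m : ℤ), A.Str s x y n → M.obj x x₀ m :=
  fun x n m σ => φ x (i + n) m (.cons f σ rfl)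

theorem innerTerm_one {x₀ x z : A.Obj} {i : ℤ}
    (φ : ∀ (x : A.Obj) (n m : ℤ), A.Str 0 x z n → M.obj x x₀ m) (f : A.Hom x z i) (n m : ℤ)
    (h : i + 0 = n) :
    M.innerTerm φ x n m (.cons f (.nil x) h) =
      - M.right x z x₀ (m - i) i m (by omega) (φ z 0 (m - i) (.nil z)) f := by
  simp only [innerTerm, Finset.univ_eq_empty, Finset.sum_empty, Nat.cast_zero, zero_add, sgn_one,
    neg_smul, one_smul]
  rfl

theorem innerTerm_succ {s : ℕ} {x₀ x y z z' : A.Obj} {a b c bc n : ℤ}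
    (φ : ∀ (x : A.Obj) (n m : ℤ), A.Str (s + 1) x z n → M.obj x x₀ m)
    (f : A.Hom y z a) (g : A.Hom z' y b) (σ : A.Str s x z' c) (h : b + c = bc)
    (h' : a + bc = n) (m : ℤ) :
    M.innerTerm φ x n m (.cons f (.cons g σ h) h') =
      - φ x n m (.cons (A.comp z' y z a b (a + b) rfl f g) σ (by omega)) -
        M.innerTerm (pre f φ) x bc m (.cons g σ h) := by
  subst h h'
  simp only [innerTerm, Fin.sum_univ_succ, neg_add, sub_eq_add_neg, add_assoc]
  congr 1
  · simp only [Fin.val_zero, Nat.cast_zero, zero_add, sgn_one, neg_smul, one_smul]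
    rfl
  · rw [← Finset.sum_neg_distrib]
    congr 1
    · refine Finset.sum_congr rfl fun i _ => ?_
      rw [← neg_smul]
      congr 1
      simp [sgn_add, sgn_one]
    · rw [← neg_smul]
      congr 1
      simp [sgn_add, sgn_one]

theorem innerTerm_add {s : ℕ} {y z : A.Obj}
    (φ ψ : ∀ (x : A.Obj) (n m : ℤ), A.Str s x z n → M.obj x y m)
    (x : A.Obj) (n m : ℤ) (σ : A.Str (s + 1) x z n) :
    M.innerTerm (φ + ψ) x n m σ = M.innerTerm φ x n m σ + M.innerTerm ψ x n m σ := by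
  simp only [innerTerm, Pi.add_apply, smul_add, Finset.sum_add_distrib, map_add,
    LinearMap.add_apply]
  abel

theorem innerTerm_smul {s : ℕ} {y z : A.Obj} (c : k)
    (φ : ∀ (x : A.Obj) (n m : ℤ), A.Str s x z n → M.obj x y m)
    (x : A.Obj) (n m : ℤ) (σ : A.Str (s + 1) x z n) :
    M.innerTerm (c • φ) x n m σ = c • M.innerTerm φ x n m σ := by
  simp only [innerTerm, Pi.smul_apply, smul_add, Finset.smul_sum, map_smul, LinearMap.smul_apply]
  congr 1
  · exact Finset.sum_congr rfl fun i _ => smul_comm _ _ _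
  · exact smul_comm _ _ _

theorem pre_eq {s : ℕ} {x₀ y z : A.Obj} {i : ℤ} (f : A.Hom y z i)
    (φ : ∀ (x : A.Obj) (n m : ℤ), A.Str (s + 1) x z n → M.obj x x₀ m)
    (x : A.Obj) (j n m : ℤ) (σ : A.Str s x y j) (h : i + j = n) :
    φ x n m (.cons f σ h) = pre f φ x j m σ := by
  subst h
  rfl

theorem cons_comp_eq {s : ℕ} {x y z w : A.Obj} {a b ab ab' j n : ℤ} (f : A.Hom z w a)
    (g : A.Hom y z b) (σ : A.Str s x y j) (h : a + b = ab) (h' : a + b = ab') (e : ab + j = n)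
    (e' : ab' + j = n) :
    GrCat.Str.cons (A.comp y z w a b ab h f g) σ e =
      .cons (A.comp y z w a b ab' h' f g) σ e' := by
  subst h h'
  rfl

theorem cons_assoc_eq {s : ℕ} {x y z w v : A.Obj} {a b c j n : ℤ} (f : A.Hom w v a)
    (g : A.Hom z w b) (h : A.Hom y z c) (σ : A.Str s x y j) (e : a + b + c + j = n)
    (e' : a + (b + c) + j = n) :
    GrCat.Str.cons (A.comp y w v a (b + c) _ rfl f (A.comp y z w b c _ rfl g h)) σ e' =
      .cons (A.comp y z v (a + b) c _ rfl (A.comp z w v a b _ rfl f g) h) σ e := by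
  rw [A.assoc y z w v a b c (a + b) (b + c) (a + b + c) rfl rfl rfl (by omega)]
  exact cons_comp_eq _ _ _ _ _ _ _

/-- `cons g σ ↦ φ (cons (f g) σ)`. -/
def dbl {s : ℕ} {x₀ y z : A.Obj} {a : ℤ} (f : A.Hom y z a)
    (φ : ∀ (x : A.Obj) (n m : ℤ), A.Str (s + 1) x z n → M.obj x x₀ m) :
    ∀ (x : A.Obj) (n m : ℤ), A.Str (s + 1) x y n → M.obj x x₀ m
  | x, n, m, @GrCat.Str.cons _ _ _ _ _ z' _ b _ _ g σ h =>
      φ x (a + n) m (.cons (A.comp z' y z a b _ rfl f g) σ (by omega))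

theorem pre_innerTerm {s : ℕ} {x₀ y z : A.Obj} {a : ℤ} (f : A.Hom y z a)
    (φ : ∀ (x : A.Obj) (n m : ℤ), A.Str (s + 1) x z n → M.obj x x₀ m) :
    pre f (M.innerTerm φ) = (-1 : k) • (dbl f φ + M.innerTerm (pre f φ)) := by
  funext x n m σ
  cases σ with
  | cons g σ h =>
    rw [pre, innerTerm_succ]
    simp only [Pi.smul_apply, Pi.add_apply, dbl]
    module

theorem innerTerm_dbl {s : ℕ} {x₀ x y z z' : A.Obj} {a b c n n' : ℤ} (f : A.Hom y z a)
    (φ : ∀ (x : A.Obj) (n m : ℤ), A.Str (s + 1) x z n → M.obj x x₀ m) (m : ℤ)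
    (g : A.Hom z' y b) (σ : A.Str (s + 1) x z' c) (h : b + c = n) (h' : a + b + c = n') :
    M.innerTerm (dbl f φ) x n m (.cons g σ h) =
      M.innerTerm φ x n' m (.cons (A.comp z' y z a b _ rfl f g) σ h') := by
  cases σ with
  | cons g' σ e =>
    rw [innerTerm_succ, innerTerm_succ]
    congr 1
    · congr 1
      obtain rfl : a + n = n' := by omega
      simp only [dbl]
      rw [cons_assoc_eq]
    · congr 1
      funext x n m τ
      simp only [pre, dbl]
      exact pre_eq _ _ _ _ _ _ _ _

theorem left_degree_eq {x y z : A.Obj} {i j j' n : ℤ} (h : i + j = n) (e : j = j')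
    (f : A.Hom y z i) (a : ∀ j, M.obj x y j) :
    M.left x y z i j n h f (a j) = M.left x y z i j' n (by omega) f (a j') := by
  subst e
  rfl

theorem right_degree_eq {x y z : A.Obj} {i j j' n : ℤ} (h : j + i = n) (e : j = j')
    (f : A.Hom x y i) (a : ∀ j, M.obj y z j) :
    M.right x y z j i n h (a j) f = M.right x y z j' i n (by omega) (a j') f := by
  subst e
  rfl

theorem innerTerm_innerTerm {s : ℕ} {x₀ z : A.Obj}
    (φ : ∀ (x : A.Obj) (n m : ℤ), A.Str s x z n → M.obj x x₀ m)
    (x : A.Obj) (n m : ℤ) (σ : A.Str (s + 2) x z n) :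
    M.innerTerm (M.innerTerm φ) x n m σ = 0 := by
  induction s generalizing z n with
  | zero =>
    match σ with
    | @GrCat.Str.cons _ _ _ _ _ y _ a j _ f (@GrCat.Str.cons _ _ _ _ _ _ _ b _ _ g (.nil _) h) h' =>
    subst h h'
    rw [innerTerm_succ, innerTerm_one, innerTerm_one]
    simp only [pre]
    rw [innerTerm_one, map_neg, LinearMap.neg_apply, neg_neg, neg_neg, sub_eq_zero,
      M.right_right x y z x₀ (m - b - a) a b (m - b) (a + b) m _ rfl _ (by omega)]
    exact right_degree_eq _ (by omega) _ (fun j => φ z 0 j (.nil z))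
  | succ s ih =>
    match σ with
    | @GrCat.Str.cons _ _ _ _ _ y _ a j _ f (@GrCat.Str.cons _ _ _ _ _ _ _ b c _ g τ h) h' =>
    have e : a + b + c = n := by omega
    rw [innerTerm_succ, pre_innerTerm, innerTerm_smul, innerTerm_add, ih,
      innerTerm_dbl f φ m g τ h e]
    module

theorem pre_leftTerm {s : ℕ} (t : ℤ) (φ : M.Raw s) {y z : A.Obj} {i : ℤ} (f : A.Hom y z i)
    (x : A.Obj) (n m : ℤ) (σ : A.Str s x y n) :
    pre f (fun x' n' m' τ => leftTerm t φ x' z n' m' τ) x n m σ =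
      sgn k (t * i) • M.left x y z i (m - i) m (by omega) f (φ x y n (m - i) σ) := rfl

/-- Left multiplication commutes with the inner terms. -/
theorem innerTerm_left {s : ℕ} {y z z' : A.Obj} {i : ℤ} (f : A.Hom y z i)
    (φ : ∀ (x : A.Obj) (n m : ℤ), A.Str s x z' n → M.obj x y m)
    (x : A.Obj) (n m : ℤ) (σ : A.Str (s + 1) x z' n) :
    M.innerTerm (fun x n m τ => M.left x y z i (m - i) m (by omega) f (φ x n (m - i) τ)) x n m σ =
      M.left x y z i (m - i) m (by omega) f (M.innerTerm φ x n (m - i) σ) := by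
  simp only [innerTerm, map_add, map_sum, map_smul]
  congr 2
  rw [M.left_right _ _ _ _ i (m - σ.split.j - i) σ.split.j _ (m - i) m _ (by omega) _ (by omega)]
  congr 1
  exact right_degree_eq (by omega) (by omega) _
    (fun j => φ σ.split.mid σ.split.i j σ.split.init)

theorem bRaw_bRaw {s : ℕ} (t : ℤ) (φ : M.Raw s) : bRaw t (bRaw t φ) = 0 := by
  funext x y n m σ
  match σ with
  | @GrCat.Str.cons _ _ _ _ _ z _ a _ _ f (@GrCat.Str.cons _ _ _ _ _ z' _ b c _ g ρ h) h' =>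
  subst h h'
  have hb : (fun x' n' m' τ => bRaw t φ x' y n' m' τ) =
      (fun x' n' m' τ => leftTerm t φ x' y n' m' τ) +
        M.innerTerm (fun x' n' m' τ => φ x' y n' m' τ) := rfl
  have hl : pre f (fun x' n' m' τ => leftTerm t φ x' y n' m' τ) =
      sgn k (t * a) • (fun x' n' m' τ => M.left x' z y a (m' - a) m' (by omega) f
        (φ x' z n' (m' - a) τ)) := rfl
  rw [bRaw, hb, innerTerm_add, innerTerm_innerTerm, innerTerm_succ, hl, innerTerm_smul,
    innerTerm_left f (fun x' n' m' τ => φ x' z n' m' τ)]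
  simp only [leftTerm, bRaw, map_add, map_smul, smul_add, mul_add, sgn_add, add_zero, Pi.zero_apply]
  rw [M.left_left _ _ _ _ a b (m - (a + b)) (a + b) (m - a) m rfl (by omega) _ (by omega),
    left_degree_eq (M := M) (j' := m - (a + b)) (i := b) (j := m - a - b) (n := m - a) (by omega)
      (by omega) g (fun j => φ x z' c j ρ)]
  module

/-! The differentials preserve multilinearity and degrees. -/

/-- Additivity in each entry, for functions on the strings with a fixed target. -/
def Additive' {s : ℕ} {y z : A.Obj}
    (φ : ∀ (x : A.Obj) (n m : ℤ), A.Str s x z n → M.obj x y m) : Prop :=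
  ∀ (x : A.Obj) (n m : ℤ) (σ τ ρ : A.Str s x z n), GrCat.Str.IsAdd σ τ ρ →
    φ x n m ρ = φ x n m σ + φ x n m τ

/-- Homogeneity in each entry, for functions on the strings with a fixed target. -/
def Homog {s : ℕ} {y z : A.Obj}
    (φ : ∀ (x : A.Obj) (n m : ℤ), A.Str s x z n → M.obj x y m) : Prop :=
  ∀ (c : k) (x : A.Obj) (n m : ℤ) (σ τ : A.Str s x z n), GrCat.Str.IsSMul c σ τ →
    φ x n m τ = c • φ x n m σ

theorem Additive'.pre {s : ℕ} {x₀ y z : A.Obj} {i : ℤ} (f : A.Hom y z i)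
    {φ : ∀ (x : A.Obj) (n m : ℤ), A.Str (s + 1) x z n → M.obj x x₀ m} (h : Additive' φ) :
    Additive' (pre f φ) :=
  fun x n m _ _ _ e => h x (i + n) m _ _ _ (.tail f rfl e)

theorem Homog.pre {s : ℕ} {x₀ y z : A.Obj} {i : ℤ} (f : A.Hom y z i)
    {φ : ∀ (x : A.Obj) (n m : ℤ), A.Str (s + 1) x z n → M.obj x x₀ m} (h : Homog φ) :
    Homog (GrBimod.pre f φ) :=
  fun c x n m _ _ e => h c x (i + n) m _ _ (.tail f rfl e)

theorem Additive'.pre_add {s : ℕ} {x₀ y z : A.Obj} {i : ℤ} (f g : A.Hom y z i)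
    {φ : ∀ (x : A.Obj) (n m : ℤ), A.Str (s + 1) x z n → M.obj x x₀ m} (h : Additive' φ) :
    GrBimod.pre (f + g) φ = GrBimod.pre f φ + GrBimod.pre g φ := by
  funext x n m σ
  exact h x (i + n) m _ _ _ (.head f g σ rfl)

theorem Homog.pre_smul {s : ℕ} {x₀ y z : A.Obj} {i : ℤ} (c : k) (f : A.Hom y z i)
    {φ : ∀ (x : A.Obj) (n m : ℤ), A.Str (s + 1) x z n → M.obj x x₀ m} (h : Homog φ) :
    GrBimod.pre (c • f) φ = c • GrBimod.pre f φ := by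
  funext x n m σ
  exact h c x (i + n) m _ _ (.head f σ rfl)

theorem Additive'.innerTerm {s : ℕ} {x₀ z : A.Obj}
    {φ : ∀ (x : A.Obj) (n m : ℤ), A.Str s x z n → M.obj x x₀ m} (h : Additive' φ) :
    Additive' (M.innerTerm φ) := by
  intro x n m σ τ ρ e
  induction s generalizing z n with
  | zero =>
    cases e with
    | head f g σ h' =>
      cases σ
      simp only [innerTerm_one, map_add, neg_add]
    | tail f h' e => cases e
  | succ s ih =>
    cases e with
    | head f g σ h' =>
      cases σ
      rw [innerTerm_succ, innerTerm_succ, innerTerm_succ, h.pre_add, innerTerm_add]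
      simp only [map_add, LinearMap.add_apply, h _ _ _ _ _ _ (.head _ _ _ _)]
      abel
    | tail f h' e =>
      have ih' := ih (h.pre f) _ _ _ _ e
      cases e with
      | head g g' σ h'' =>
        rw [innerTerm_succ, innerTerm_succ, innerTerm_succ, ih']
        simp only [map_add, h _ _ _ _ _ _ (.head _ _ _ _)]
        abel
      | tail g h'' e =>
        rw [innerTerm_succ, innerTerm_succ, innerTerm_succ, ih',
          h _ _ _ _ _ _ (.tail _ _ e)]
        abel

theorem Homog.innerTerm {s : ℕ} {x₀ z : A.Obj}
    {φ : ∀ (x : A.Obj) (n m : ℤ), A.Str s x z n → M.obj x x₀ m} (h : Homog φ) :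
    Homog (M.innerTerm φ) := by
  intro c x n m σ τ e
  induction s generalizing z n with
  | zero =>
    cases e with
    | head f σ h' =>
      cases σ
      simp only [innerTerm_one, map_smul, smul_neg]
    | tail f h' e => cases e
  | succ s ih =>
    cases e with
    | head f σ h' =>
      cases σ
      rw [innerTerm_succ, innerTerm_succ, h.pre_smul, innerTerm_smul]
      simp only [map_smul, LinearMap.smul_apply, h _ _ _ _ _ _ (.head _ _ _)]
      module
    | tail f h' e =>
      have ih' := ih (h.pre f) _ _ _ e
      cases e with
      | head g σ h'' =>
        rw [innerTerm_succ, innerTerm_succ, ih']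
        simp only [map_smul, h _ _ _ _ _ _ (.head _ _ _)]
        module
      | tail g h'' e =>
        rw [innerTerm_succ, innerTerm_succ, ih', h _ _ _ _ _ _ (.tail _ _ e)]
        module

theorem bRaw_mem {s : ℕ} {t : ℤ} {φ : M.Raw s} (h : φ ∈ M.cochain s t) :
    bRaw t φ ∈ M.cochain (s + 1) t := by
  obtain ⟨h₁, h₂, h₃⟩ := h
  have h₁' : ∀ y, Additive' (fun x' n' m' τ => φ x' y n' m' τ) :=
    fun y x n m _ _ _ e => h₁ x y n m _ _ _ e
  have h₂' : ∀ y, Homog (fun x' n' m' τ => φ x' y n' m' τ) :=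
    fun y c x n m _ _ e => h₂ c x y n m _ _ e
  refine ⟨fun x y n m σ τ ρ e => ?_, fun c x y n m σ τ e => ?_, fun x y n m σ e => ?_⟩
  · rw [bRaw, bRaw, bRaw, (h₁' y).innerTerm _ _ _ _ _ _ e]
    have : leftTerm t φ x y n m ρ = leftTerm t φ x y n m σ + leftTerm t φ x y n m τ := by
      cases e with
      | head f g σ h' => simp only [leftTerm, map_add, LinearMap.add_apply, smul_add]
      | tail f h' e => simp only [leftTerm, h₁ _ _ _ _ _ _ _ e, map_add, smul_add]
    rw [this]
    abel
  · rw [bRaw, bRaw, (h₂' y).innerTerm _ _ _ _ _ _ e]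
    have : leftTerm t φ x y n m τ = c • leftTerm t φ x y n m σ := by
      cases e with
      | head f σ h' => simp only [leftTerm, map_smul, LinearMap.smul_apply, smul_comm c]
      | tail f h' e => simp only [leftTerm, h₂ _ _ _ _ _ _ _ e, map_smul, smul_comm c]
    rw [this, smul_add]
  · have e₁ : leftTerm t φ x y n m σ = 0 := by
      cases σ with
      | cons f σ h' =>
        rw [leftTerm, h₃ _ _ _ _ _ (by omega), map_zero, smul_zero]
    have e₂ := σ.split.add_eq
    rw [bRaw, e₁, innerTerm, h₃ _ _ _ _ _ (by omega), map_zero, LinearMap.zero_apply, smul_zero,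
      add_zero, zero_add]
    exact Finset.sum_eq_zero fun i _ => by rw [h₃ _ _ _ _ _ e, smul_zero]

/-- The Hochschild coboundary. -/
def b (M : GrBimod.{uk, u, v, w} A) (s : ℕ) (t : ℤ) : M.cochain s t →ₗ[k] M.cochain (s + 1) t where
  toFun φ := ⟨bRaw t φ.1, bRaw_mem φ.2⟩
  map_add' φ ψ := by
    refine Subtype.ext ?_
    funext x y n m σ
    have := innerTerm_add (M := M) (fun x' n' m' τ => φ.1 x' y n' m' τ)
      (fun x' n' m' τ => ψ.1 x' y n' m' τ) x n m σ
    have e : leftTerm t (φ.1 + ψ.1) x y n m σ =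
        leftTerm t φ.1 x y n m σ + leftTerm t ψ.1 x y n m σ := by
      cases σ
      simp only [leftTerm, Pi.add_apply, map_add, smul_add]
    change leftTerm t (φ.1 + ψ.1) x y n m σ + _ = (_ + _) + (_ + _)
    rw [e, add_add_add_comm, ← this]
    rfl
  map_smul' c φ := by
    refine Subtype.ext ?_
    funext x y n m σ
    have := innerTerm_smul (M := M) c (fun x' n' m' τ => φ.1 x' y n' m' τ) x n m σ
    have e : leftTerm t (c • φ.1) x y n m σ = c • leftTerm t φ.1 x y n m σ := by
      cases σ
      simp only [leftTerm, Pi.smul_apply, map_smul, smul_comm c]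
    change leftTerm t (c • φ.1) x y n m σ + _ = c • (_ + _)
    rw [e, smul_add, ← this]
    rfl

theorem b_b (M : GrBimod.{uk, u, v, w} A) (s : ℕ) (t : ℤ) (φ : M.cochain s t) :
    M.b (s + 1) t (M.b s t φ) = 0 :=
  Subtype.ext (bRaw_bRaw t φ.1)

end GrBimod

namespace DGBimod

open GrBimod

variable {A : DGCat.{uk, u, v} k} {M : DGBimod.{uk, u, v, w} A}

theorem sourceTerm_nil {x₀ x : A.Obj}
    (φ : ∀ (x' : A.Obj) (n m : ℤ), A.toGrCat.Str 0 x' x n → M.obj x' x₀ m) (m : ℤ) :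
    M.sourceTerm φ x 0 m (.nil x) = 0 := by
  simp [sourceTerm]

theorem sourceTerm_cons {s : ℕ} {x₀ x y z : A.Obj} {i j n : ℤ}
    (φ : ∀ (x : A.Obj) (n m : ℤ), A.toGrCat.Str (s + 1) x z n → M.obj x x₀ m)
    (f : A.Hom y z i) (σ : A.toGrCat.Str s x y j) (h : i + j = n) (m : ℤ) :
    M.sourceTerm φ x n m (.cons f σ h) =
      φ x (n - 1) m (.cons (A.d y z i (i - 1) (Int.sub_add_cancel i 1) f) σ (by omega)) +
        sgn k i • M.sourceTerm (pre (M := M.toGrBimod) f φ) x j m σ := by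
  simp only [sourceTerm, Fin.sum_univ_succ]
  congr 1
  · simp only [Fin.val_zero, GrCat.Str.prefixDeg, sgn_zero, one_smul]
    rfl
  · rw [Finset.smul_sum]
    refine Finset.sum_congr rfl fun p _ => ?_
    simp only [Fin.val_succ, GrCat.Str.prefixDeg, sgn_add, mul_smul]
    congr 2
    exact pre_eq (M := M.toGrBimod) f φ x (j - 1) (n - 1) m (A.dAt p σ) (by omega)

theorem sourceTerm_add {s : ℕ} {y z : A.Obj}
    (φ ψ : ∀ (x : A.Obj) (n m : ℤ), A.toGrCat.Str s x z n → M.obj x y m)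
    (x : A.Obj) (n m : ℤ) (σ : A.toGrCat.Str s x z n) :
    M.sourceTerm (φ + ψ) x n m σ = M.sourceTerm φ x n m σ + M.sourceTerm ψ x n m σ := by
  simp only [sourceTerm, Pi.add_apply, smul_add, Finset.sum_add_distrib]

theorem sourceTerm_smul {s : ℕ} {y z : A.Obj} (c : k)
    (φ : ∀ (x : A.Obj) (n m : ℤ), A.toGrCat.Str s x z n → M.obj x y m)
    (x : A.Obj) (n m : ℤ) (σ : A.toGrCat.Str s x z n) :
    M.sourceTerm (c • φ) x n m σ = c • M.sourceTerm φ x n m σ := by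
  simp only [sourceTerm, Pi.smul_apply, Finset.smul_sum, smul_comm c]

theorem sourceTerm_additive {s : ℕ} {x₀ z : A.Obj}
    {φ : ∀ (x : A.Obj) (n m : ℤ), A.toGrCat.Str s x z n → M.obj x x₀ m}
    (h : Additive' (M := M.toGrBimod) φ) : Additive' (M := M.toGrBimod) (M.sourceTerm φ) := by
  intro x n m σ τ ρ e
  induction e with
  | head f g σ h' =>
    rw [sourceTerm_cons, sourceTerm_cons, sourceTerm_cons, h.pre_add, sourceTerm_add, map_add,
      h _ _ _ _ _ _ (.head _ _ _ _), smul_add]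
    abel
  | tail f h' e ih =>
    rw [sourceTerm_cons, sourceTerm_cons, sourceTerm_cons, ih (h.pre f),
      h _ _ _ _ _ _ (.tail _ _ e), smul_add]
    abel

theorem sourceTerm_homog {s : ℕ} {x₀ z : A.Obj}
    {φ : ∀ (x : A.Obj) (n m : ℤ), A.toGrCat.Str s x z n → M.obj x x₀ m}
    (h : Homog (M := M.toGrBimod) φ) : Homog (M := M.toGrBimod) (M.sourceTerm φ) := by
  intro c x n m σ τ e
  induction e with
  | head f σ h' =>
    rw [sourceTerm_cons, sourceTerm_cons, h.pre_smul, sourceTerm_smul, map_smul,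
      h _ _ _ _ _ _ (.head _ _ _)]
    module
  | tail f h' e ih =>
    rw [sourceTerm_cons, sourceTerm_cons, ih (h.pre f), h _ _ _ _ _ _ (.tail _ _ e)]
    module

theorem dRaw_mem {s : ℕ} {t t' : ℤ} (ht : t + 1 = t') {φ : M.toGrBimod.Raw s}
    (h : φ ∈ M.toGrBimod.cochain s t) : dRaw t φ ∈ M.toGrBimod.cochain s t' := by
  obtain ⟨h₁, h₂, h₃⟩ := h
  have h₁' : ∀ y, Additive' (M := M.toGrBimod) (fun x' n' m' τ => φ x' y n' m' τ) :=
    fun y x n m _ _ _ e => h₁ x y n m _ _ _ e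
  have h₂' : ∀ y, Homog (M := M.toGrBimod) (fun x' n' m' τ => φ x' y n' m' τ) :=
    fun y c x n m _ _ e => h₂ c x y n m _ _ e
  refine ⟨fun x y n m σ τ ρ e => ?_, fun c x y n m σ τ e => ?_, fun x y n m σ e => ?_⟩
  · rw [dRaw, dRaw, dRaw, sourceTerm_additive (h₁' y) _ _ _ _ _ _ e, h₁ _ _ _ _ _ _ _ e, map_add]
    module
  · rw [dRaw, dRaw, sourceTerm_homog (h₂' y) _ _ _ _ _ _ e, h₂ _ _ _ _ _ _ _ e, map_smul]
    module
  · rw [dRaw, h₃ _ _ _ _ _ (by omega), map_zero, sourceTerm, Finset.sum_eq_zero, smul_zero,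
      sub_zero]
    intro p _
    rw [h₃ _ _ _ _ _ (by omega), smul_zero]

/-- The internal differential. -/
def dInt (M : DGBimod.{uk, u, v, w} A) (s : ℕ) (t t' : ℤ) (ht : t + 1 = t') :
    M.toGrBimod.cochain s t →ₗ[k] M.toGrBimod.cochain s t' where
  toFun φ := ⟨dRaw t φ.1, dRaw_mem ht φ.2⟩
  map_add' φ ψ := by
    refine Subtype.ext ?_
    funext x y n m σ
    have := sourceTerm_add (M := M) (fun x' n' m' τ => φ.1 x' y n' m' τ)
      (fun x' n' m' τ => ψ.1 x' y n' m' τ) x n m σ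
    change M.d x y (m + 1) m rfl (φ.1 x y n (m + 1) σ + ψ.1 x y n (m + 1) σ) -
      sgn k t • M.sourceTerm ((fun x' n' m' τ => φ.1 x' y n' m' τ) +
        (fun x' n' m' τ => ψ.1 x' y n' m' τ)) x n m σ =
      (_ - sgn k t • _) + (_ - sgn k t • _)
    rw [this, map_add]
    module
  map_smul' c φ := by
    refine Subtype.ext ?_
    funext x y n m σ
    have := sourceTerm_smul (M := M) c (fun x' n' m' τ => φ.1 x' y n' m' τ) x n m σ
    change M.d x y (m + 1) m rfl (c • φ.1 x y n (m + 1) σ) -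
      sgn k t • M.sourceTerm (c • (fun x' n' m' τ => φ.1 x' y n' m' τ)) x n m σ =
      c • (_ - sgn k t • _)
    rw [this, map_smul]
    module

theorem d_degree_eq {x y : A.Obj} {p p' m : ℤ} (h : m + 1 = p) (e : p = p')
    (a : ∀ j, M.obj x y j) :
    M.d x y p m h (a p) = M.d x y p' m (by omega) (a p') := by
  subst e
  rfl

theorem additive_zero {s : ℕ} {x₀ x y z : A.Obj} {i j n : ℤ}
    {φ : ∀ (x : A.Obj) (n m : ℤ), A.toGrCat.Str (s + 1) x z n → M.obj x x₀ m}
    (h : Additive' (M := M.toGrBimod) φ) (σ : A.toGrCat.Str s x y j) (e : i + j = n) (m : ℤ) :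
    φ x n m (.cons (0 : A.Hom y z i) σ e) = 0 := by
  have := h x n m _ _ _ (.head (0 : A.Hom y z i) 0 σ e)
  simpa using this

theorem pre_sourceTerm {s : ℕ} {x₀ y z : A.Obj} {i : ℤ}
    (φ : ∀ (x : A.Obj) (n m : ℤ), A.toGrCat.Str (s + 1) x z n → M.obj x x₀ m)
    (f : A.Hom y z i) :
    pre (M := M.toGrBimod) f (M.sourceTerm φ) =
      pre (M := M.toGrBimod) (A.d y z i (i - 1) (Int.sub_add_cancel i 1) f) φ +
        sgn k i • M.sourceTerm (pre (M := M.toGrBimod) f φ) := by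
  funext x n m σ
  rw [pre, sourceTerm_cons]
  exact congrArg (· + _) (pre_eq (M := M.toGrBimod) _ φ _ _ _ _ σ _)

theorem sourceTerm_sourceTerm {s : ℕ} {x₀ z : A.Obj}
    {φ : ∀ (x : A.Obj) (n m : ℤ), A.toGrCat.Str s x z n → M.obj x x₀ m}
    (h : Additive' (M := M.toGrBimod) φ) (x : A.Obj) (n m : ℤ) (σ : A.toGrCat.Str s x z n) :
    M.sourceTerm (M.sourceTerm φ) x n m σ = 0 := by
  induction σ with
  | nil => simp [sourceTerm]
  | cons f σ e ih =>
    rename_i i j n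
    rw [sourceTerm_cons, sourceTerm_cons, pre_sourceTerm, sourceTerm_add, sourceTerm_smul,
      ih (h.pre f), A.d_d, additive_zero h]
    rw [sgn_sub_one]
    module

/-- `d ∘ φ - (-1)^t φ ∘ d` for functions on the strings with a fixed target. -/
def dFix {s : ℕ} {y z : A.Obj} (t : ℤ)
    (φ : ∀ (x : A.Obj) (n m : ℤ), A.toGrCat.Str s x z n → M.obj x y m) :
    ∀ (x : A.Obj) (n m : ℤ), A.toGrCat.Str s x z n → M.obj x y m := fun x n m σ =>
  M.d x y (m + 1) m rfl (φ x n (m + 1) σ) - sgn k t • M.sourceTerm φ x n m σ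

theorem d_sourceTerm {s : ℕ} {y z : A.Obj}
    (φ : ∀ (x : A.Obj) (n m : ℤ), A.toGrCat.Str s x z n → M.obj x y m)
    (x : A.Obj) (n m : ℤ) (σ : A.toGrCat.Str s x z n) :
    M.sourceTerm (fun x n m τ => M.d x y (m + 1) m rfl (φ x n (m + 1) τ)) x n m σ =
      M.d x y (m + 1) m rfl (M.sourceTerm φ x n (m + 1) σ) := by
  simp only [sourceTerm, map_sum, map_smul]

theorem dRaw_dRaw {s : ℕ} {t t' : ℤ} (ht : t + 1 = t') {φ : M.toGrBimod.Raw s}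
    (h : φ ∈ M.toGrBimod.cochain s t) : dRaw t' (dRaw t φ) = 0 := by
  subst ht
  have h₁ : ∀ y, Additive' (M := M.toGrBimod) (fun x' n' m' τ => φ x' y n' m' τ) :=
    fun y x n m _ _ _ e => h.1 x y n m _ _ _ e
  funext x y n m σ
  have hd : (fun x' n' m' τ => dRaw t φ x' y n' m' τ) =
      (fun x' n' m' τ => M.d x' y (m' + 1) m' rfl (φ x' y n' (m' + 1) τ)) +
        (- sgn k t) • M.sourceTerm (fun x' n' m' τ => φ x' y n' m' τ) := by
    funext x' n' m' τ
    simp only [dRaw, Pi.add_apply, Pi.smul_apply]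
    module
  rw [dRaw, hd, sourceTerm_add, sourceTerm_smul, sourceTerm_sourceTerm (h₁ y),
    d_sourceTerm (fun x' n' m' τ => φ x' y n' m' τ), dRaw, map_sub, M.d_d, map_smul, sgn_add, sgn_one]
  simp only [Pi.zero_apply]
  module

theorem pre_dbl {s : ℕ} {x₀ y z z' : A.Obj} {a b : ℤ} (f : A.Hom y z a) (g : A.Hom z' y b)
    (φ : ∀ (x : A.Obj) (n m : ℤ), A.toGrCat.Str (s + 1) x z n → M.obj x x₀ m) :
    pre (M := M.toGrBimod) g (dbl (M := M.toGrBimod) f φ) =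
      pre (M := M.toGrBimod) (A.comp z' y z a b _ rfl f g) φ := by
  funext x n m τ
  simp only [pre, dbl]
  exact pre_eq (M := M.toGrBimod) _ _ _ _ _ _ _ _

theorem pre_dFix {s : ℕ} {x₀ y z : A.Obj} {i : ℤ} (t : ℤ)
    (φ : ∀ (x : A.Obj) (n m : ℤ), A.toGrCat.Str (s + 1) x z n → M.obj x x₀ m)
    (f : A.Hom y z i) :
    pre (M := M.toGrBimod) f (dFix t φ) =
      dFix (t - i) (pre (M := M.toGrBimod) f φ) +
        (- sgn k t) • pre (M := M.toGrBimod) (A.d y z i (i - 1) (Int.sub_add_cancel i 1) f) φ := by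
  funext x n m σ
  have e := congrFun (congrFun (congrFun (congrFun (pre_sourceTerm φ f) x) n) m) σ
  have e' : pre (M := M.toGrBimod) f (dFix t φ) x n m σ =
    M.d x x₀ (m + 1) m rfl (pre (M := M.toGrBimod) f φ x n (m + 1) σ) -
      sgn k t • pre (M := M.toGrBimod) f (M.sourceTerm φ) x n m σ := rfl
  have e'' : sgn k t = sgn k (t - i) * sgn k i := by rw [← sgn_add, Int.sub_add_cancel]
  have e3 : sgn k (t - i) = sgn k t * sgn k i := by
    rw [e'', mul_assoc, sgn_mul_self, mul_one]
  rw [e', e]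
  simp only [Pi.add_apply, Pi.smul_apply, dFix, e3]
  module

theorem dbl_cons {s : ℕ} {x₀ x y z z' : A.Obj} {a b ab c n n' : ℤ}
    (φ : ∀ (x : A.Obj) (n m : ℤ), A.toGrCat.Str (s + 1) x z n → M.obj x x₀ m)
    (f : A.Hom y z a) (g : A.Hom z' y b) (τ : A.toGrCat.Str s x z' c) (e : b + c = n)
    (hab : a + b = ab) (e' : ab + c = n') (m : ℤ) :
    dbl (M := M.toGrBimod) f φ x n m (.cons g τ e) =
      φ x n' m (.cons (A.comp z' y z a b ab hab f g) τ e') := by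
  obtain rfl : a + n = n' := by omega
  subst hab
  rfl

theorem leibniz_cons {s : ℕ} {x₀ x y z z' : A.Obj} {a b ab c n : ℤ}
    {φ : ∀ (x : A.Obj) (n m : ℤ), A.toGrCat.Str (s + 1) x z n → M.obj x x₀ m}
    (h : Additive' (M := M.toGrBimod) φ) (h' : Homog (M := M.toGrBimod) φ)
    (f : A.Hom y z a) (g : A.Hom z' y b) (τ : A.toGrCat.Str s x z' c) (hab : a + b = ab)
    (e : ab - 1 + c = n) (m : ℤ) :
    φ x n m (.cons (A.d z' z ab (ab - 1) (Int.sub_add_cancel ab 1)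
        (A.comp z' y z a b ab hab f g)) τ e) =
      φ x n m (.cons (A.comp z' y z (a - 1) b (a - 1 + b) rfl
        (A.d y z a (a - 1) (Int.sub_add_cancel a 1) f) g) τ (by omega)) +
      sgn k a • φ x n m (.cons (A.comp z' y z a (b - 1) (a + (b - 1)) rfl f
        (A.d z' y b (b - 1) (Int.sub_add_cancel b 1) g)) τ (by omega)) := by
  rw [A.leibniz z' y z a b ab (a - 1) (b - 1) (ab - 1) hab (Int.sub_add_cancel a 1)
    (Int.sub_add_cancel b 1) (Int.sub_add_cancel ab 1), h _ _ _ _ _ _ (.head _ _ _ _),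
    h' _ _ _ _ _ _ (.head _ _ _),
    cons_comp_eq (ab' := a - 1 + b) _ _ _ _ rfl _ (by omega),
    cons_comp_eq (ab' := a + (b - 1)) _ _ _ _ rfl _ (by omega)]

theorem dFix_innerTerm {s : ℕ} {x₀ z : A.Obj} {t : ℤ}
    {φ : ∀ (x : A.Obj) (n m : ℤ), A.toGrCat.Str s x z n → M.obj x x₀ m}
    (h : Additive' (M := M.toGrBimod) φ) (hh : Homog (M := M.toGrBimod) φ)
    (h' : ∀ (x : A.Obj) (n m : ℤ) (σ : A.toGrCat.Str s x z n), m + t ≠ n → φ x n m σ = 0)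
    (x : A.Obj) (n m : ℤ) (σ : A.toGrCat.Str (s + 1) x z n) :
    dFix t (M.innerTerm φ) x n m σ = M.innerTerm (dFix t φ) x n m σ := by
  induction s generalizing z n t with
  | zero =>
    match σ with
    | @GrCat.Str.cons _ _ _ _ _ y _ i _ _ f (.nil _) e =>
    rw [dFix, innerTerm_one, innerTerm_one, sourceTerm_cons, sourceTerm_nil, innerTerm_one,
      dFix, sourceTerm_nil, map_neg,
      M.leibniz_right y z x₀ (m + 1 - i) i (m + 1) (m - i) (i - 1) m _ (by omega) (by omega) rfl,
      d_degree_eq (p' := m - i + 1) _ (by omega) (fun j => φ z 0 j (.nil z)),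
      right_degree_eq (M := M.toGrBimod) (j' := m - (i - 1)) _ (by omega) _
        (fun j => φ z 0 j (.nil z))]
    by_cases hm : m - (i - 1) + t = 0
    · have : sgn k (m + 1 - i) = sgn k t := by
        rw [show m + 1 - i = -t by omega, sgn, sgn, zpow_neg, ← inv_zpow]
        simp
      rw [this]
      simp only [smul_zero, add_zero, sub_zero]
      module
    · rw [h' z 0 _ _ hm]
      simp
  | succ s ih =>
    match σ with
    | @GrCat.Str.cons _ _ _ _ _ y _ a j _ f (@GrCat.Str.cons _ _ _ _ _ y' _ b c _ g τ e) e' =>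
    have ih' := ih (t := t - a) (h.pre f) (hh.pre f) (fun x n m σ hm => h' x _ m _ (by omega)) j
      (.cons g τ e)
    have hm1 : pre (M := M.toGrBimod) f (M.innerTerm φ) = _ := pre_innerTerm f φ
    have e3 : sgn k (t - a) = sgn k t * sgn k a := by
      rw [← mul_one (sgn k (t - a)), ← sgn_mul_self k a, ← mul_assoc, ← sgn_add,
        Int.sub_add_cancel]
    rw [innerTerm_succ, pre_dFix, innerTerm_add, innerTerm_smul, ← ih', dFix, dFix, dFix,
      sourceTerm_cons, innerTerm_succ, innerTerm_succ, hm1, sourceTerm_smul, sourceTerm_add,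
      sourceTerm_cons (φ := dbl (M := M.toGrBimod) f φ), pre_dbl, sourceTerm_cons (φ := φ),
      leibniz_cons h hh, dbl_cons (ab := a + (b - 1)) (n' := n - 1) φ f _ τ _ rfl (by omega),
      map_sub, map_neg, e3, sgn_add]
    have e4 : sgn k a * sgn k a = 1 := sgn_mul_self k a
    generalize sgn k a = u at *
    generalize M.sourceTerm (pre (M := M.toGrBimod) _ φ) x c m τ = X1
    module

theorem sourceTerm_left {s : ℕ} {y z z' : A.Obj} {i : ℤ} (f : A.Hom y z i)
    (φ : ∀ (x : A.Obj) (n m : ℤ), A.toGrCat.Str s x z' n → M.obj x y m)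
    (x : A.Obj) (n m : ℤ) (σ : A.toGrCat.Str s x z' n) :
    M.sourceTerm (fun x n m τ => M.left x y z i (m - i) m (by omega) f (φ x n (m - i) τ)) x n m σ =
      M.left x y z i (m - i) m (by omega) f (M.sourceTerm φ x n (m - i) σ) := by
  simp only [sourceTerm, map_sum, map_smul]

theorem dRaw_leftTerm {s : ℕ} {t : ℤ} (φ : M.toGrBimod.Raw s) :
    dRaw t (leftTerm t φ) = leftTerm (t + 1) (dRaw t φ) := by
  funext x y n m σ
  match σ with
  | @GrCat.Str.cons _ _ _ _ _ z _ a j _ f τ e =>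
  have hl : pre (M := M.toGrBimod) f (fun x' n' m' τ => leftTerm t φ x' y n' m' τ) =
      sgn k (t * a) • (fun x' n' m' τ => M.left x' z y a (m' - a) m' (by omega) f
        (φ x' z n' (m' - a) τ)) := rfl
  rw [dRaw, sourceTerm_cons, hl, sourceTerm_smul, sourceTerm_left f (fun x' n' m' τ => φ x' z n' m' τ)]
  simp only [leftTerm, dRaw, map_smul, map_sub]
  rw [M.leibniz_left x z y a (m + 1 - a) (m + 1) (a - 1) (m - a) m _ (by omega) (by omega) rfl,
    d_degree_eq (p' := m - a + 1) (by omega) (by omega) (fun l => φ x z j l τ),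
    left_degree_eq (M := M.toGrBimod) (j' := m - (a - 1)) (i := a - 1) (j := m + 1 - a) (n := m)
      (by omega) (by omega) _ (fun l => φ x z j l τ), mul_sub, mul_one, sgn_sub, add_mul, one_mul,
    sgn_add]
  have e3 : sgn k t * sgn k t = 1 := sgn_mul_self k t
  generalize M.left x z y _ _ m _ (A.d z y a (a - 1) _ f) _ = X
  generalize M.left x z y a _ m _ f (M.sourceTerm _ x j _ τ) = Y
  generalize M.left x z y a _ m _ f _ = Z
  have e5 : sgn k t • (sgn k (t * a) * sgn k t) • X = sgn k (t * a) • X := by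
    rw [smul_smul, mul_left_comm, e3, mul_one]
  rw [smul_add, smul_add (sgn k t), e5]
  module

theorem dRaw_bRaw {s : ℕ} {t : ℤ} {φ : M.toGrBimod.Raw s} (h : φ ∈ M.toGrBimod.cochain s t) :
    dRaw t (bRaw t φ) = bRaw (t + 1) (dRaw t φ) := by
  funext x y n m σ
  have h₁ : Additive' (M := M.toGrBimod) (fun x' n' m' τ => φ x' y n' m' τ) :=
    fun x n m _ _ _ e => h.1 x y n m _ _ _ e
  have h₂ : Homog (M := M.toGrBimod) (fun x' n' m' τ => φ x' y n' m' τ) :=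
    fun c x n m _ _ e => h.2.1 c x y n m _ _ e
  have hb : (fun x' n' m' τ => bRaw t φ x' y n' m' τ) =
      (fun x' n' m' τ => leftTerm t φ x' y n' m' τ) +
        M.innerTerm (fun x' n' m' τ => φ x' y n' m' τ) := rfl
  have e1 := dFix_innerTerm (t := t) h₁ h₂ (fun x n m σ e => h.2.2 x y n m σ e) x n m σ
  have e2 := congrFun (congrFun (congrFun (congrFun (congrFun (dRaw_leftTerm (t := t) φ) x) y) n) m) σ
  have e3 : bRaw (t + 1) (dRaw t φ) x y n m σ = leftTerm (t + 1) (dRaw t φ) x y n m σ +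
    M.innerTerm (dFix t (fun x' n' m' τ => φ x' y n' m' τ)) x n m σ := rfl
  rw [e3, ← e1, ← e2, dFix, dRaw, dRaw, hb, sourceTerm_add, bRaw, map_add]
  module

end DGBimod

/-! ### Double complexes in the right half-plane and their product total complexes -/

/-- A double complex of vector spaces `X s t` with `s ≥ 0`, with commuting differentials `dh` of
bidegree `(1, 0)` and `dv` of bidegree `(0, 1)`. -/
structure DoubleComplex (k : Type uk) [Field k] where
  X : ℕ → ℤ → Type w
  [addCommGroup : ∀ s t, AddCommGroup (X s t)]
  [module : ∀ s t, Module k (X s t)]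
  dh : ∀ (s : ℕ) (t : ℤ), X s t →ₗ[k] X (s + 1) t
  dv : ∀ (s : ℕ) (t t' : ℤ), t + 1 = t' → (X s t →ₗ[k] X s t')
  dh_dh : ∀ (s : ℕ) (t : ℤ) (x : X s t), dh (s + 1) t (dh s t x) = 0
  dv_dv : ∀ (s : ℕ) (t t' t'' : ℤ) (h : t + 1 = t') (h' : t' + 1 = t'') (x : X s t),
    dv s t' t'' h' (dv s t t' h x) = 0
  comm : ∀ (s : ℕ) (t t' : ℤ) (h : t + 1 = t') (x : X s t),
    dh s t' (dv s t t' h x) = dv (s + 1) t t' h (dh s t x)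

attribute [instance] DoubleComplex.addCommGroup DoubleComplex.module

/-- The Hochschild double complex `E_0^{s,t}(A; M)`. -/
def DGBimod.doubleComplex {A : DGCat.{uk, u, v} k} (M : DGBimod.{uk, u, v, w} A) :
    DoubleComplex.{uk, max u v w} k where
  X s t := M.toGrBimod.cochain s t
  dh s t := M.toGrBimod.b s t
  dv s t t' h := M.dInt s t t' h
  dh_dh s t φ := M.toGrBimod.b_b s t φ
  dv_dv s t t' t'' h h' φ := Subtype.ext (DGBimod.dRaw_dRaw h φ.2)
  comm s t t' h φ := by
    subst h
    exact Subtype.ext (DGBimod.dRaw_bRaw φ.2).symm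

/-- The graded Hochschild complex `CH_gr(C; M)` in internal degree `t`. -/
noncomputable def GrBimod.hochschildComplex {C : GrCat.{uk, u, v} k} (M : GrBimod.{uk, u, v, w} C)
    (t : ℤ) : CochainComplex (ModuleCat.{max u v w} k) ℕ :=
  CochainComplex.of (fun s => ModuleCat.of k (M.cochain s t)) (fun s => ModuleCat.ofHom (M.b s t))
    (fun s => by
      refine ModuleCat.hom_ext (LinearMap.ext fun φ => ?_)
      exact M.b_b s t φ)

/-- The graded Hochschild cohomology `HH_gr^{s,t}(C; M)`: external degree `s`, internal degree `t`. -/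
noncomputable abbrev GrBimod.HHgr {C : GrCat.{uk, u, v} k} (M : GrBimod.{uk, u, v, w} C)
    (s : ℕ) (t : ℤ) : ModuleCat.{max u v w} k :=
  (M.hochschildComplex t).homology s

namespace DoubleComplex

open CategoryTheory

variable (K : DoubleComplex.{uk, w} k)

/-- The product total complex in degree `n`: `∏_{s + t = n} K^{s,t}`. -/
abbrev Tot (n : ℤ) : Type w :=
  ∀ p : {p : ℕ × ℤ // (p.1 : ℤ) + p.2 = n}, K.X p.1.1 p.1.2

/-- The component of `D x` in bidegree `(s, t)`, namely `dh x_{s-1,t} + (-1)^s dv x_{s,t-1}`. -/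
def totDComp (n n' : ℤ) (h : n + 1 = n') : ∀ (s : ℕ) (t : ℤ), (s : ℤ) + t = n' →
    (K.Tot n →ₗ[k] K.X s t)
  | 0, t, e => (K.dv 0 (t - 1) t (by omega)).comp
      (LinearMap.proj (⟨(0, t - 1), by push_cast at e ⊢; omega⟩ : {p : ℕ × ℤ // (p.1 : ℤ) + p.2 = n}))
  | s + 1, t, e => (K.dh s t).comp
        (LinearMap.proj (⟨(s, t), by push_cast at e ⊢; omega⟩ : {p : ℕ × ℤ // (p.1 : ℤ) + p.2 = n})) +
      sgn k (s + 1) • (K.dv (s + 1) (t - 1) t (by omega)).comp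
        (LinearMap.proj
          (⟨(s + 1, t - 1), by push_cast at e ⊢; omega⟩ : {p : ℕ × ℤ // (p.1 : ℤ) + p.2 = n}))

/-- The differential `D = dh + (-1)^s dv` of the product total complex. -/
def totD (n n' : ℤ) (h : n + 1 = n') : K.Tot n →ₗ[k] K.Tot n' :=
  LinearMap.pi fun p => K.totDComp n n' h p.1.1 p.1.2 p.2

theorem dv_degree_eq {s : ℕ} {t t' t'' : ℤ} (h : t + 1 = t'') (e : t = t') (x : ∀ t, K.X s t) :
    K.dv s t t'' h (x t) = K.dv s t' t'' (by omega) (x t') := by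
  subst e
  rfl

theorem totD_totD (n n' n'' : ℤ) (h : n + 1 = n') (h' : n' + 1 = n'') (x : K.Tot n) :
    K.totD n' n'' h' (K.totD n n' h x) = 0 := by
  funext ⟨⟨s, t⟩, e⟩
  match s, e with
  | 0, e => exact K.dv_dv _ _ _ _ _ _ _
  | 1, e =>
    change K.dh 0 t (K.dv 0 (t - 1) t _ _) + sgn k _ • K.dv 1 (t - 1) t _
      (K.dh 0 (t - 1) _ + sgn k _ • K.dv 1 (t - 1 - 1) (t - 1) _ _) = 0
    rw [K.comm, map_add, map_smul, K.dv_dv]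
    simp [sgn_one]
  | s + 2, e =>
    change K.dh (s + 1) t (K.dh s t _ + sgn k _ • K.dv (s + 1) (t - 1) t _ _) +
      sgn k _ • K.dv (s + 2) (t - 1) t _
        (K.dh (s + 1) (t - 1) _ + sgn k _ • K.dv (s + 2) (t - 1 - 1) (t - 1) _ _) = 0
    rw [map_add, map_add, map_smul, map_smul, K.dv_dv, K.dh_dh, K.comm]
    simp [sgn_one, sgn_add]

/-- The subspace `F^p Tot^n` of elements whose components in columns `s < p` vanish. -/
def fil (p n : ℤ) : Submodule k (K.Tot n) where
  carrier := {x | ∀ q : {q : ℕ × ℤ // (q.1 : ℤ) + q.2 = n}, (q.1.1 : ℤ) < p → x q = 0}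
  add_mem' hx hy q h := by rw [Pi.add_apply, hx q h, hy q h, add_zero]
  zero_mem' _ _ := rfl
  smul_mem' c x hx q h := by rw [Pi.smul_apply, hx q h, smul_zero]

theorem fil_anti {p p' : ℤ} (n : ℤ) (h : p ≤ p') : K.fil p' n ≤ K.fil p n :=
  fun _ hx q hq => hx q (lt_of_lt_of_le hq h)

theorem totD_mem_fil (p n n' : ℤ) (h : n + 1 = n') {x : K.Tot n} (hx : x ∈ K.fil p n) :
    K.totD n n' h x ∈ K.fil p n' := by
  rintro ⟨⟨s, t⟩, e⟩ hs
  match s, e, hs with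
  | 0, e, hs =>
    exact (congrArg (K.dv 0 (t - 1) t (by omega))
      (hx ⟨(0, t - 1), by push_cast at e ⊢; omega⟩ hs)).trans (map_zero _)
  | s + 1, e, hs =>
    have e₁ := hx ⟨(s, t), by push_cast at e ⊢; omega⟩ (by push_cast at hs; change (s : ℤ) < p; omega)
    have e₂ := hx ⟨(s + 1, t - 1), by push_cast at e ⊢; omega⟩ hs
    change K.dh s t (x ⟨(s, t), _⟩) +
      sgn k _ • K.dv (s + 1) (t - 1) t _ (x ⟨(s + 1, t - 1), _⟩) = 0
    rw [e₁, e₂, map_zero, map_zero, smul_zero, add_zero]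

/-- The cochain complex `F^p Tot` for the column filtration of the product total complex. -/
noncomputable def filComplex (p : ℤ) : CochainComplex (ModuleCat.{w} k) ℤ where
  X n := ModuleCat.of k (K.fil p n)
  d n n' := if h : n + 1 = n' then
    ModuleCat.ofHom ((K.totD n n' h).restrict fun _ hx => K.totD_mem_fil p n n' h hx) else 0
  shape n n' h := dif_neg h
  d_comp_d' n n' n'' h h' := by
    change n + 1 = n' at h
    change n' + 1 = n'' at h'
    rw [dif_pos h, dif_pos h']
    refine ModuleCat.hom_ext (LinearMap.ext fun x => ?_)
    exact Subtype.ext (K.totD_totD n n' n'' h h' x.1)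

/-- The product total complex. -/
noncomputable def totComplex : CochainComplex (ModuleCat.{w} k) ℤ where
  X n := ModuleCat.of k (K.Tot n)
  d n n' := if h : n + 1 = n' then ModuleCat.ofHom (K.totD n n' h) else 0
  shape n n' h := dif_neg h
  d_comp_d' n n' n'' h h' := by
    change n + 1 = n' at h
    change n' + 1 = n'' at h'
    rw [dif_pos h, dif_pos h']
    refine ModuleCat.hom_ext (LinearMap.ext fun x => ?_)
    exact K.totD_totD n n' n'' h h' x

/-- The inclusion `F^{p+1} Tot ⟶ F^p Tot`. -/
noncomputable def filStep (p : ℤ) : K.filComplex (p + 1) ⟶ K.filComplex p where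
  f n := ModuleCat.ofHom (Submodule.inclusion (K.fil_anti n (by omega)))
  comm' n n' h := by
    change n + 1 = n' at h
    simp only [filComplex, dif_pos h]
    rfl

/-- The inclusion `F^p Tot ⟶ Tot`. -/
noncomputable def filInc (p : ℤ) : K.filComplex p ⟶ K.totComplex where
  f n := ModuleCat.ofHom (K.fil p n).subtype
  comm' n n' h := by
    change n + 1 = n' at h
    simp only [filComplex, totComplex, dif_pos h]
    rfl

/-- `Z_r^p = {x ∈ F^p Tot^n | D x ∈ F^{p+r}}`. -/
def Z (r p n : ℤ) : Submodule k (K.Tot n) :=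
  K.fil p n ⊓ (K.fil (p + r) (n + 1)).comap (K.totD n (n + 1) rfl)

/-- `B_r^p = Z_{r-1}^{p+1} + D Z_{r-1}^{p-r+1}`. -/
def B (r p n : ℤ) : Submodule k (K.Tot n) :=
  K.Z (r - 1) (p + 1) n ⊔
    (K.Z (r - 1) (p - r + 1) (n - 1)).map (K.totD (n - 1) n (Int.sub_add_cancel n 1))

/-- The data that identify `E`, starting from its page `E_0`, with the spectral sequence of the
column filtration of the product total complex: `E_r^{p,q} = Z_r^p / B_r^p` in total degree
`p + q`, the differential `d_r` is induced by `D`, and the isomorphism `H(E_r) ≅ E_{r+1}` is the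
tautological one. -/
structure ColumnFiltrationData (E : CohomologicalSpectralSequence (ModuleCat.{w} k) 0) where
  π : ∀ (r : ℤ) (hr : 0 ≤ r) (p q n : ℤ), p + q = n → (K.Z r p n →ₗ[k] (E.page r hr).X (p, q))
  surjective_π : ∀ (r : ℤ) (hr : 0 ≤ r) (p q n : ℤ) (h : p + q = n),
    Function.Surjective (π r hr p q n h)
  ker_π : ∀ (r : ℤ) (hr : 0 ≤ r) (p q n : ℤ) (h : p + q = n),
    LinearMap.ker (π r hr p q n h) = (K.B r p n).submoduleOf (K.Z r p n)
  d_π : ∀ (r : ℤ) (hr : 0 ≤ r) (p q n : ℤ) (h : p + q = n) (p' q' : ℤ) (h' : p' + q' = n + 1),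
    p' = p + r → ∀ (x : K.Z r p n) (y : K.Z r p' (n + 1)), (y : K.Tot (n + 1)) = K.totD n (n + 1) rfl x →
    ((E.page r hr).d (p, q) (p', q')).hom (π r hr p q n h x) = π r hr p' q' (n + 1) h' y
  iso_π : ∀ (r : ℤ) (hr : 0 ≤ r) (p q n : ℤ) (h : p + q = n) (x : K.Z r p n) (y : K.Z (r + 1) p n),
    (y : K.Tot n) = x → ∀ c : (E.page r hr).cycles (p, q),
    ((E.page r hr).iCycles (p, q)).hom c = π r hr p q n h x →
    (E.iso r (r + 1) (p, q) rfl hr).hom.hom (((E.page r hr).homologyπ (p, q)).hom c) =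
      π (r + 1) (by omega) p q n h y

/-- The subspace `F^p H^n(Tot)`: the image of `H^n(F^p Tot)`. -/
noncomputable def filH (p n : ℤ) : Submodule k (K.totComplex.homology n) :=
  LinearMap.range (HomologicalComplex.homologyMap (K.filInc p) n).hom

/-- The associated graded `F^p H^n / F^{p+1} H^n`. -/
abbrev GrH (p n : ℤ) : Type w := K.filH p n ⧸ (K.filH (p + 1) n).submoduleOf (K.filH p n)

/-- The permanent cycles, in filtration `p` and total degree `n`. -/
def ZInf (p n : ℤ) : Submodule k (K.Tot n) := ⨅ r : ℕ, K.Z r p n ⊔ K.fil (p + 1) n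

/-- The eventual boundaries, in filtration `p` and total degree `n`. -/
def BInf (p n : ℤ) : Submodule k (K.Tot n) := ⨆ r : ℕ, K.B r p n ⊔ K.fil (p + 1) n

/-- The limit page `E_∞^{p,n-p}`. -/
abbrev EInf (p n : ℤ) : Type w := K.ZInf p n ⧸ (K.BInf p n).submoduleOf (K.ZInf p n)

/-- The map `F^p H^n / F^{p+1} H^n ⟶ E_∞^{p,n-p}` is the canonical one: the class of a cocycle of
`F^p Tot` goes to the class of that cocycle. -/
def IsCanonical (p n : ℤ) (e : K.GrH p n →ₗ[k] K.EInf p n) : Prop :=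
  ∀ (c : (K.filComplex p).cycles n) (a : K.filH p n) (z : K.ZInf p n),
    (a : K.totComplex.homology n) = (HomologicalComplex.homologyMap (K.filInc p) n).hom
      (((K.filComplex p).homologyπ n).hom c) →
    (z : K.Tot n) = (show K.fil p n from ((K.filComplex p).iCycles n).hom c).1 →
    e (Submodule.Quotient.mk a) = Submodule.Quotient.mk z

/-- Conditional convergence to `H^n(Tot)` (in the sense of Boardman) of the spectral sequence of
the column filtration. The filtration is exhaustive, and in each degree `n` the tower
`⋯ ⟶ H^n(F^2 Tot) ⟶ H^n(F^1 Tot) ⟶ H^n(F^0 Tot)` has vanishing limit and vanishing derived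
limit: these are the kernel and the cokernel of `(a_p)_p ↦ (a_p - i(a_{p+1}))_p`. -/
structure ConvergesConditionally : Prop where
  exhaustive : ∀ n : ℤ, K.filH 0 n = ⊤
  lim_eq_zero : ∀ n : ℤ, Function.Injective
    fun (a : ∀ p : ℕ, (K.filComplex p).homology n) (p : ℕ) =>
      a p - (HomologicalComplex.homologyMap (K.filStep p) n).hom (a (p + 1))
  derivedLim_eq_zero : ∀ n : ℤ, Function.Surjective
    fun (a : ∀ p : ℕ, (K.filComplex p).homology n) (p : ℕ) =>
      a p - (HomologicalComplex.homologyMap (K.filStep p) n).hom (a (p + 1))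

/-- `lim¹_r Z_r^p = 0` in all bidegrees, where `Z_r^p` is regarded as a subspace of
`E_0 = F^p / F^{p+1}`. -/
def DerivedEInfVanishes : Prop :=
  ∀ (p n : ℤ) (z : ℕ → K.Tot n), (∀ r : ℕ, z r ∈ K.Z r p n) →
    ∃ y : ℕ → K.Tot n, ∀ r : ℕ, y r ∈ K.Z r p n ∧ z r - (y r - y (r + 1)) ∈ K.fil (p + 1) n

/-- Strong convergence to `H^n(Tot)`: the filtration of `H^n(Tot)` is exhaustive, Hausdorff and
complete, and its associated graded is `E_∞`. -/
structure ConvergesStrongly : Prop where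
  exhaustive : ∀ n : ℤ, K.filH 0 n = ⊤
  hausdorff : ∀ n : ℤ, ⨅ p : ℕ, K.filH p n = ⊥
  complete : ∀ (n : ℤ) (a : ℕ → K.totComplex.homology n),
    (∀ p : ℕ, a (p + 1) - a p ∈ K.filH p n) → ∃ b, ∀ p : ℕ, b - a p ∈ K.filH p n
  gr : ∀ p n : ℤ, ∃ e : K.GrH p n →ₗ[k] K.EInf p n, K.IsCanonical p n e ∧ Function.Bijective e

/-- The convergence of the spectral sequence of a right half-plane double complex to the cohomology
of the product total complex. -/
structure Converges : Prop where
  conditionally : K.ConvergesConditionally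
  gr_injective : ∀ p n : ℤ, ∃ e : K.GrH p n →ₗ[k] K.EInf p n,
    K.IsCanonical p n e ∧ Function.Injective e
  strongly : K.DerivedEInfVanishes → K.ConvergesStrongly

/-- `Converges`, with the abutment `H^•` made explicit: `H^n` is the cohomology of the product total
complex. -/
def ConvergesTo (H : ℤ → ModuleCat.{w} k) : Prop :=
  (∀ n : ℤ, H n = K.totComplex.homology n) ∧ K.Converges

/-- The column `K^{s,•}`. -/
noncomputable def column (s : ℕ) : CochainComplex (ModuleCat.{w} k) ℤ where
  X t := ModuleCat.of k (K.X s t)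
  d t t' := if h : t + 1 = t' then ModuleCat.ofHom (K.dv s t t' h) else 0
  shape t t' h := dif_neg h
  d_comp_d' t t' t'' h h' := by
    change t + 1 = t' at h
    change t' + 1 = t'' at h'
    rw [dif_pos h, dif_pos h']
    refine ModuleCat.hom_ext (LinearMap.ext fun x => ?_)
    exact K.dv_dv s t t' t'' h h' x

/-- The horizontal differential as a map of columns. -/
noncomputable def columnMap (s : ℕ) : K.column s ⟶ K.column (s + 1) where
  f t := ModuleCat.ofHom (K.dh s t)
  comm' t t' h := by
    change t + 1 = t' at h
    simp only [column, dif_pos h]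
    refine ModuleCat.hom_ext (LinearMap.ext fun x => ?_)
    exact (K.comm s t t' h x).symm

/-- The complex `s ↦ H^t(K^{s,•})` of the vertical cohomology spaces, with the differential induced
by the horizontal one. -/
noncomputable def verticalCohomology (t : ℤ) : CochainComplex (ModuleCat.{w} k) ℕ :=
  CochainComplex.of (fun s => (K.column s).homology t)
    (fun s => HomologicalComplex.homologyMap (K.columnMap s) t)
    (fun s => by
      rw [← HomologicalComplex.homologyMap_comp]
      have : K.columnMap s ≫ K.columnMap (s + 1) = 0 := by
        ext t x
        exact K.dh_dh s t x
      rw [this, HomologicalComplex.homologyMap_zero])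

end DoubleComplex

/-- The dg Hochschild complex `CH_dg(A; M)`: the product total complex of the Hochschild double
complex. -/
noncomputable abbrev DGBimod.CHdg {A : DGCat.{uk, u, v} k} (M : DGBimod.{uk, u, v, w} A) :
    CochainComplex (ModuleCat.{max u v w} k) ℤ :=
  M.doubleComplex.totComplex

/-- The dg Hochschild cohomology `HH_dg^n(A; M)`. -/
noncomputable abbrev DGBimod.HHdg {A : DGCat.{uk, u, v} k} (M : DGBimod.{uk, u, v, w} A) (n : ℤ) :
    ModuleCat.{max u v w} k :=
  M.CHdg.homology n

/-! ### The Künneth map from internal cocycles to cochains on homology -/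

/-- `h ∈ HH_gr^{s,t}` is the class of the cocycle `ψ`. -/
def GrBimod.IsClassOf {C : GrCat.{uk, u, v} k} (M : GrBimod.{uk, u, v, w} C) {s : ℕ} {t : ℤ}
    (ψ : M.cochain s t) (h : M.HHgr s t) : Prop :=
  ∃ c : (M.hochschildComplex t).cycles s,
    ((M.hochschildComplex t).iCycles s).hom c = ψ ∧
      ((M.hochschildComplex t).homologyπ s).hom c = h

/-- `A.Represents σ τ`: the string `σ` consists of cycles, and `τ` is the string of their homology
classes. -/
inductive DGCat.Represents (A : DGCat.{uk, u, v} k) : ∀ {s : ℕ} {x y : A.Obj} {n : ℤ},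
    A.toGrCat.Str s x y n → GrCat.Str A.homology s x y n → Prop
  | nil (x : A.Obj) : Represents A (.nil x) (GrCat.Str.nil (A := A.homology) x)
  | cons {s : ℕ} {x z y : A.Obj} {i j n : ℤ} (f : Cyc (A.d z y) i) {σ : A.toGrCat.Str s x z j}
      {τ : GrCat.Str A.homology s x z j} (h : i + j = n) : Represents A σ τ →
      Represents A (.cons (f : A.Hom z y i) σ h)
        (GrCat.Str.cons (A := A.homology) (Hlgy.mk (A.d z y) i f) τ h)

/-- The cochain `ψ` on `H_• A` with values in `Σ^t H_• M` is induced by the cochain `φ` of internal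
degree `t`: `ψ([f_1] ⊗ ⋯ ⊗ [f_s]) = [φ(f_1 ⊗ ⋯ ⊗ f_s)]` for all cycles `f_1, …, f_s`. -/
def DGBimod.Induces {A : DGCat.{uk, u, v} k} (M : DGBimod.{uk, u, v, w} A) {s : ℕ} {t : ℤ}
    (φ : M.toGrBimod.cochain s t) (ψ : (M.homology.shift t).cochain s 0) : Prop :=
  ∀ (x y : A.Obj) (n : ℤ) (σ : A.toGrCat.Str s x y n) (τ : GrCat.Str A.homology s x y n),
    A.Represents σ τ → ∃ h : φ.1 x y n (n - t) σ ∈ Cyc (M.d x y) (n - t),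
      ψ.1 x y n n τ = Hlgy.mk (M.d x y) (n - t) ⟨_, h⟩

/-! ### Automorphisms -/

/-- A graded automorphism `T` of a differential graded category: an automorphism of the underlying
graded category with `T d = - d T`, as for the parity functor `f ↦ (-1)^{|f|} f` and for shift
functors of complexes. -/
structure DGCat.Auto (A : DGCat.{uk, u, v} k) where
  obj : A.Obj ≃ A.Obj
  map : ∀ (x y : A.Obj) (n : ℤ), A.Hom x y n ≃ₗ[k] A.Hom (obj x) (obj y) n
  map_id : ∀ x : A.Obj, map x x 0 (A.id x) = A.id (obj x)
  map_comp : ∀ (x y z : A.Obj) (i j n : ℤ) (h : i + j = n) (g : A.Hom y z i) (f : A.Hom x y j),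
    map x z n (A.comp x y z i j n h g f) =
      A.comp (obj x) (obj y) (obj z) i j n h (map y z i g) (map x y j f)
  map_d : ∀ (x y : A.Obj) (n m : ℤ) (h : m + 1 = n) (f : A.Hom x y n),
    map x y m (A.d x y n m h f) = - A.d (obj x) (obj y) n m h (map x y n f)

/-- An action of `T` on a bimodule `M`, compatible with the action of `T` on `A`. -/
structure DGCat.Auto.Action {A : DGCat.{uk, u, v} k} (T : A.Auto) (M : DGBimod.{uk, u, v, w} A) where
  map : ∀ (x y : A.Obj) (n : ℤ), M.obj x y n →ₗ[k] M.obj (T.obj x) (T.obj y) n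
  map_left : ∀ (x y z : A.Obj) (i j n : ℤ) (h : i + j = n) (g : A.Hom y z i) (m : M.obj x y j),
    map x z n (M.left x y z i j n h g m) =
      M.left (T.obj x) (T.obj y) (T.obj z) i j n h (T.map y z i g) (map x y j m)
  map_right : ∀ (x y z : A.Obj) (i j n : ℤ) (h : i + j = n) (m : M.obj y z i) (f : A.Hom x y j),
    map x z n (M.right x y z i j n h m f) =
      M.right (T.obj x) (T.obj y) (T.obj z) i j n h (map y z i m) (T.map x y j f)
  map_d : ∀ (x y : A.Obj) (n l : ℤ) (h : l + 1 = n) (m : M.obj x y n),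
    map x y l (M.d x y n l h m) = - M.d (T.obj x) (T.obj y) n l h (map x y n m)

namespace DGCat.Auto

open GrBimod DGBimod

variable {A : DGCat.{uk, u, v} k} (T : A.Auto)

/-- `T` acts on the standard bimodule `A`. -/
def selfAction : T.Action A.self where
  map x y n := (T.map x y n : A.Hom x y n →ₗ[k] A.Hom (T.obj x) (T.obj y) n)
  map_left := T.map_comp
  map_right := T.map_comp
  map_d := T.map_d

/-- `f_1 ⊗ ⋯ ⊗ f_s ↦ T f_1 ⊗ ⋯ ⊗ T f_s`. -/
def str : ∀ {s : ℕ} {x y : A.Obj} {n : ℤ},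
    A.toGrCat.Str s x y n → A.toGrCat.Str s (T.obj x) (T.obj y) n
  | _, _, _, _, .nil x => .nil (T.obj x)
  | _, _, y, _, @GrCat.Str.cons _ _ _ _ _ z _ i _ _ f σ h => .cons (T.map z y i f) (str σ) h

namespace Action

variable {T} {M : DGBimod.{uk, u, v, w} A} (R : T.Action M)

/-- The cochains `φ` of internal degree `t` with
`φ(T f_1, …, T f_s) = (-1)^t T (φ(f_1, …, f_s))`. -/
def cochain (s : ℕ) (t : ℤ) : Submodule k (M.toGrBimod.cochain s t) where
  carrier := {φ | ∀ (x y : A.Obj) (n m : ℤ) (σ : A.toGrCat.Str s x y n),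
    φ.1 (T.obj x) (T.obj y) n m (T.str σ) = sgn k t • R.map x y m (φ.1 x y n m σ)}
  add_mem' {φ ψ} hφ hψ x y n m σ := by
    change φ.1 _ _ _ _ _ + ψ.1 _ _ _ _ _ = sgn k t • R.map x y m (φ.1 _ _ _ _ _ + ψ.1 _ _ _ _ _)
    rw [hφ, hψ, map_add, smul_add]
  zero_mem' x y n m σ := by
    change (0 : M.obj _ _ m) = sgn k t • R.map x y m 0
    rw [map_zero, smul_zero]
  smul_mem' c φ hφ x y n m σ := by
    change c • φ.1 _ _ _ _ _ = sgn k t • R.map x y m (c • φ.1 _ _ _ _ _)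
    rw [hφ, map_smul, smul_comm]

theorem innerTerm_str {s : ℕ} {y z : A.Obj} (c : k)
    (φ : ∀ (x : A.Obj) (n m : ℤ), A.toGrCat.Str s x z n → M.obj x y m)
    (ψ : ∀ (x : A.Obj) (n m : ℤ), A.toGrCat.Str s x (T.obj z) n → M.obj x (T.obj y) m)
    (h : ∀ x n m σ, ψ (T.obj x) n m (T.str σ) = c • R.map x y m (φ x n m σ))
    (x : A.Obj) (n m : ℤ) (σ : A.toGrCat.Str (s + 1) x z n) :
    M.innerTerm ψ (T.obj x) n m (T.str σ) = c • R.map x y m (M.innerTerm φ x n m σ) := by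
  induction s generalizing z n with
  | zero =>
    match σ with
    | @GrCat.Str.cons _ _ _ _ _ z' _ i _ _ f (.nil _) e =>
    have h₃ : ψ (T.obj z) 0 (m - i) (.nil (T.obj z)) = _ := h z 0 (m - i) (.nil z)
    rw [str, str, innerTerm_one, innerTerm_one, h₃, map_neg, R.map_right, map_smul,
      LinearMap.smul_apply, smul_neg]
  | succ s ih =>
    match σ with
    | @GrCat.Str.cons _ _ _ _ _ z' _ a _ _ f (@GrCat.Str.cons _ _ _ _ _ z'' _ b l _ g τ e) e' =>
    have h₃ := ih (pre (M := M.toGrBimod) f φ)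
      (pre (M := M.toGrBimod) (T.map _ _ _ f) ψ)
      (fun x n m σ => h x _ m (.cons f σ rfl)) _ (.cons g τ e)
    have h₄ := h x n m (.cons (A.comp _ _ _ a b _ rfl f g) τ (by omega))
    rw [str, T.map_comp] at h₄
    rw [str] at h₃
    rw [str, str, innerTerm_succ, innerTerm_succ, h₃, h₄, map_sub, map_neg]
    module

theorem sourceTerm_str {s : ℕ} {y z : A.Obj} (c : k)
    (φ : ∀ (x : A.Obj) (n m : ℤ), A.toGrCat.Str s x z n → M.obj x y m)
    (ψ : ∀ (x : A.Obj) (n m : ℤ), A.toGrCat.Str s x (T.obj z) n → M.obj x (T.obj y) m)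
    (hψ : Homog (M := M.toGrBimod) ψ)
    (h : ∀ x n m σ, ψ (T.obj x) n m (T.str σ) = c • R.map x y m (φ x n m σ))
    (x : A.Obj) (n m : ℤ) (σ : A.toGrCat.Str s x z n) :
    M.sourceTerm ψ (T.obj x) n m (T.str σ) =
      - c • R.map x y m (M.sourceTerm φ x n m σ) := by
  induction σ with
  | nil => simp [sourceTerm]
  | @cons s x z' z i j n f σ e ih =>
    have h₃ := ih (pre (M := M.toGrBimod) f φ)
      (pre (M := M.toGrBimod) (T.map _ _ _ f) ψ) (hψ.pre _)
      (fun x n m σ => h x _ m (.cons f σ rfl))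
    have h₄ := h x (n - 1) m (.cons (A.d _ _ _ (i - 1) (Int.sub_add_cancel i 1) f) σ (by omega))
    rw [str, T.map_d, ← neg_one_smul k] at h₄
    have h₅ := (hψ (-1) _ _ _ _ _ (.head (A.d _ _ _ (i - 1) (Int.sub_add_cancel i 1) (T.map _ _ _ f))
      (T.str σ) (by omega))).symm.trans h₄
    rw [neg_smul, one_smul, neg_eq_iff_eq_neg] at h₅
    rw [str, sourceTerm_cons, sourceTerm_cons, h₃, h₅, map_add, map_smul]
    module

theorem b_mem {s : ℕ} {t : ℤ} {φ : M.toGrBimod.cochain s t} (h : φ ∈ R.cochain s t) :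
    M.toGrBimod.b s t φ ∈ R.cochain (s + 1) t := by
  intro x y n m σ
  have h₁ := R.innerTerm_str (sgn k t) (fun x' n' m' τ => φ.1 x' y n' m' τ)
    (fun x' n' m' τ => φ.1 x' (T.obj y) n' m' τ) (fun x n m σ => h x y n m σ) x n m σ
  have h₂ : leftTerm t φ.1 (T.obj x) (T.obj y) n m (T.str σ) =
      sgn k t • R.map x y m (leftTerm t φ.1 x y n m σ) := by
    match σ with
    | @GrCat.Str.cons _ _ _ _ _ z _ i j _ f τ e =>
    rw [str, leftTerm, leftTerm, h x z j (m - i) τ, map_smul, map_smul, R.map_left, smul_comm]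
  change leftTerm t φ.1 (T.obj x) (T.obj y) n m (T.str σ) + M.innerTerm _ _ _ _ _ =
    sgn k t • R.map x y m (_ + _)
  rw [h₂, h₁, map_add, smul_add]

theorem dInt_mem {s : ℕ} {t t' : ℤ} (ht : t + 1 = t') {φ : M.toGrBimod.cochain s t}
    (h : φ ∈ R.cochain s t) : M.dInt s t t' ht φ ∈ R.cochain s t' := by
  subst ht
  intro x y n m σ
  have hψ : Homog (M := M.toGrBimod) (fun x' n' m' τ => φ.1 x' (T.obj y) n' m' τ) :=
    fun c x n m _ _ e => φ.2.2.1 c x (T.obj y) n m _ _ e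
  have h₁ := R.sourceTerm_str (sgn k t) (fun x' n' m' τ => φ.1 x' y n' m' τ)
    (fun x' n' m' τ => φ.1 x' (T.obj y) n' m' τ) hψ (fun x n m σ => h x y n m σ) x n m σ
  change M.d _ _ _ _ _ (φ.1 (T.obj x) (T.obj y) n (m + 1) (T.str σ)) -
      sgn k t • M.sourceTerm _ _ _ _ _ =
    sgn k (t + 1) • R.map x y m (M.d _ _ _ _ _ (φ.1 x y n (m + 1) σ) - sgn k t • _)
  rw [h x y n (m + 1) σ, h₁, map_sub, map_smul, R.map_d, map_smul, sgn_add, sgn_one]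
  module

/-- The double complex of `T`-invariant (up to the natural sign) Hochschild cochains. -/
def doubleComplex : DoubleComplex.{uk, max u v w} k where
  X s t := R.cochain s t
  dh s t := (M.toGrBimod.b s t).restrict fun _ h => R.b_mem h
  dv s t t' h := (M.dInt s t t' h).restrict fun _ hφ => R.dInt_mem h hφ
  dh_dh s t φ := Subtype.ext (M.doubleComplex.dh_dh s t φ.1)
  dv_dv s t t' t'' h h' φ := Subtype.ext (M.doubleComplex.dv_dv s t t' t'' h h' φ.1)
  comm s t t' h φ := Subtype.ext (M.doubleComplex.comm s t t' h φ.1)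

end Action

/-- The double complex `E_0(A, T)` of the cochains with values in `A` that are `T`-invariant up to
the natural sign. -/
def doubleComplex : DoubleComplex.{uk, max u v} k := T.selfAction.doubleComplex

/-- The dg Hochschild cohomology `HH_dg^n(A, T)`. -/
noncomputable abbrev HHdg (n : ℤ) : ModuleCat.{max u v} k := T.doubleComplex.totComplex.homology n

end DGCat.Auto

end Hochschild

/-! ### Homology of complexes of modules, by elements -/

/-! The pages are the classical subquotients `Z_r^p / B_r^p` of the filtered complex `Tot`. Both
`E_{r+1}^p` and the cohomology of `E_r` at `p` are quotients of `Z_{r+1}^p`, and the two kernels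
coincide (`ker_zToHomology`). This gives the isomorphism `H(E_r) ≅ E_{r+1}`.

Convergence rests on two properties of a product total complex with columns `s ≥ 0`. One has `F^0
Tot = Tot`, and the filtration is Hausdorff and complete: elements `u_p ∈ F^p` can be summed, since
each column sees only finitely many of them (`exists_telescope`, `eq_zero_of_telescope`). Hence
`lim` and `lim¹` of the `F^p Tot` vanish, and choosing cocycles carries this over to the groups
`H^n(F^p Tot)`. Only finitely many differentials enter a given column, so a cocycle of `F^p` dies in
`E_∞` exactly when it bounds modulo `F^{p+1}`. Therefore `F^p H / F^{p+1} H` embeds in `E_∞`. If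
`lim¹_r Z_r^p` vanishes in `E_0`, completeness lifts this, one column after another, to `lim¹_r (F^p
∩ D⁻¹ F^r) = 0` (`DerivedEInfVanishes.exists_eq_sub`). With this, a sequence of approximate
solutions can be corrected to a constant one, that is, to an exact solution. This proves that the
filtration of `H` is Hausdorff and that the embedding in `E_∞` is surjective.

For the second page, an element of `Z_2^s` is determined modulo `B_2^s` by its leading component.
This component is a vertical cocycle whose horizontal differential is a vertical coboundary. So
`E_2` is the cohomology of any complex `C` whose terms are identified with the vertical cohomology
compatibly with the horizontal differentials (`ComputesVerticalCohomology`). For the automorphism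
version `C` is the vertical cohomology itself. For a bimodule `C` is the graded Hochschild complex
of the homology, and the identification is the Künneth theorem.

The Künneth theorem is proved by explicit homotopies. Over a field, each complex `A(x, y)` and `M(x,
y)` has a projection `p` to homology, a section `i` by cycles, and a homotopy `h` with `dh + hd = 1
- ip`. On strings, `H = ∑ ± ip ⊗ ⋯ ⊗ ip ⊗ h ⊗ 1 ⊗ ⋯ ⊗ 1` satisfies `dH + Hd = 1 - (ip)^{⊗s}`
(`sourceTerm_hFun_add`). Composition of cochains with `H` shows that the class of `φ(f_1, …, f_s)`
depends only on the classes of the cycles `f_i`, and that a cocycle inducing zero on homology is a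
coboundary. Compatibility with `b` holds because products in homology are computed on
representatives, the Koszul sign of `Σ^t` being the sign in the first term of `b`. -/

section HomologyClasses

open CategoryTheory

variable {k : Type uk} [Field k] {ι : Type*} {c : ComplexShape ι}

/-- The homology class of an element that is killed by the differential. -/
noncomputable def cocycleClass (C : HomologicalComplex (ModuleCat.{w} k) c) {i j : ι}
    (hj : c.next i = j) : LinearMap.ker (C.d i j).hom →ₗ[k] C.homology i :=
  (C.homologyπ i).hom.comp (C.liftCycles (A := ModuleCat.of k (LinearMap.ker (C.d i j).hom))
    (ModuleCat.ofHom (LinearMap.ker (C.d i j).hom).subtype) j hj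
    (ModuleCat.hom_ext (LinearMap.ext fun x => x.2))).hom

variable (C : HomologicalComplex (ModuleCat.{w} k) c) {i j : ι} (hj : c.next i = j)

theorem exists_cycles_eq (x : LinearMap.ker (C.d i j).hom) : ∃ z : C.cycles i,
    (C.iCycles i).hom z = x ∧ (C.homologyπ i).hom z = cocycleClass C hj x := by
  refine ⟨(C.liftCycles (A := ModuleCat.of k (LinearMap.ker (C.d i j).hom))
    (ModuleCat.ofHom (LinearMap.ker (C.d i j).hom).subtype) j hj
    (ModuleCat.hom_ext (LinearMap.ext fun x => x.2))).hom x, ?_, rfl⟩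
  rw [← LinearMap.comp_apply, ← ModuleCat.hom_comp, HomologicalComplex.liftCycles_i]
  rfl

theorem iCycles_injective : Function.Injective (C.iCycles i).hom :=
  (ModuleCat.mono_iff_injective (C.iCycles i)).1 inferInstance

theorem homologyπ_surjective : Function.Surjective (C.homologyπ i).hom :=
  (ModuleCat.epi_iff_surjective (C.homologyπ i)).1 inferInstance

theorem d_iCycles (z : C.cycles i) (j : ι) : (C.d i j).hom ((C.iCycles i).hom z) = 0 := by
  rw [← LinearMap.comp_apply, ← ModuleCat.hom_comp, HomologicalComplex.iCycles_d]
  rfl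

theorem homologyπ_eq_cocycleClass (z : C.cycles i) (x : LinearMap.ker (C.d i j).hom)
    (h : (C.iCycles i).hom z = x) : (C.homologyπ i).hom z = cocycleClass C hj x := by
  obtain ⟨z', h₁, h₂⟩ := exists_cycles_eq C hj x
  rw [← h₂, iCycles_injective C (h.trans h₁.symm)]

theorem cocycleClass_surjective : Function.Surjective (cocycleClass C hj) := fun h => by
  obtain ⟨z, rfl⟩ := homologyπ_surjective C h
  exact ⟨⟨_, LinearMap.mem_ker.2 (d_iCycles C z j)⟩, (homologyπ_eq_cocycleClass C hj z _ rfl).symm⟩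

/-- Homology is the cokernel of `toCycles`, so a cycle with zero class lifts along it; injectivity
of `iCycles` turns this into a statement about elements of the complex. -/
theorem cocycleClass_eq_zero_iff {l : ι} (hl : c.prev i = l) (x : LinearMap.ker (C.d i j).hom) :
    cocycleClass C hj x = 0 ↔ ∃ y : C.X l, (C.d l i).hom y = x := by
  obtain ⟨z, h₁, h₂⟩ := exists_cycles_eq C hj x
  rw [← h₁, ← h₂]
  constructor
  · intro h
    have he := (ShortComplex.exact_of_g_is_cokernel
      (ShortComplex.mk _ _ (C.toCycles_comp_homologyπ l i)) (C.homologyIsCokernel l i hl))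
    obtain ⟨y, hy⟩ := (ShortComplex.moduleCat_exact_iff _).1 he z h
    refine ⟨y, ?_⟩
    rw [← C.toCycles_i l i]
    exact congrArg (C.iCycles i).hom hy
  · rintro ⟨y, hy⟩
    rw [← C.toCycles_i l i] at hy
    rw [← iCycles_injective C hy]
    exact congrArg (fun f => f.hom y) (C.toCycles_comp_homologyπ l i)

theorem homologyMap_cocycleClass {C' : HomologicalComplex (ModuleCat.{w} k) c} (f : C ⟶ C')
    (x : LinearMap.ker (C.d i j).hom) (x' : LinearMap.ker (C'.d i j).hom)
    (h : (f.f i).hom x = x') :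
    (HomologicalComplex.homologyMap f i).hom (cocycleClass C hj x) = cocycleClass C' hj x' := by
  obtain ⟨z, h₁, h₂⟩ := exists_cycles_eq C hj x
  rw [← h₂, ← homologyπ_eq_cocycleClass C' hj ((HomologicalComplex.cyclesMap f i).hom z) x']
  · exact congrArg (fun f => f.hom z) (HomologicalComplex.homologyπ_naturality f i)
  · rw [← h, ← h₁]
    exact congrArg (fun f => f.hom z) (HomologicalComplex.cyclesMap_i f i)

end HomologyClasses

/-! ### The spectral sequence of the column filtration -/

section LinearEquivOfKerEq

variable {k N P H : Type*} [Field k] [AddCommGroup N] [Module k N] [AddCommGroup P] [Module k P]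
  [AddCommGroup H] [Module k H]

/-- Two surjections with the same kernel have isomorphic targets. -/
noncomputable def linearEquivOfKerEq (f : N →ₗ[k] P) (g : N →ₗ[k] H) (hf : Function.Surjective f)
    (hg : Function.Surjective g) (h : LinearMap.ker f = LinearMap.ker g) : P ≃ₗ[k] H :=
  (f.quotKerEquivOfSurjective hf).symm.trans
    ((Submodule.quotEquivOfEq _ _ h).trans (g.quotKerEquivOfSurjective hg))

theorem linearEquivOfKerEq_apply (f : N →ₗ[k] P) (g : N →ₗ[k] H) (hf : Function.Surjective f)
    (hg : Function.Surjective g) (h : LinearMap.ker f = LinearMap.ker g) (x : N) :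
    linearEquivOfKerEq f g hf hg h (f x) = g x := by
  have : (f.quotKerEquivOfSurjective hf).symm (f x) = Submodule.Quotient.mk x := by
    rw [LinearEquiv.symm_apply_eq]
    rfl
  rw [linearEquivOfKerEq, LinearEquiv.trans_apply, this]
  rfl

end LinearEquivOfKerEq

namespace DoubleComplex

open CategoryTheory

variable {k : Type uk} [Field k] (K : DoubleComplex.{uk, w} k)

/-- The degree `n'` and the filtration index `q` are variables tied by equations, so that the
criterion applies to indices that agree only up to integer arithmetic. -/
theorem mem_Z_iff {r p q n n' : ℤ} (h : n + 1 = n') (hq : q = p + r) {x : K.Tot n} :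
    x ∈ K.Z r p n ↔ x ∈ K.fil p n ∧ K.totD n n' h x ∈ K.fil q n' := by
  subst h hq
  rfl

/-- All indices are again free. The four filtration conditions say that `u ∈ Z_{r-1}^{p+1}` and `v ∈
Z_{r-1}^{p-r+1}`, where `l = p - r + 1`. -/
theorem mem_B_iff {r p l m n n' q : ℤ} (h : m + 1 = n) (h' : n + 1 = n') (hl : l + r = p + 1)
    (hq : q = p + r) {x : K.Tot n} : x ∈ K.B r p n ↔ ∃ (u : K.Tot n) (v : K.Tot m),
      u ∈ K.fil (p + 1) n ∧ K.totD n n' h' u ∈ K.fil q n' ∧ v ∈ K.fil l m ∧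
        K.totD m n h v ∈ K.fil p n ∧ u + K.totD m n h v = x := by
  obtain rfl : m = n - 1 := by omega
  obtain rfl : l = p - r + 1 := by omega
  rw [B, Submodule.mem_sup]
  constructor
  · rintro ⟨u, hu, _, ⟨v, hv, rfl⟩, rfl⟩
    rw [K.mem_Z_iff (q := q) h' (by omega)] at hu
    rw [SetLike.mem_coe, K.mem_Z_iff (q := p) h (by omega)] at hv
    exact ⟨u, v, hu.1, hu.2, hv.1, hv.2, rfl⟩
  · rintro ⟨u, v, h₁, h₂, h₃, h₄, rfl⟩
    exact ⟨u, (K.mem_Z_iff (q := q) h' (by omega)).2 ⟨h₁, h₂⟩, _,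
      ⟨v, (K.mem_Z_iff (q := p) h (by omega)).2 ⟨h₃, h₄⟩, rfl⟩, rfl⟩

theorem zero_mem_fil (p n : ℤ) : (0 : K.Tot n) ∈ K.fil p n := Submodule.zero_mem _

theorem totD_mem_Z {r p n n' : ℤ} (h : n + 1 = n') {x : K.Tot n}
    (hx : K.totD n n' h x ∈ K.fil p n') : K.totD n n' h x ∈ K.Z r p n' :=
  ⟨hx, by
    change K.totD n' (n' + 1) rfl _ ∈ K.fil (p + r) (n' + 1)
    rw [totD_totD]
    exact zero_mem_fil _ _ _⟩

/-- The entry `Z_r^p / B_r^p` of the page `E_r`, in total degree `n`. -/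
abbrev PageX (r p n : ℤ) : Type w := K.Z r p n ⧸ (K.B r p n).submoduleOf (K.Z r p n)

/-- The differential `D` of the total complex as a map `Z_r^p ⟶ Z_r^{p+r}`. -/
def zD (r p p' n n' : ℤ) (hp : p' = p + r) (h : n + 1 = n') : K.Z r p n →ₗ[k] K.Z r p' n' :=
  ((K.totD n n' h).comp (K.Z r p n).subtype).codRestrict _
    fun x => K.totD_mem_Z h ((K.mem_Z_iff h hp).1 x.2).2

/-- The differential of the page `E_r`. -/
def pageD (r p p' n n' : ℤ) (hp : p' = p + r) (h : n + 1 = n') :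
    K.PageX r p n →ₗ[k] K.PageX r p' n' :=
  Submodule.mapQ _ _ (K.zD r p p' n n' hp h) (by
    rintro ⟨x, hx⟩ hb
    obtain ⟨u, v, h₁, h₂, h₃, h₄, e⟩ :=
      (K.mem_B_iff (Int.sub_add_cancel n 1) h (Int.sub_add_cancel (p + 1) r) hp).1 hb
    -- If `x = u + Dv`, then `Dx = Du`, and `u ∈ Z_{r-1}^{p+1}` is just what the boundary summand of
    -- `B_r^{p+r}` asks for, because `(p + r) - r + 1 = p + 1`.
    refine (K.mem_B_iff (l := p + 1) h rfl (by omega) rfl).2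
      ⟨0, u, zero_mem_fil _ _ _, ?_, h₁, h₂, ?_⟩
    · rw [map_zero]
      exact zero_mem_fil _ _ _
    · change 0 + _ = K.totD n n' h x
      have e' : x = u + K.totD (n - 1) n _ v := e.symm
      rw [e', map_add, totD_totD, add_zero, zero_add])

theorem pageD_mk {r p p' n n' : ℤ} (hp : p' = p + r) (h : n + 1 = n') (x : K.Z r p n) :
    K.pageD r p p' n n' hp h (Submodule.Quotient.mk x) =
      Submodule.Quotient.mk (K.zD r p p' n n' hp h x) := rfl

theorem pageD_pageD {r p p' p'' n n' n'' : ℤ} (hp : p' = p + r) (h : n + 1 = n')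
    (hp' : p'' = p' + r) (h' : n' + 1 = n'') (x : K.PageX r p n) :
    K.pageD r p' p'' n' n'' hp' h' (K.pageD r p p' n n' hp h x) = 0 := by
  obtain ⟨x, rfl⟩ := Submodule.Quotient.mk_surjective _ x
  rw [pageD_mk, pageD_mk, ← Submodule.Quotient.mk_zero]
  exact congrArg _ (Subtype.ext (K.totD_totD _ _ _ _ _ _))

/-- The page `E_r`. -/
noncomputable def page (r : ℤ) :
    HomologicalComplex (ModuleCat.{w} k) (ComplexShape.up' (⟨r, 1 - r⟩ : ℤ × ℤ)) where
  X a := ModuleCat.of k (K.PageX r a.1 (a.1 + a.2))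
  d a b := if h : b.1 = a.1 + r ∧ a.1 + a.2 + 1 = b.1 + b.2 then
    ModuleCat.ofHom (K.pageD r a.1 b.1 (a.1 + a.2) (b.1 + b.2) h.1 h.2) else 0
  shape a b hab := dif_neg fun h => hab (Prod.ext h.1.symm (by
    change a.2 + (1 - r) = b.2
    omega))
  d_comp_d' a b c hab hbc := by
    obtain rfl : a + _ = b := hab
    obtain rfl : _ + _ = c := hbc
    rw [dif_pos ⟨rfl, by simp only [Prod.fst_add, Prod.snd_add]; omega⟩,
      dif_pos ⟨rfl, by simp only [Prod.fst_add, Prod.snd_add]; omega⟩]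
    exact ModuleCat.hom_ext (LinearMap.ext fun x => K.pageD_pageD _ _ _ _ x)

theorem page_d {r : ℤ} {a b : ℤ × ℤ} (h₁ : b.1 = a.1 + r) (h₂ : a.1 + a.2 + 1 = b.1 + b.2) :
    (K.page r).d a b = ModuleCat.ofHom (K.pageD r a.1 b.1 (a.1 + a.2) (b.1 + b.2) h₁ h₂) :=
  dif_pos ⟨h₁, h₂⟩

theorem up'_next (r : ℤ) (a : ℤ × ℤ) :
    (ComplexShape.up' (⟨r, 1 - r⟩ : ℤ × ℤ)).next a = (a.1 + r, a.2 + (1 - r)) :=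
  ComplexShape.next_eq' _ rfl

theorem up'_prev (r : ℤ) (a : ℤ × ℤ) :
    (ComplexShape.up' (⟨r, 1 - r⟩ : ℤ × ℤ)).prev a = (a.1 - r, a.2 - (1 - r)) :=
  ComplexShape.prev_eq' _ (Prod.ext (Int.sub_add_cancel _ _) (Int.sub_add_cancel _ _))

theorem Z_succ_le (r p n : ℤ) : K.Z (r + 1) p n ≤ K.Z r p n :=
  fun _ hx => ⟨hx.1, K.fil_anti _ (by omega) hx.2⟩

/-- The canonical map `Z_r^p ⟶ E_r^{p,q}`. -/
noncomputable def toPage (r p q n : ℤ) (h : p + q = n) : K.Z r p n →ₗ[k] (K.page r).X (p, q) := by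
  subst h
  exact Submodule.mkQ _

theorem toPage_surjective (r p q n : ℤ) (h : p + q = n) :
    Function.Surjective (K.toPage r p q n h) := by
  subst h
  exact Submodule.mkQ_surjective _

theorem ker_toPage (r p q n : ℤ) (h : p + q = n) :
    LinearMap.ker (K.toPage r p q n h) = (K.B r p n).submoduleOf (K.Z r p n) := by
  subst h
  exact Submodule.ker_mkQ _

theorem toPage_eq_zero_iff {r p q n : ℤ} (h : p + q = n) (x : K.Z r p n) :
    K.toPage r p q n h x = 0 ↔ x.1 ∈ K.B r p n := by
  rw [← LinearMap.mem_ker, ker_toPage]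
  rfl

theorem toPage_eq_iff {r p q n : ℤ} (h : p + q = n) (x y : K.Z r p n) :
    K.toPage r p q n h x = K.toPage r p q n h y ↔ x.1 - y.1 ∈ K.B r p n := by
  rw [← sub_eq_zero, ← map_sub, toPage_eq_zero_iff]
  rfl

theorem page_d_toPage {r p q p' q' n n' : ℤ} (hp : p' = p + r) (h : p + q = n) (h' : p' + q' = n')
    (hn : n + 1 = n') (x : K.Z r p n) :
    ((K.page r).d (p, q) (p', q')).hom (K.toPage r p q n h x) =
      K.toPage r p' q' n' h' (K.zD r p p' n n' hp hn x) := by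
  subst h h'
  exact congrArg (fun f => f.hom (K.toPage r p q _ rfl x)) (page_d (a := (p, q)) (b := (p', q')) K hp hn)

/-- The summand `Z_{r-1}^{p+1}` of `B_r^p`. Changing a representative by such an element does not
change its class in `E_r`. -/
theorem mem_B_of_mem_fil {r p n n' : ℤ} (h : n + 1 = n') {x : K.Tot n} (hx : x ∈ K.fil (p + 1) n)
    (hx' : K.totD n n' h x ∈ K.fil (p + r) n') : x ∈ K.B r p n := by
  refine (K.mem_B_iff (Int.sub_add_cancel n 1) h (Int.sub_add_cancel (p + 1) r) rfl).2
      ⟨x, 0, hx, hx', zero_mem_fil _ _ _, ?_, ?_⟩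
  · rw [map_zero]
    exact zero_mem_fil _ _ _
  · rw [map_zero, add_zero]

theorem page_d_toPage_eq_zero (r p q n : ℤ) (h : p + q = n) (x : K.Z (r + 1) p n) :
    ((K.page r).d (p, q) (p + r, q + (1 - r))).hom
      (K.toPage r p q n h (Submodule.inclusion (K.Z_succ_le r p n) x)) = 0 := by
  rw [K.page_d_toPage rfl h (by omega) rfl, toPage_eq_zero_iff]
  refine K.mem_B_of_mem_fil rfl ((K.mem_Z_iff rfl (by omega)).1 x.2).2 ?_
  change K.totD _ _ _ (K.totD _ _ _ _) ∈ K.fil (p + r + r) (n + 1 + 1)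
  rw [totD_totD]
  exact zero_mem_fil _ _ _

/-- The map `Z_{r+1}^p ⟶ H(E_r)`. -/
noncomputable def zToHomology (r p q n : ℤ) (h : p + q = n) :
    K.Z (r + 1) p n →ₗ[k] (K.page r).homology (p, q) :=
  (cocycleClass (K.page r) (up'_next r (p, q))).comp
    (((K.toPage r p q n h).comp (Submodule.inclusion (K.Z_succ_le r p n))).codRestrict _
      (K.page_d_toPage_eq_zero r p q n h))

/-- A `d_r`-cocycle has a representative `x` with `Dx = u + Dv`, where `u ∈ F^{p+r+1}` and `v ∈
F^{p+1}`. Then `x - v` lies in `Z_{r+1}^p`, and it represents the same class because `v ∈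
Z_{r-1}^{p+1}`. -/
theorem zToHomology_surjective (r p q n : ℤ) (h : p + q = n) :
    Function.Surjective (K.zToHomology r p q n h) := by
  intro y
  obtain ⟨⟨y, hy⟩, rfl⟩ := cocycleClass_surjective (K.page r) (up'_next r (p, q)) y
  obtain ⟨x, rfl⟩ := K.toPage_surjective r p q n h y
  have hy' := LinearMap.mem_ker.1 hy
  rw [K.page_d_toPage rfl h (by dsimp only; omega) rfl, toPage_eq_zero_iff] at hy'
  obtain ⟨u, v, h₁, h₂, h₃, h₄, e⟩ := (K.mem_B_iff (l := p + 1) rfl rfl (by omega) rfl).1 hy'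
  have e' : K.totD _ _ rfl x.1 = u + K.totD _ _ rfl v := e.symm
  have hxv : x.1 - v ∈ K.Z (r + 1) p n := by
    refine (K.mem_Z_iff rfl rfl).2 ⟨sub_mem x.2.1 (K.fil_anti _ (by omega) h₃), ?_⟩
    rw [map_sub, e', add_sub_cancel_right, ← add_assoc]
    exact h₁
  refine ⟨⟨_, hxv⟩, congrArg (cocycleClass (K.page r) _) (Subtype.ext ?_)⟩
  refine (K.toPage_eq_iff h _ _).2 ?_
  change x.1 - v - x.1 ∈ K.B r p n
  rw [sub_sub_cancel_left]
  refine K.mem_B_of_mem_fil rfl (neg_mem h₃) ?_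
  rw [map_neg]
  exact neg_mem h₄

/-- If `x` bounds in `E_r`, then `Dy - x = u + Dv` with `y ∈ Z_r^{p-r}` and `u + Dv ∈ B_r^p`. Since
`v ∈ F^{p-r+1}` can be absorbed into `y`, the equation `x = -u + D(y - v)` is a decomposition of the
kind required by `B_{r+1}^p`. The converse reads the same equation backwards. -/
theorem ker_zToHomology (r p q n : ℤ) (h : p + q = n) :
    LinearMap.ker (K.zToHomology r p q n h) = (K.B (r + 1) p n).submoduleOf _ := by
  ext ⟨x, hx⟩
  have hm : n - 1 + 1 = n := Int.sub_add_cancel n 1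
  refine (cocycleClass_eq_zero_iff _ _ (up'_prev r (p, q)) _).trans ?_
  constructor
  · rintro ⟨y, hy⟩
    obtain ⟨y, rfl⟩ := K.toPage_surjective r (p - r) (q - (1 - r)) (n - 1) (by omega) y
    rw [K.page_d_toPage (Int.sub_add_cancel p r).symm (by dsimp only; omega) h hm] at hy
    have hb : K.totD _ _ hm y.1 - x ∈ K.B r p n := (K.toPage_eq_iff h _ _).1 hy
    obtain ⟨u, v, h₁, h₂, h₃, h₄, e⟩ := (K.mem_B_iff hm rfl (Int.sub_add_cancel (p + 1) r) rfl).1 hb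
    have e₁ : x = -u + K.totD _ _ hm (y.1 - v) := by
      rw [map_sub, ← sub_eq_zero, ← sub_eq_zero.2 e]
      abel
    refine (K.mem_B_iff (l := p - r) hm rfl (by omega) rfl).2 ⟨-u, y.1 - v, neg_mem h₁, ?_,
      sub_mem y.2.1 (K.fil_anti _ (by omega) h₃), ?_, e₁.symm⟩
    -- Membership in `B_r` gives only `Du ∈ F^{p+r}`. The missing step of filtration comes from
    -- `D(-u) = Dx` and `x ∈ Z_{r+1}^p`.
    · have e₂ : K.totD _ _ rfl x = K.totD _ _ rfl (-u) := by
        rw [e₁, map_add, totD_totD, add_zero]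
      rw [← e₂]
      exact ((K.mem_Z_iff rfl rfl).1 hx).2
    · rw [map_sub]
      exact sub_mem ((K.mem_Z_iff hm (by omega)).1 y.2).2 h₄
  · intro hb
    obtain ⟨u, v, h₁, h₂, h₃, h₄, e⟩ :=
      (K.mem_B_iff (l := p - r) hm rfl (by omega) rfl).1 hb
    refine ⟨K.toPage r (p - r) (q - (1 - r)) (n - 1) (by omega)
      ⟨v, (K.mem_Z_iff hm (by omega)).2 ⟨h₃, h₄⟩⟩, ?_⟩
    rw [K.page_d_toPage (Int.sub_add_cancel p r).symm (by dsimp only; omega) h hm]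
    refine (K.toPage_eq_iff h _ _).2 ?_
    change K.totD _ _ hm v - x ∈ K.B r p n
    have e' : x = u + K.totD _ _ hm v := e.symm
    rw [e', sub_add_cancel_right]
    refine K.mem_B_of_mem_fil rfl (neg_mem h₁) ?_
    rw [map_neg]
    exact neg_mem (K.fil_anti _ (by omega) h₂)

/-- The isomorphism `H(E_r) ≅ E_{r+1}`. -/
noncomputable def pageIso (r p q : ℤ) :
    (K.page r).homology (p, q) ≃ₗ[k] (K.page (r + 1)).X (p, q) :=
  linearEquivOfKerEq (K.zToHomology r p q _ rfl) (K.toPage (r + 1) p q _ rfl)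
    (K.zToHomology_surjective r p q _ rfl) (K.toPage_surjective _ _ _ _ _)
    ((K.ker_zToHomology _ _ _ _ _).trans (K.ker_toPage _ _ _ _ _).symm)

theorem pageIso_zToHomology (r p q n : ℤ) (h : p + q = n) (x : K.Z (r + 1) p n) :
    K.pageIso r p q (K.zToHomology r p q n h x) = K.toPage (r + 1) p q n h x := by
  subst h
  exact linearEquivOfKerEq_apply _ _ _ _ _ _

/-- The spectral sequence of the column filtration. -/
noncomputable def spectralSequence : CohomologicalSpectralSequence (ModuleCat.{w} k) 0 where
  page r _ := K.page r
  iso r r' a h _ := (K.pageIso r a.1 a.2).toModuleIso ≪≫ eqToIso (by rw [h])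

/-- The spectral sequence of the column filtration starts with `Z_r^p / B_r^p`. -/
noncomputable def spectralSequenceData : K.ColumnFiltrationData K.spectralSequence where
  π r _ := K.toPage r
  surjective_π r _ := K.toPage_surjective r
  ker_π r _ := K.ker_toPage r
  d_π r hr p q n h p' q' h' hp x y e :=
    (K.page_d_toPage hp h h' rfl x).trans (congrArg _ (Subtype.ext e.symm))
  iso_π r hr p q n h x y e c hc := by
    have : (K.page r).homologyπ (p, q) c = K.zToHomology r p q n h y :=
      homologyπ_eq_cocycleClass _ _ _ _ (hc.trans (congrArg _ (Subtype.ext e.symm)))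
    refine Eq.trans ?_ (K.pageIso_zToHomology r p q n h y)
    rw [← this]
    rfl

/-- For `p < 0` also `F^{p+1} Tot = Tot`, so all of `Z_r^p` lies in the summand `Z_{r-1}^{p+1}` of
`B_r^p`. -/
theorem isZero_page (r p q : ℤ) (hp : p < 0) : Limits.IsZero ((K.page r).X (p, q)) := by
  have : Subsingleton ((K.page r).X (p, q)) := by
    refine subsingleton_of_forall_eq 0 fun y => ?_
    obtain ⟨x, rfl⟩ := K.toPage_surjective r p q _ rfl y
    refine (K.toPage_eq_zero_iff _ _).2 (K.mem_B_of_mem_fil rfl (fun a ha => ?_) x.2.2)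
    have := Int.natCast_nonneg a.1.1
    omega
  exact ModuleCat.isZero_of_subsingleton _

end DoubleComplex

/-! ### Convergence -/

namespace DoubleComplex

open CategoryTheory

variable {k : Type uk} [Field k] (K : DoubleComplex.{uk, w} k)

theorem mem_fil_of_nonpos {p n : ℤ} (hp : p ≤ 0) (x : K.Tot n) : x ∈ K.fil p n := fun a ha => by
  have := Int.natCast_nonneg a.1.1
  omega

theorem eq_zero_of_forall_mem_fil {n : ℤ} {x : K.Tot n} (h : ∀ p : ℕ, x ∈ K.fil p n) : x = 0 :=
  funext fun a => h (a.1.1 + 1) a (by push_cast; omega)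

/-- The complete filtration: elements of `F^p` can be summed over all `p`. -/
theorem exists_telescope {n : ℤ} (u : ℕ → K.Tot n) (hu : ∀ p : ℕ, u p ∈ K.fil p n) :
    ∃ t : ℕ → K.Tot n, ∀ p : ℕ, t p ∈ K.fil p n ∧ u p = t p - t (p + 1) := by
  -- This is `t_p = ∑_{q ≥ p} u_q`. In column `s` the terms with `q > s` vanish, so the sum is cut
  -- off at `q = s`.
  refine ⟨fun p a => ∑ q ∈ Finset.Ico p (a.1.1 + 1), u q a, fun p => ⟨fun a ha => ?_, ?_⟩⟩
  · beta_reduce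
    rw [Finset.Ico_eq_empty (by omega), Finset.sum_empty]
  · funext a
    rw [Pi.sub_apply]
    beta_reduce
    by_cases h : p < a.1.1 + 1
    · rw [Finset.sum_eq_sum_Ico_succ_bot h, add_sub_cancel_right]
    · rw [Finset.Ico_eq_empty h, Finset.Ico_eq_empty (by omega), Finset.sum_empty, sub_self]
      exact hu p a (by omega)

/-- This is `lim_p F^p Tot = 0`: the sequence is constant and its value lies in every `F^p`. The
preceding result is `lim¹_p F^p Tot = 0`. -/
theorem eq_zero_of_telescope {n : ℤ} {t : ℕ → K.Tot n} (h : ∀ p : ℕ, t p ∈ K.fil p n)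
    (h' : ∀ p, t p - t (p + 1) = 0) (p : ℕ) : t p = 0 := by
  have h₁ : ∀ q, t q = t 0 := fun q => by
    induction q with
    | zero => rfl
    | succ q ih => rw [← ih, eq_comm, ← sub_eq_zero, h']
  rw [h₁]
  exact K.eq_zero_of_forall_mem_fil fun q => h₁ q ▸ h q

/-! Cohomology classes. -/

/-- The cocycles of `F^p Tot^n`. -/
def filCocycles (p n : ℤ) : Submodule k (K.Tot n) :=
  K.fil p n ⊓ LinearMap.ker (K.totD n (n + 1) rfl)

theorem filComplex_d (p n n' : ℤ) (h : n + 1 = n') : (K.filComplex p).d n n' =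
    ModuleCat.ofHom ((K.totD n n' h).restrict fun _ hx => K.totD_mem_fil p n n' h hx) :=
  dif_pos h

theorem totComplex_d (n n' : ℤ) (h : n + 1 = n') :
    K.totComplex.d n n' = ModuleCat.ofHom (K.totD n n' h) :=
  dif_pos h

/-- The class of a cocycle in `H^n(F^p Tot)`. -/
noncomputable def filClass (p n : ℤ) : K.filCocycles p n →ₗ[k] (K.filComplex p).homology n :=
  (cocycleClass (K.filComplex p) (CochainComplex.next ℤ n)).comp
    ((Submodule.inclusion inf_le_left).codRestrict _ fun x => by
      change ((K.filComplex p).d n (n + 1)).hom (Submodule.inclusion inf_le_left x) = 0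
      rw [filComplex_d K p n _ rfl]
      exact Subtype.ext x.2.2)

/-- The class of a cocycle in `H^n(Tot)`. -/
noncomputable def totClass (n : ℤ) :
    LinearMap.ker (K.totD n (n + 1) rfl) →ₗ[k] K.totComplex.homology n :=
  (cocycleClass K.totComplex (CochainComplex.next ℤ n)).comp
    ((Submodule.subtype _).codRestrict _ fun x => by
      change (K.totComplex.d n (n + 1)).hom x.1 = 0
      rw [totComplex_d K n _ rfl]
      exact x.2)

theorem filClass_surjective (p n : ℤ) : Function.Surjective (K.filClass p n) := fun y => by
  obtain ⟨⟨y, hy⟩, rfl⟩ := cocycleClass_surjective _ (CochainComplex.next ℤ n) y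
  refine ⟨⟨y.1, y.2, ?_⟩, rfl⟩
  rw [LinearMap.mem_ker, filComplex_d K p n _ rfl] at hy
  exact congrArg Subtype.val hy

theorem totClass_surjective (n : ℤ) : Function.Surjective (K.totClass n) := fun y => by
  obtain ⟨⟨y, hy⟩, rfl⟩ := cocycleClass_surjective _ (CochainComplex.next ℤ n) y
  refine ⟨⟨y, ?_⟩, rfl⟩
  rw [LinearMap.mem_ker, totComplex_d K n _ rfl] at hy
  exact hy

theorem filClass_eq_zero_iff {p m n : ℤ} (h : m + 1 = n) (x : K.filCocycles p n) :
    K.filClass p n x = 0 ↔ ∃ y ∈ K.fil p m, K.totD m n h y = x := by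
  obtain rfl : m = n - 1 := by omega
  refine (cocycleClass_eq_zero_iff _ (CochainComplex.next ℤ n) (CochainComplex.prev ℤ n) _).trans ?_
  rw [filComplex_d K p _ n h]
  exact ⟨fun ⟨y, hy⟩ => ⟨y.1, y.2, congrArg Subtype.val hy⟩,
    fun ⟨y, hy, e⟩ => ⟨⟨y, hy⟩, Subtype.ext e⟩⟩

theorem totClass_eq_zero_iff {m n : ℤ} (h : m + 1 = n) (x : LinearMap.ker (K.totD n (n + 1) rfl)) :
    K.totClass n x = 0 ↔ ∃ y, K.totD m n h y = x := by
  obtain rfl : m = n - 1 := by omega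
  refine (cocycleClass_eq_zero_iff _ (CochainComplex.next ℤ n) (CochainComplex.prev ℤ n) _).trans ?_
  rw [totComplex_d K _ n h]
  exact Iff.rfl

theorem filCocycles_anti {p p' : ℤ} (n : ℤ) (h : p ≤ p') : K.filCocycles p' n ≤ K.filCocycles p n :=
  inf_le_inf_right _ (K.fil_anti n h)

theorem filStep_filClass (p n : ℤ) (x : K.filCocycles (p + 1) n) :
    (HomologicalComplex.homologyMap (K.filStep p) n).hom (K.filClass (p + 1) n x) =
      K.filClass p n (Submodule.inclusion (K.filCocycles_anti n (by omega)) x) :=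
  homologyMap_cocycleClass _ _ _ _ _ rfl

theorem filInc_filClass (p n : ℤ) (x : K.filCocycles p n) :
    (HomologicalComplex.homologyMap (K.filInc p) n).hom (K.filClass p n x) =
      K.totClass n (Submodule.inclusion inf_le_right x) :=
  homologyMap_cocycleClass _ _ _ _ _ rfl

theorem mem_filH_iff {p n : ℤ} (y : K.totComplex.homology n) : y ∈ K.filH p n ↔
    ∃ x : K.filCocycles p n, K.totClass n (Submodule.inclusion inf_le_right x) = y := by
  constructor
  · rintro ⟨z, rfl⟩
    obtain ⟨x, rfl⟩ := K.filClass_surjective p n z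
    exact ⟨x, (K.filInc_filClass p n x).symm⟩
  · rintro ⟨x, rfl⟩
    exact ⟨_, K.filInc_filClass p n x⟩

theorem filH_zero (n : ℤ) : K.filH 0 n = ⊤ := by
  refine Submodule.eq_top_iff'.2 fun y => ?_
  obtain ⟨x, rfl⟩ := K.totClass_surjective n y
  exact (K.mem_filH_iff _).2 ⟨⟨x.1, K.mem_fil_of_nonpos le_rfl _, x.2⟩, rfl⟩

/-- For the limit, represent a compatible sequence of classes by cocycles `x_p` with `x_p - x_{p+1}
= D c_p`. If `t_p` is the sum of the `c_q` with `q ≥ p`, then `x_p - D t_p` is independent of `p`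
and lies in every `F^p`, so that `x_p = D t_p`. For the derived limit, sum the representing cocycles
themselves: the `D t_p` are all equal and lie in every `F^p`, so the `t_p` are cocycles. -/
theorem convergesConditionally : K.ConvergesConditionally where
  exhaustive := K.filH_zero
  lim_eq_zero n a b hab := by
    have h : ∀ p : ℕ, ∃ x, K.filClass p n x = a p - b p := fun p => K.filClass_surjective p n _
    choose x hx using h
    have hm : n - 1 + 1 = n := Int.sub_add_cancel n 1
    have h₁ : ∀ p : ℕ, ∃ c ∈ K.fil p (n - 1), K.totD (n - 1) n hm c = (x p).1 - (x (p + 1)).1 := by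
      intro p
      refine (K.filClass_eq_zero_iff hm
        (x p - Submodule.inclusion (K.filCocycles_anti n (by push_cast; omega)) (x (p + 1)))).1 ?_
      have h₂ := congrFun hab p
      have h₃ := K.filStep_filClass p n (x (p + 1))
      rw [map_sub, ← h₃]
      have h₄ : K.filClass (p + 1) n (x (p + 1)) = a (p + 1) - b (p + 1) := hx (p + 1)
      rw [h₄, hx, map_sub, sub_sub_sub_comm, sub_eq_zero]
      exact h₂
    choose c hc hc' using h₁
    obtain ⟨t, ht⟩ := K.exists_telescope c hc
    have h₅ := K.eq_zero_of_telescope (t := fun p => (x p).1 - K.totD (n - 1) n hm (t p))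
      (fun p => sub_mem (x p).2.1 (K.totD_mem_fil _ _ _ _ (ht p).1)) (fun p => by
        rw [sub_sub_sub_comm, ← map_sub, ← (ht p).2, hc', sub_self])
    funext p
    rw [← sub_eq_zero, ← hx]
    exact (K.filClass_eq_zero_iff hm _).2 ⟨t p, (ht p).1, (sub_eq_zero.1 (h₅ p)).symm⟩
  derivedLim_eq_zero n b := by
    have h : ∀ p : ℕ, ∃ x, K.filClass p n x = b p := fun p => K.filClass_surjective p n _
    choose x hx using h
    obtain ⟨t, ht⟩ := K.exists_telescope (fun p => (x p).1) (fun p => (x p).2.1)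
    have h₁ := K.eq_zero_of_telescope (t := fun p => K.totD n (n + 1) rfl (t p))
      (fun p => K.totD_mem_fil _ _ _ _ (ht p).1) (fun p => by
        rw [← map_sub, ← (ht p).2]
        exact (x p).2.2)
    refine ⟨fun p => K.filClass p n ⟨t p, (ht p).1, h₁ p⟩, funext fun p => ?_⟩
    have h₂ := K.filStep_filClass p n ⟨t (p + 1), (ht (p + 1)).1, h₁ (p + 1)⟩
    refine (congrArg (_ - ·) h₂).trans ?_
    rw [← map_sub, ← hx]
    exact congrArg _ (Subtype.ext (ht p).2.symm)

/-! The comparison of the associated graded with the limit page. -/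

theorem filCocycles_le_ZInf (p n : ℤ) : K.filCocycles p n ≤ K.ZInf p n := fun x hx =>
  (Submodule.mem_iInf _).2 fun r => Submodule.mem_sup_left ⟨hx.1, by
    change K.totD n (n + 1) rfl x ∈ K.fil (p + r) (n + 1)
    rw [LinearMap.mem_ker.1 hx.2]
    exact zero_mem_fil _ _ _⟩

/-- The map from the cocycles of `F^p Tot` to `F^p H / F^{p+1} H`. -/
noncomputable def toGrH (p n : ℤ) : K.filCocycles p n →ₗ[k] K.GrH p n :=
  (Submodule.mkQ _).comp (((K.totClass n).comp (Submodule.inclusion inf_le_right)).codRestrict _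
    fun x => (K.mem_filH_iff _).2 ⟨x, rfl⟩)

/-- The map from the cocycles of `F^p Tot` to the limit page. -/
noncomputable def toEInf (p n : ℤ) : K.filCocycles p n →ₗ[k] K.EInf p n :=
  (Submodule.mkQ _).comp (Submodule.inclusion (K.filCocycles_le_ZInf p n))

theorem toGrH_surjective (p n : ℤ) : Function.Surjective (K.toGrH p n) := fun y => by
  obtain ⟨⟨y, hy⟩, rfl⟩ := Submodule.Quotient.mk_surjective _ y
  obtain ⟨x, rfl⟩ := (K.mem_filH_iff _).1 hy
  exact ⟨x, rfl⟩

theorem BInf_le (p m n : ℤ) (h : m + 1 = n) :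
    K.BInf p n ≤ K.fil (p + 1) n ⊔ LinearMap.range (K.totD m n h) := by
  refine iSup_le fun r => sup_le (fun x hx => ?_) le_sup_left
  obtain ⟨u, v, h₁, -, -, -, rfl⟩ :=
    (K.mem_B_iff h rfl (Int.sub_add_cancel (p + 1) r) rfl).1 hx
  exact Submodule.add_mem_sup h₁ ⟨v, rfl⟩

/-- The half-plane condition enters here: a differential into column `p` starts in a column `≥ 0`,
so every coboundary in `F^p` is hit at a finite stage. -/
theorem mem_BInf {p m n : ℤ} (h : m + 1 = n) {u : K.Tot n} {v : K.Tot m} (hu : u ∈ K.fil (p + 1) n)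
    (hv : K.totD m n h v ∈ K.fil p n) : u + K.totD m n h v ∈ K.BInf p n := by
  -- For this `r` one has `p - r + 1 ≤ 0`, so the condition `v ∈ F^{p-r+1}` is void.
  refine Submodule.mem_iSup_of_mem (p + 1).toNat ?_
  refine add_mem (Submodule.mem_sup_right hu) (Submodule.mem_sup_left ?_)
  refine (K.mem_B_iff h rfl (Int.sub_add_cancel (p + 1) _) rfl).2 ⟨0, v, zero_mem_fil _ _ _, ?_,
    K.mem_fil_of_nonpos (by omega) _, hv, zero_add _⟩
  rw [map_zero]
  exact zero_mem_fil _ _ _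

/-- The class of `x` comes from `F^{p+1}` exactly when `x` is a coboundary plus a cocycle of
`F^{p+1}`. In a decomposition `x = u + Dv` the term `u` is automatically a cocycle. Hence the kernel
agrees with that of the map to `E_∞`, which makes the canonical map well defined and injective. -/
theorem toGrH_eq_zero_iff {p n : ℤ} (x : K.filCocycles p n) :
    K.toGrH p n x = 0 ↔ x.1 ∈ K.BInf p n := by
  have hm : n - 1 + 1 = n := Int.sub_add_cancel n 1
  refine (Submodule.Quotient.mk_eq_zero _).trans ?_
  change K.totClass n _ ∈ K.filH (p + 1) n ↔ _
  rw [mem_filH_iff]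
  constructor
  · rintro ⟨x', hx'⟩
    rw [eq_comm, ← sub_eq_zero, ← map_sub, totClass_eq_zero_iff _ hm] at hx'
    obtain ⟨y, hy⟩ := hx'
    have hy' : K.totD (n - 1) n hm y = x.1 - x'.1 := hy
    have := K.mem_BInf (p := p) hm (u := x'.1) (v := y) x'.2.1
      (hy' ▸ sub_mem x.2.1 (K.fil_anti n (by omega) x'.2.1))
    rwa [hy', add_sub_cancel] at this
  · intro hx
    obtain ⟨u, hu, _, ⟨v, rfl⟩, e⟩ := Submodule.mem_sup.1 (K.BInf_le p _ n hm hx)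
    have hu' : K.totD n (n + 1) rfl u = 0 := by
      have : K.totD n (n + 1) rfl x.1 = 0 := x.2.2
      rwa [← e, map_add, totD_totD, add_zero] at this
    refine ⟨⟨u, hu, hu'⟩, ?_⟩
    rw [eq_comm, ← sub_eq_zero, ← map_sub, totClass_eq_zero_iff _ hm]
    refine ⟨v, ?_⟩
    change _ = x.1 - u
    rw [← e, add_sub_cancel_left]

theorem toEInf_eq_zero_iff {p n : ℤ} (x : K.filCocycles p n) :
    K.toEInf p n x = 0 ↔ x.1 ∈ K.BInf p n :=
  Submodule.Quotient.mk_eq_zero _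

/-- The canonical map `F^p H / F^{p+1} H ⟶ E_∞`. -/
noncomputable def grToEInf (p n : ℤ) : K.GrH p n →ₗ[k] K.EInf p n :=
  (Submodule.liftQ _ (K.toEInf p n) fun x hx => LinearMap.mem_ker.2
    ((K.toEInf_eq_zero_iff x).2 ((K.toGrH_eq_zero_iff x).1 hx))).comp
    ((K.toGrH p n).quotKerEquivOfSurjective (K.toGrH_surjective p n)).symm.toLinearMap

theorem grToEInf_toGrH (p n : ℤ) (x : K.filCocycles p n) :
    K.grToEInf p n (K.toGrH p n x) = K.toEInf p n x := by
  have : ((K.toGrH p n).quotKerEquivOfSurjective (K.toGrH_surjective p n)).symm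
      (K.toGrH p n x) = Submodule.Quotient.mk x := by
    rw [LinearEquiv.symm_apply_eq]
    rfl
  rw [grToEInf, LinearMap.comp_apply, LinearEquiv.coe_coe, this]
  rfl

theorem grToEInf_injective (p n : ℤ) : Function.Injective (K.grToEInf p n) := by
  rw [injective_iff_map_eq_zero]
  intro y hy
  obtain ⟨x, rfl⟩ := K.toGrH_surjective p n y
  rw [grToEInf_toGrH] at hy
  exact (K.toGrH_eq_zero_iff x).2 ((K.toEInf_eq_zero_iff x).1 hy)

theorem grToEInf_isCanonical (p n : ℤ) : K.IsCanonical p n (K.grToEInf p n) := by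
  intro c a z ha hz
  have hd := d_iCycles (K.filComplex p) c (n + 1)
  rw [filComplex_d K p n _ rfl] at hd
  have h : z.1 ∈ K.filCocycles p n := by
    rw [hz]
    exact ⟨Subtype.prop _, congrArg Subtype.val hd⟩
  have e₁ : (K.filComplex p).homologyπ n c = K.filClass p n ⟨z, h⟩ :=
    homologyπ_eq_cocycleClass _ _ _ _ (Subtype.ext hz.symm)
  have e₂ : (Submodule.Quotient.mk a : K.GrH p n) = K.toGrH p n ⟨z, h⟩ := by
    refine congrArg Submodule.Quotient.mk (Subtype.ext ?_)
    rw [ha]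
    exact (congrArg _ e₁).trans (K.filInc_filClass p n _)
  rw [e₂, grToEInf_toGrH]
  rfl

/-! Strong convergence. -/

variable {K}

/-- The hypothesis controls `D z_r` by `F^{p+r}`, whereas here `D z_r ∈ F^r`. The sequence is
therefore shifted by `p`. The solution is continued to indices `r < p` by adding `z_r + ⋯ +
z_{p-1}`, which solves the equation exactly there. -/
theorem DerivedEInfVanishes.exists_sub_mem_fil (hK : K.DerivedEInfVanishes) {p : ℕ} {n : ℤ}
    (z : ℕ → K.Tot n) (hz : ∀ r : ℕ, z r ∈ K.fil p n)
    (hz' : ∀ r : ℕ, K.totD n (n + 1) rfl (z r) ∈ K.fil r (n + 1)) :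
    ∃ y : ℕ → K.Tot n, (∀ r : ℕ, y r ∈ K.fil p n) ∧
      (∀ r : ℕ, K.totD n (n + 1) rfl (y r) ∈ K.fil r (n + 1)) ∧
      ∀ r, z r - (y r - y (r + 1)) ∈ K.fil (p + 1) n := by
  obtain ⟨y, hy⟩ := hK p n (fun r => z (p + r)) fun r => ⟨hz _, by exact_mod_cast hz' (p + r)⟩
  refine ⟨fun r => y (r - p) + ∑ i ∈ Finset.Ico r p, z i, fun r => ?_, fun r => ?_, fun r => ?_⟩
  · exact add_mem (hy _).1.1 (sum_mem fun i _ => hz i)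
  · rw [map_add, map_sum]
    refine add_mem (K.fil_anti _ (by omega) (hy (r - p)).1.2) (sum_mem fun i hi => ?_)
    exact K.fil_anti _ (by rw [Finset.mem_Ico] at hi; omega) (hz' i)
  · beta_reduce
    by_cases h : r < p
    · rw [Finset.sum_eq_sum_Ico_succ_bot h, Nat.sub_eq_zero_of_le h.le, Nat.sub_eq_zero_of_le h,
        add_sub_add_left_eq_sub, add_sub_cancel_right, sub_self]
      exact zero_mem_fil _ _ _
    · obtain ⟨r, rfl⟩ := Nat.exists_eq_add_of_le (not_lt.1 h)
      rw [Finset.Ico_eq_empty h, Finset.Ico_eq_empty (by omega), Finset.sum_empty,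
        add_zero, add_zero, Nat.add_sub_cancel_left, add_assoc, Nat.add_sub_cancel_left]
      exact (hy r).2

/-- The derived limit of the spaces `F^p ∩ D⁻¹ F^r` vanishes. -/
theorem DerivedEInfVanishes.exists_eq_sub (hK : K.DerivedEInfVanishes) {p : ℕ} {n : ℤ}
    (z : ℕ → K.Tot n) (hz : ∀ r : ℕ, z r ∈ K.fil p n)
    (hz' : ∀ r : ℕ, K.totD n (n + 1) rfl (z r) ∈ K.fil r (n + 1)) :
    ∃ y : ℕ → K.Tot n, (∀ r : ℕ, y r ∈ K.fil p n) ∧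
      (∀ r : ℕ, K.totD n (n + 1) rfl (y r) ∈ K.fil r (n + 1)) ∧ ∀ r, z r = y r - y (r + 1) := by
  let S (q : ℕ) : Type w := {z : ℕ → K.Tot n // (∀ r : ℕ, z r ∈ K.fil q n) ∧
    ∀ r : ℕ, K.totD n (n + 1) rfl (z r) ∈ K.fil r (n + 1)}
  -- Solving modulo `F^{q+1}` leaves an error sequence that satisfies the same conditions one
  -- filtration step deeper, so the procedure can be iterated.
  have step (q : ℕ) (z : S q) : ∃ (y : S q) (z' : S (q + 1)),
      ∀ r, z.1 r = y.1 r - y.1 (r + 1) + z'.1 r := by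
    obtain ⟨y, h₁, h₂, h₃⟩ := hK.exists_sub_mem_fil z.1 z.2.1 z.2.2
    refine ⟨⟨y, h₁, h₂⟩, ⟨fun r => z.1 r - (y r - y (r + 1)), fun r => by exact_mod_cast h₃ r,
      fun r => ?_⟩, fun r => (add_sub_cancel _ _).symm⟩
    rw [map_sub, map_sub]
    exact sub_mem (z.2.2 r) (sub_mem (h₂ r) (K.fil_anti _ (by push_cast; omega) (h₂ (r + 1))))
  choose Y Z' hYZ using step
  let seq : ∀ j : ℕ, S (p + j) := fun j => Nat.rec ⟨z, hz, hz'⟩ (fun j s => Z' (p + j) s) j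
  have hseq (j : ℕ) : seq (j + 1) = Z' (p + j) (seq j) := rfl
  have hmem (j r : ℕ) : (Y (p + j) (seq j)).1 r ∈ K.fil j n :=
    K.fil_anti _ (by push_cast; omega) ((Y (p + j) (seq j)).2.1 r)
  -- For fixed `r` the partial solutions lie deeper and deeper in the filtration. Their sum `t r 0`
  -- is the solution, and `t r j` is its tail from the `j`-th term on.
  have h (r : ℕ) := K.exists_telescope (fun j => (Y (p + j) (seq j)).1 r) fun j => hmem j r
  choose t ht using h
  have hsum (r j : ℕ) : t r 0 = ∑ i ∈ Finset.range j, (Y (p + i) (seq i)).1 r + t r j := by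
    induction j with
    | zero => simp
    | succ j ih => rw [ih, Finset.sum_range_succ, (ht r j).2]; abel
  have hz_sum (r j : ℕ) : z r = ∑ i ∈ Finset.range j, (Y (p + i) (seq i)).1 r -
      ∑ i ∈ Finset.range j, (Y (p + i) (seq i)).1 (r + 1) + (seq j).1 r := by
    induction j with
    | zero => simp [seq]
    | succ j ih =>
      rw [ih, Finset.sum_range_succ, Finset.sum_range_succ, hYZ (p + j) (seq j) r, hseq]
      abel
  refine ⟨fun r => t r 0, fun r => ?_, fun r => ?_, fun r => ?_⟩
  · beta_reduce
    rw [hsum r p]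
    exact add_mem (sum_mem fun i _ => K.fil_anti _ (by push_cast; omega)
      ((Y (p + i) (seq i)).2.1 r)) (ht r p).1
  · beta_reduce
    -- Cutting the sum at `j = r` is the right choice: each of the finitely many earlier terms has
    -- its differential in `F^r`, and the tail itself lies in `F^r`.
    rw [hsum r r, map_add, map_sum]
    exact add_mem (sum_mem fun i _ => (Y (p + i) (seq i)).2.2 r)
      (K.totD_mem_fil _ _ _ _ (ht r r).1)
  · rw [← sub_eq_zero]
    -- After `j` iterations the equation fails only by the error sequence and the two tails, all in
    -- `F^j`.
    refine K.eq_zero_of_forall_mem_fil fun j => ?_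
    have e : z r - (t r 0 - t (r + 1) 0) = (seq j).1 r - t r j + t (r + 1) j := by
      rw [hz_sum r j, hsum r j, hsum (r + 1) j]
      abel
    rw [e]
    exact add_mem (sub_mem (K.fil_anti _ (by push_cast; omega) ((seq j).2.1 r)) (ht r j).1)
      (ht (r + 1) j).1

variable (K)

/-- Completeness of `Tot` suffices. Represent `a_{p+1} - a_p` by cocycles in `F^p` and sum them: the
sums `t_p` are cocycles, and `a_p + [t_p]` is independent of `p`, hence is the limit. -/
theorem filH_complete (n : ℤ) (a : ℕ → K.totComplex.homology n)
    (ha : ∀ p : ℕ, a (p + 1) - a p ∈ K.filH p n) : ∃ b, ∀ p : ℕ, b - a p ∈ K.filH p n := by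
  have h (p : ℕ) := (K.mem_filH_iff _).1 (ha p)
  choose u hu using h
  obtain ⟨t, ht⟩ := K.exists_telescope (fun p => (u p).1) fun p => (u p).2.1
  have h₁ := K.eq_zero_of_telescope (t := fun p => K.totD n (n + 1) rfl (t p))
    (fun p => K.totD_mem_fil _ _ _ _ (ht p).1) (fun p => by
      rw [← map_sub, ← (ht p).2]
      exact (u p).2.2)
  have h₂ (p : ℕ) : a p + K.totClass n ⟨t p, h₁ p⟩ = a 0 + K.totClass n ⟨t 0, h₁ 0⟩ := by
    induction p with
    | zero => rfl
    | succ p ih =>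
      rw [← ih, ← sub_eq_zero, add_sub_add_comm, ← hu, ← map_sub, ← map_add]
      refine (K.totClass_eq_zero_iff (Int.sub_add_cancel n 1) _).2 ⟨0, ?_⟩
      rw [map_zero]
      change 0 = (u p).1 + (t (p + 1) - t p)
      rw [(ht p).2]
      abel
  refine ⟨a 0 + K.totClass n ⟨t 0, h₁ 0⟩, fun p => ?_⟩
  rw [← h₂ p, add_sub_cancel_left]
  exact (K.mem_filH_iff _).2 ⟨⟨t p, (ht p).1, h₁ p⟩, rfl⟩

variable {K}

/-- If the class of `x` lies in every `F^p H`, there are `w_p` with `x - D w_p ∈ F^p`. Then `D(w_r -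
w_{r+1}) ∈ F^r`, so vanishing of `lim¹` gives `w_r - w_{r+1} = y_r - y_{r+1}` with `D y_r ∈ F^r`.
The constant value `w = w_r - y_r` satisfies `x - Dw ∈ F^r` for all `r`, that is, `x = Dw`. -/
theorem DerivedEInfVanishes.iInf_filH (hK : K.DerivedEInfVanishes) (n : ℤ) :
    ⨅ p : ℕ, K.filH p n = ⊥ := by
  obtain ⟨m, rfl⟩ : ∃ m, n = m + 1 := ⟨n - 1, (Int.sub_add_cancel n 1).symm⟩
  refine (Submodule.eq_bot_iff _).2 fun h hh => ?_
  obtain ⟨x, rfl⟩ := K.totClass_surjective _ h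
  have h₁ (p : ℕ) : ∃ w, x.1 - K.totD m _ rfl w ∈ K.fil p (m + 1) := by
    obtain ⟨x', hx'⟩ := (K.mem_filH_iff _).1 ((Submodule.mem_iInf _).1 hh p)
    rw [eq_comm, ← sub_eq_zero, ← map_sub, totClass_eq_zero_iff _ rfl] at hx'
    obtain ⟨w, hw⟩ := hx'
    refine ⟨w, ?_⟩
    rw [hw]
    change x.1 - (x.1 - x'.1) ∈ K.fil p (m + 1)
    rw [sub_sub_cancel]
    exact x'.2.1
  choose w hw using h₁
  obtain ⟨y, -, hy, e⟩ := hK.exists_eq_sub (p := 0) (fun r => w r - w (r + 1))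
    (fun r => K.mem_fil_of_nonpos (by simp) _) (fun r => by
      have := sub_mem (K.fil_anti _ (by push_cast; omega : (r : ℤ) ≤ (r + 1 : ℕ)) (hw (r + 1)))
        (hw r)
      rwa [sub_sub_sub_cancel_left, ← map_sub] at this)
  have h₂ (r : ℕ) : w r - y r = w 0 - y 0 := by
    induction r with
    | zero => rfl
    | succ r ih =>
      rw [← ih, ← sub_eq_zero, sub_sub_sub_comm, ← neg_sub (w r), e]
      abel
  refine (K.totClass_eq_zero_iff rfl x).2 ⟨w 0 - y 0, ?_⟩
  rw [eq_comm, ← sub_eq_zero]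
  refine K.eq_zero_of_forall_mem_fil fun r => ?_
  rw [← h₂ r, map_sub, sub_sub_eq_add_sub, add_sub_right_comm]
  exact add_mem (hw r) (hy r)

/-- A permanent cycle `z` agrees modulo `F^{p+1}` with elements `c_r` such that `D c_r ∈ F^r`.
Corrections `y_r` make `c_r - y_r` independent of `r`, and this common value is a genuine cocycle.
-/
theorem DerivedEInfVanishes.grToEInf_surjective (hK : K.DerivedEInfVanishes) (p n : ℤ) :
    Function.Surjective (K.grToEInf p n) := by
  intro y
  obtain ⟨⟨z, hz⟩, rfl⟩ := Submodule.Quotient.mk_surjective _ y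
  obtain hp | ⟨p, rfl⟩ := (lt_or_ge p 0).imp_right Int.eq_ofNat_of_zero_le
  -- In negative filtration `F^{p+1} = Tot`, so `E_∞` vanishes.
  · refine ⟨0, ?_⟩
    rw [map_zero, eq_comm, Submodule.Quotient.mk_eq_zero]
    exact Submodule.mem_iSup_of_mem 0 (Submodule.mem_sup_right (K.mem_fil_of_nonpos (by omega) _))
  have h₁ (r : ℕ) : ∃ c ∈ K.fil p n, K.totD n (n + 1) rfl c ∈ K.fil r (n + 1) ∧
      z - c ∈ K.fil (p + 1) n := by
    -- The subtraction is truncated; `p + (r - p) ≥ r` holds in any case, which is all that is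
    -- needed.
    obtain ⟨c, hc, f, hf, e⟩ := Submodule.mem_sup.1 ((Submodule.mem_iInf _).1 hz (r - p))
    refine ⟨c, hc.1, K.fil_anti _ (by omega) hc.2, ?_⟩
    rwa [← e, add_sub_cancel_left]
  choose c hc hc' hzc using h₁
  -- The differences lie in `F^{p+1}`, and the corrections are taken there too, so that they do not
  -- change the class in `E_∞^p`.
  obtain ⟨y, hy, hy', e⟩ := hK.exists_eq_sub (p := p + 1) (n := n) (fun r => c r - c (r + 1))
    (fun r => by
      have := sub_mem (hzc (r + 1)) (hzc r)
      rw [sub_sub_sub_cancel_left] at this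
      exact_mod_cast this)
    (fun r => by
      rw [map_sub]
      exact sub_mem (hc' r) (K.fil_anti _ (by push_cast; omega) (hc' (r + 1))))
  have h₂ (r : ℕ) : c r - y r = c 0 - y 0 := by
    induction r with
    | zero => rfl
    | succ r ih =>
      rw [← ih, ← sub_eq_zero, sub_sub_sub_comm, ← neg_sub (c r), e]
      abel
  have h₃ : c 0 - y 0 ∈ K.filCocycles p n := by
    refine ⟨sub_mem (hc 0) (K.fil_anti _ (by push_cast; omega) (hy 0)),
      K.eq_zero_of_forall_mem_fil fun r => ?_⟩
    rw [← h₂ r, map_sub]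
    exact sub_mem (hc' r) (hy' r)
  refine ⟨K.toGrH p n ⟨_, h₃⟩, ?_⟩
  rw [grToEInf_toGrH]
  refine (Submodule.Quotient.eq _).2 ?_
  change c 0 - y 0 - z ∈ K.BInf p n
  refine Submodule.mem_iSup_of_mem 0 (Submodule.mem_sup_right ?_)
  have := sub_mem (neg_mem (hzc 0)) (show y 0 ∈ K.fil (p + 1) n by exact_mod_cast hy 0)
  rwa [neg_sub, sub_right_comm] at this

variable (K)

theorem converges : K.Converges where
  conditionally := K.convergesConditionally
  gr_injective p n := ⟨_, K.grToEInf_isCanonical p n, K.grToEInf_injective p n⟩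
  strongly hK :=
    { exhaustive := K.filH_zero
      hausdorff := hK.iInf_filH
      complete := K.filH_complete
      gr := fun p n => ⟨_, K.grToEInf_isCanonical p n, K.grToEInf_injective p n,
        hK.grToEInf_surjective p n⟩ }

end DoubleComplex

/-! ### The second page -/

namespace DoubleComplex

open CategoryTheory

variable {k : Type uk} [Field k] (K : DoubleComplex.{uk, w} k)

theorem totD_apply_zero {n n' t t' : ℤ} (h : n + 1 = n') (ht : t + 1 = t')
    (e : ((0 : ℕ) : ℤ) + t = n) (e' : ((0 : ℕ) : ℤ) + t' = n') (x : K.Tot n) :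
    K.totD n n' h x ⟨(0, t'), e'⟩ = K.dv 0 t t' ht (x ⟨(0, t), e⟩) := by
  obtain rfl : t = t' - 1 := by omega
  rfl

theorem totD_apply_succ {n n' t t' : ℤ} {s : ℕ} (h : n + 1 = n') (ht : t + 1 = t')
    (e₁ : (s : ℤ) + t' = n) (e₂ : ((s + 1 : ℕ) : ℤ) + t = n) (e' : ((s + 1 : ℕ) : ℤ) + t' = n')
    (x : K.Tot n) :
    K.totD n n' h x ⟨(s + 1, t'), e'⟩ = K.dh s t' (x ⟨(s, t'), e₁⟩) +
      sgn k (s + 1) • K.dv (s + 1) t t' ht (x ⟨(s + 1, t), e₂⟩) := by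
  obtain rfl : t = t' - 1 := by omega
  rfl

theorem sgn_smul_eq_zero_iff {V : Type*} [AddCommGroup V] [Module k V] (n : ℤ) (x : V) :
    sgn k n • x = 0 ↔ x = 0 :=
  ⟨fun h => by rw [← one_smul k x, ← sgn_mul_self k n, mul_smul, h, smul_zero],
    fun h => by rw [h, smul_zero]⟩

theorem mem_fil_succ_iff {n t : ℤ} {s : ℕ} (e : (s : ℤ) + t = n) {x : K.Tot n}
    (hx : x ∈ K.fil s n) : x ∈ K.fil (s + 1) n ↔ x ⟨(s, t), e⟩ = 0 := by
  refine ⟨fun h => h ⟨(s, t), e⟩ (by dsimp only; omega), fun h => ?_⟩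
  rintro ⟨⟨s', t'⟩, e'⟩ hs
  rcases lt_or_ge (s' : ℤ) s with h' | h'
  · exact hx _ h'
  · dsimp only at hs e'
    obtain rfl : s' = s := by omega
    obtain rfl : t' = t := by omega
    exact h

theorem totD_mem_fil_succ_iff {n n' t t' : ℤ} {s : ℕ} (h : n + 1 = n') (ht : t + 1 = t')
    (e : (s : ℤ) + t = n) {x : K.Tot n} (hx : x ∈ K.fil s n) :
    K.totD n n' h x ∈ K.fil (s + 1) n' ↔ K.dv s t t' ht (x ⟨(s, t), e⟩) = 0 := by
  rw [K.mem_fil_succ_iff (t := t') (by omega) (K.totD_mem_fil _ _ _ h hx)]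
  cases s with
  | zero => rw [K.totD_apply_zero h ht e]
  | succ s =>
    rw [K.totD_apply_succ h ht (by push_cast at e; omega) e,
      hx ⟨(s, t'), _⟩ (by dsimp only; omega), map_zero, zero_add, sgn_smul_eq_zero_iff]

/-- Since `x` starts in column `s`, so does `Dx`, and `Dx ∈ F^{s+2}` is tested in the two columns
`s` and `s + 1`. Only the first two components of `x` matter there. -/
theorem mem_Z_two_iff {n t t' t'' : ℤ} {s : ℕ} (ht : t + 1 = t') (ht' : t'' + 1 = t)
    (e : (s : ℤ) + t = n) (e' : ((s + 1 : ℕ) : ℤ) + t'' = n) {x : K.Tot n} (hx : x ∈ K.fil s n) :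
    x ∈ K.Z 2 s n ↔ K.dv s t t' ht (x ⟨(s, t), e⟩) = 0 ∧
      K.dh s t (x ⟨(s, t), e⟩) +
        sgn k (s + 1) • K.dv (s + 1) t'' t ht' (x ⟨(s + 1, t''), e'⟩) = 0 := by
  rw [← K.totD_mem_fil_succ_iff rfl ht e hx, K.mem_Z_iff (q := (s + 1 : ℕ) + 1) rfl (by omega),
    ← K.totD_apply_succ (n' := n + 1) rfl ht' e e' (by push_cast; omega)]
  refine ⟨fun h => ?_, fun h => ?_⟩
  · have h₁ := K.fil_anti (n + 1) (by push_cast; omega : ((s + 1 : ℕ) : ℤ) ≤ (s + 1 : ℕ) + 1) h.2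
    exact ⟨by exact_mod_cast h₁, (K.mem_fil_succ_iff _ h₁).1 h.2⟩
  · have h₁ : K.totD n (n + 1) rfl x ∈ K.fil (s + 1 : ℕ) (n + 1) := by exact_mod_cast h.1
    exact ⟨hx, (K.mem_fil_succ_iff _ h₁).2 h.2⟩

theorem exists_mem_fil {n t t'' : ℤ} {s : ℕ} (e : (s : ℤ) + t = n)
    (e' : ((s + 1 : ℕ) : ℤ) + t'' = n) (a : K.X s t) (b : K.X (s + 1) t'') :
    ∃ x ∈ K.fil s n, x ⟨(s, t), e⟩ = a ∧ x ⟨(s + 1, t''), e'⟩ = b := by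
  classical
  let i₁ : {p : ℕ × ℤ // (p.1 : ℤ) + p.2 = n} := ⟨(s, t), e⟩
  let i₂ : {p : ℕ × ℤ // (p.1 : ℤ) + p.2 = n} := ⟨(s + 1, t''), e'⟩
  have hne : i₁ ≠ i₂ := fun h => by
    have := congrArg (fun p => p.1.1) h
    exact absurd this (Nat.ne_of_lt (Nat.lt_succ_self s))
  let x₁ : K.Tot n := Pi.single i₁ a
  let x₂ : K.Tot n := Pi.single i₂ b
  refine ⟨x₁ + x₂, fun q hq => ?_, ?_, ?_⟩
  · have h₁ : x₁ q = 0 := Pi.single_eq_of_ne (fun h => by subst h; exact lt_irrefl _ hq) _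
    have h₂ : x₂ q = 0 := Pi.single_eq_of_ne (fun h => by
      subst h
      change ((s + 1 : ℕ) : ℤ) < s at hq
      omega) _
    rw [Pi.add_apply, h₁, h₂, add_zero]
  · have h₁ : x₁ i₁ = a := Pi.single_eq_same _ _
    have h₂ : x₂ i₁ = 0 := Pi.single_eq_of_ne hne _
    exact (congrArg₂ (· + ·) h₁ h₂).trans (add_zero _)
  · have h₁ : x₁ i₂ = 0 := Pi.single_eq_of_ne hne.symm _
    have h₂ : x₂ i₂ = b := Pi.single_eq_same _ _
    exact (congrArg₂ (· + ·) h₁ h₂).trans (zero_add _)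

/-! ### `E_2` from a model of the vertical cohomology. -/

section SecondPage

variable {t : ℤ} {C : CochainComplex (ModuleCat.{w} k) ℕ}
  (κ : ∀ s, LinearMap.ker (K.dv s t (t + 1) rfl) →ₗ[k] C.X s)

/-- The maps `κ` from vertical cocycles to `C` induce isomorphisms of the vertical cohomology spaces
with the terms of the complex `C`, and commute with the horizontal differentials. -/
structure ComputesVerticalCohomology : Prop where
  surjective : ∀ s, Function.Surjective (κ s)
  eq_zero_iff : ∀ s x, κ s x = 0 ↔ ∃ y, K.dv s (t - 1) t (Int.sub_add_cancel t 1) y = x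
  comm : ∀ s (x : LinearMap.ker (K.dv s t (t + 1) rfl))
    (y : LinearMap.ker (K.dv (s + 1) t (t + 1) rfl)), K.dh s t x = y →
    (C.d s (s + 1)).hom (κ s x) = κ (s + 1) y

variable {K κ}

theorem dv_dh_eq_zero {s : ℕ} (x : LinearMap.ker (K.dv s t (t + 1) rfl)) :
    K.dv (s + 1) t (t + 1) rfl (K.dh s t x) = 0 := by
  rw [← K.comm, LinearMap.mem_ker.1 x.2, map_zero]

/-- The leading component of an element of `Z_2^s`, as a vertical cocycle. -/
def leading (K : DoubleComplex.{uk, w} k) (s : ℕ) (t n : ℤ) (e : (s : ℤ) + t = n) :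
    K.Z 2 s n →ₗ[k] LinearMap.ker (K.dv s t (t + 1) rfl) :=
  ((LinearMap.proj (⟨(s, t), e⟩ : {p : ℕ × ℤ // (p.1 : ℤ) + p.2 = n})).comp
    (K.Z 2 s n).subtype).codRestrict _ fun x =>
      ((K.mem_Z_two_iff rfl (Int.sub_add_cancel t 1) e (by push_cast; omega) x.2.1).1 x.2).1

/-- The second condition for `Z_2` exhibits the horizontal differential of the leading component as
the vertical coboundary of a multiple of the next component, and `κ` kills vertical coboundaries. -/
theorem ComputesVerticalCohomology.d_leading (hκ : K.ComputesVerticalCohomology κ) {s : ℕ} {n : ℤ}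
    (e : (s : ℤ) + t = n) (x : K.Z 2 s n) :
    (C.d s (s + 1)).hom (κ s (K.leading s t n e x)) = 0 := by
  have h := ((K.mem_Z_two_iff rfl (Int.sub_add_cancel t 1) e (by push_cast; omega) x.2.1).1 x.2).2
  rw [hκ.comm s _ ⟨_, dv_dh_eq_zero _⟩ rfl, hκ.eq_zero_iff]
  refine ⟨-sgn k (s + 1) • x.1 ⟨(s + 1, t - 1), by push_cast; omega⟩, ?_⟩
  rw [map_smul, neg_smul]
  exact (eq_neg_of_add_eq_zero_left h).symm

/-- The map `Z_2^s ⟶ H^s(C)`. -/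
noncomputable def ComputesVerticalCohomology.toHomology (hκ : K.ComputesVerticalCohomology κ) (s : ℕ)
    (n : ℤ) (e : (s : ℤ) + t = n) : K.Z 2 s n →ₗ[k] C.homology s :=
  (cocycleClass C (CochainComplex.next ℕ s)).comp
    (((κ s).comp (K.leading s t n e)).codRestrict _ (hκ.d_leading e))

theorem ComputesVerticalCohomology.toHomology_surjective (hκ : K.ComputesVerticalCohomology κ)
    (s : ℕ) (n : ℤ) (e : (s : ℤ) + t = n) : Function.Surjective (hκ.toHomology s n e) := by
  intro y
  obtain ⟨⟨y, hy⟩, rfl⟩ := cocycleClass_surjective C (CochainComplex.next ℕ s) y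
  obtain ⟨a, rfl⟩ := hκ.surjective s y
  have hy' := LinearMap.mem_ker.1 hy
  rw [hκ.comm s a ⟨_, dv_dh_eq_zero a⟩ rfl, hκ.eq_zero_iff] at hy'
  obtain ⟨b, hb⟩ := hy'
  -- The next component is chosen so that `(-1)^{s+1} dv` of it cancels `dh a = dv b` in column `s +
  -- 1`.
  obtain ⟨x, hx, h₁, h₂⟩ := K.exists_mem_fil e (t'' := t - 1) (by push_cast; omega) a.1
    (-sgn k (s + 1) • b)
  have hZ : x ∈ K.Z 2 s n := by
    refine (K.mem_Z_two_iff rfl (Int.sub_add_cancel t 1) e (by push_cast; omega) hx).2 ⟨?_, ?_⟩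
    · rw [h₁]
      exact a.2
    · rw [h₁, h₂, map_smul, hb, neg_smul, smul_neg, smul_smul, sgn_mul_self, one_smul,
        add_neg_cancel]
  have h₃ : K.leading s t n e ⟨x, hZ⟩ = a := Subtype.ext h₁
  exact ⟨⟨x, hZ⟩, congrArg (cocycleClass C _) (Subtype.ext (congrArg (κ s) h₃))⟩

/-- Membership in `B_2^s` can be read off in column `s`: the component of `x` there must equal that
of `Dv` for some `v ∈ F^{s-1}` with `Dv ∈ F^s`. Such a `v` has a vertical cocycle `a` in column `s -
1` and an arbitrary entry `w` in column `s`. The condition thus says that the leading component is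
`dh a` up to a vertical coboundary, which is vanishing of its class in `H^s(C)`. -/
theorem ComputesVerticalCohomology.ker_toHomology (hκ : K.ComputesVerticalCohomology κ) (s : ℕ)
    (n : ℤ) (e : (s : ℤ) + t = n) :
    LinearMap.ker (hκ.toHomology s n e) = (K.B 2 s n).submoduleOf _ := by
  have hm : n - 1 + 1 = n := Int.sub_add_cancel n 1
  have ht : t - 1 + 1 = t := Int.sub_add_cancel t 1
  ext x
  refine (cocycleClass_eq_zero_iff C _ rfl _).trans ?_
  change _ ↔ x.1 ∈ K.B 2 s n
  have hB (v : K.Tot (n - 1)) (hv : v ∈ K.fil (s - 1) (n - 1))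
      (hD : K.totD (n - 1) n hm v ∈ K.fil s n)
      (h : x.1 ⟨(s, t), e⟩ = K.totD (n - 1) n hm v ⟨(s, t), e⟩) : x.1 ∈ K.B 2 s n := by
    refine (K.mem_B_iff (l := s - 1) hm rfl (by omega) rfl).2
      ⟨x.1 - K.totD (n - 1) n hm v, v, ?_, ?_, hv, hD, sub_add_cancel _ _⟩
    · rw [K.mem_fil_succ_iff e (sub_mem x.2.1 hD), Pi.sub_apply, h, sub_self]
    · rw [map_sub, totD_totD, sub_zero]
      exact x.2.2
  have hB' (hx : x.1 ∈ K.B 2 s n) : ∃ v ∈ K.fil (s - 1) (n - 1),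
      K.totD (n - 1) n hm v ∈ K.fil s n ∧
        x.1 ⟨(s, t), e⟩ = K.totD (n - 1) n hm v ⟨(s, t), e⟩ := by
    obtain ⟨u, v, h₁, -, h₃, h₄, h₅⟩ := (K.mem_B_iff (l := s - 1) hm rfl (by omega) rfl).1 hx
    refine ⟨v, h₃, h₄, ?_⟩
    rw [← h₅, Pi.add_apply, h₁ ⟨(s, t), e⟩ (by dsimp only; omega), zero_add]
  cases s with
  | zero =>
    -- No differential enters degree `0`, so only vertical coboundaries are divided out in this
    -- case.
    have hd : C.d ((ComplexShape.up ℕ).prev 0) 0 = 0 := C.shape _ _ (by simp)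
    rw [hd]
    have h₀ : (∃ y : C.X ((ComplexShape.up ℕ).prev 0), (0 : C.X _ ⟶ C.X 0).hom y =
        κ 0 (K.leading 0 t n e x)) ↔ κ 0 (K.leading 0 t n e x) = 0 :=
      ⟨fun ⟨_, h⟩ => h.symm, fun h => ⟨0, h.symm⟩⟩
    refine h₀.trans ((hκ.eq_zero_iff 0 _).trans ⟨fun ⟨w, hw⟩ => ?_, fun hx => ?_⟩)
    · obtain ⟨v, hv, h₁, -⟩ := K.exists_mem_fil (n := n - 1) (s := 0) (t := t - 1) (t'' := t - 2)
        (by omega) (by push_cast at e ⊢; omega) w 0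
      refine hB v (K.mem_fil_of_nonpos (by simp) _) (K.mem_fil_of_nonpos (by simp) _) ?_
      rw [K.totD_apply_zero hm ht (by push_cast at e ⊢; omega), h₁, hw]
      rfl
    · obtain ⟨v, -, -, h⟩ := hB' hx
      refine ⟨_, ((K.totD_apply_zero hm ht (by push_cast at e ⊢; omega) e v).symm.trans h.symm)⟩
  | succ s =>
    have e₁ : (s : ℤ) + t = n - 1 := by push_cast at e; omega
    have e₂ : ((s + 1 : ℕ) : ℤ) + (t - 1) = n - 1 := by omega
    rw [CochainComplex.prev_nat_succ]
    constructor
    · rintro ⟨y, hy⟩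
      obtain ⟨a, rfl⟩ := hκ.surjective s y
      rw [hκ.comm s a ⟨_, dv_dh_eq_zero a⟩ rfl, eq_comm, ← sub_eq_zero] at hy
      have hy' : κ (s + 1) (K.leading (s + 1) t n e x - ⟨_, dv_dh_eq_zero a⟩) = 0 :=
        (map_sub _ _ _).trans hy
      rw [hκ.eq_zero_iff] at hy'
      obtain ⟨w, hw⟩ := hy'
      -- The sign compensates the sign of the vertical part of `D` in column `s + 1`.
      obtain ⟨v, hv, h₁, h₂⟩ := K.exists_mem_fil e₁ e₂ a.1 (sgn k (s + 1) • w)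
      refine hB v (by push_cast; rwa [add_sub_cancel_right]) ?_ ?_
      · push_cast
        rw [K.totD_mem_fil_succ_iff hm rfl e₁ hv, h₁]
        exact a.2
      · rw [K.totD_apply_succ hm ht e₁ e₂, h₁, h₂, map_smul, smul_smul, sgn_mul_self, one_smul, hw]
        change x.1 ⟨(s + 1, t), e⟩ = K.dh s t a.1 + (x.1 ⟨(s + 1, t), e⟩ - K.dh s t a.1)
        rw [add_sub_cancel]
    · intro hx
      obtain ⟨v, hv, hD, h⟩ := hB' hx
      push_cast at hv hD
      rw [add_sub_cancel_right] at hv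
      have ha := (K.totD_mem_fil_succ_iff hm rfl e₁ hv).1 hD
      refine ⟨κ s ⟨_, ha⟩, ?_⟩
      rw [hκ.comm s _ ⟨_, dv_dh_eq_zero ⟨_, ha⟩⟩ rfl, eq_comm, ← sub_eq_zero]
      refine (map_sub (κ (s + 1)) (K.leading (s + 1) t n e x) _).symm.trans ?_
      rw [hκ.eq_zero_iff]
      refine ⟨sgn k (s + 1) • v ⟨(s + 1, t - 1), e₂⟩, ?_⟩
      rw [map_smul]
      change _ = x.1 ⟨(s + 1, t), e⟩ - K.dh s t (v ⟨(s, t), e₁⟩)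
      rw [h, K.totD_apply_succ hm ht e₁ e₂, add_sub_cancel_left]

/-- The second page is the cohomology of the complex `C`. -/
noncomputable def ComputesVerticalCohomology.secondPageEquiv (hκ : K.ComputesVerticalCohomology κ)
    (s : ℕ) : (K.page 2).X ((s : ℤ), t) ≃ₗ[k] C.homology s :=
  linearEquivOfKerEq (K.toPage 2 s t (s + t) rfl) (hκ.toHomology s (s + t) rfl)
    (K.toPage_surjective _ _ _ _ _) (hκ.toHomology_surjective _ _ _)
    ((K.ker_toPage _ _ _ _ _).trans (hκ.ker_toHomology _ _ _).symm)

/-- Records the isomorphism on representatives, as is needed to state that it is induced by `κ`. -/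
theorem ComputesVerticalCohomology.secondPageEquiv_toPage (hκ : K.ComputesVerticalCohomology κ)
    (s : ℕ) (x : K.Z 2 s (s + t)) : ∃ c : C.cycles s,
      (C.iCycles s).hom c = κ s (K.leading s t (s + t) rfl x) ∧
        (C.homologyπ s).hom c = hκ.secondPageEquiv s (K.toPage 2 s t (s + t) rfl x) := by
  obtain ⟨c, h₁, h₂⟩ := exists_cycles_eq C (CochainComplex.next ℕ s)
    (((κ s).comp (K.leading s t (s + t) rfl)).codRestrict _ (hκ.d_leading rfl) x)
  refine ⟨c, h₁, h₂.trans ?_⟩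
  rw [secondPageEquiv, linearEquivOfKerEq_apply]
  rfl

end SecondPage

theorem column_d (s : ℕ) (t t' : ℤ) (h : t + 1 = t') :
    (K.column s).d t t' = ModuleCat.ofHom (K.dv s t t' h) :=
  dif_pos h

/-- The class of a vertical cocycle. -/
noncomputable def columnClass (t : ℤ) (s : ℕ) :
    LinearMap.ker (K.dv s t (t + 1) rfl) →ₗ[k] (K.verticalCohomology t).X s :=
  (cocycleClass (K.column s) (CochainComplex.next ℤ t)).comp
    ((Submodule.subtype _).codRestrict _ fun x => by
      change ((K.column s).d t (t + 1)).hom x.1 = 0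
      rw [column_d K s t _ rfl]
      exact x.2)

theorem computesVerticalCohomology_columnClass (t : ℤ) :
    K.ComputesVerticalCohomology (K.columnClass t) where
  surjective s y := by
    obtain ⟨⟨y, hy⟩, rfl⟩ := cocycleClass_surjective (K.column s) (CochainComplex.next ℤ t) y
    refine ⟨⟨y, ?_⟩, rfl⟩
    have := LinearMap.mem_ker.1 hy
    rw [column_d K s t _ rfl] at this
    exact this
  eq_zero_iff s x := by
    refine (cocycleClass_eq_zero_iff (K.column s) (CochainComplex.next ℤ t)
      (CochainComplex.prev ℤ t) _).trans ?_
    rw [column_d K s _ t (Int.sub_add_cancel t 1)]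
    exact Iff.rfl
  comm s x y h := by
    have : (K.verticalCohomology t).d s (s + 1) = HomologicalComplex.homologyMap (K.columnMap s) t :=
      CochainComplex.of_d (fun s => (K.column s).homology t)
        (fun s => HomologicalComplex.homologyMap (K.columnMap s) t) s
    rw [this]
    exact homologyMap_cocycleClass _ _ _ _ _ h

end DoubleComplex

/-! ### Splittings of differential graded vector spaces -/

section Splitting

variable {k : Type uk} [Field k]

/-- A splitting of a differential graded vector space: a projection to the homology, a choice of
representing cycles, and a contracting homotopy for the difference. -/
structure Splitting {X : ℤ → Type v} [∀ n, AddCommGroup (X n)] [∀ n, Module k (X n)]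
    (d : ∀ n m : ℤ, m + 1 = n → (X n →ₗ[k] X m)) where
  p : ∀ n, X n →ₗ[k] Hlgy d n
  i : ∀ n, Hlgy d n →ₗ[k] Cyc d n
  h : ∀ n m : ℤ, n + 1 = m → (X n →ₗ[k] X m)
  p_cyc : ∀ n (c : Cyc d n), p n c = Hlgy.mk d n c
  mk_i : ∀ n (a : Hlgy d n), Hlgy.mk d n (i n a) = a
  homotopy : ∀ (n m l : ℤ) (hm : n + 1 = m) (hl : l + 1 = n) (x : X n),
    d m n hm (h n m hm x) + h l n hl (d n l hl x) = x - i n (p n x)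

variable {X : ℤ → Type v} [∀ n, AddCommGroup (X n)] [∀ n, Module k (X n)]
  (d : ∀ n m : ℤ, m + 1 = n → (X n →ₗ[k] X m))

theorem Hlgy.exists_of_mk_eq_zero (n : ℤ) (x : Cyc d n) (h : Hlgy.mk d n x = 0) :
    ∃ y, d (n + 1) n rfl y = (x : X n) :=
  (Submodule.Quotient.mk_eq_zero _).1 h

/-- Over a field a complex is its homology plus a contractible complex. With `p` extending the class
map, `i` a section by cycles and `r` a section of `d` with `pr = 0`, the map `q = 1 - ip - rd`
projects to the boundaries, and `h = rq` is the homotopy. -/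
theorem exists_splitting
    (dd : ∀ (n m l : ℤ) (h : m + 1 = n) (h' : l + 1 = m) (x : X n), d m l h' (d n m h x) = 0) :
    Nonempty (Splitting d) := by
  have hp (n : ℤ) := (Hlgy.mk d n).exists_extend
  choose p hp using hp
  have hi (n : ℤ) := (Hlgy.mk d n).exists_rightInverse_of_surjective
    (LinearMap.range_eq_top.2 (Hlgy.mk_surjective d n))
  choose i hi using hi
  have hs (n : ℤ) := (d (n + 1) n rfl).rangeRestrict.exists_rightInverse_of_surjective
    (LinearMap.range_eq_top.2 (LinearMap.surjective_rangeRestrict _))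
  choose s hs using hs
  have hp' (n : ℤ) (c : Cyc d n) : p n c = Hlgy.mk d n c := LinearMap.congr_fun (hp n) c
  have hi' (n : ℤ) (a : Hlgy d n) : Hlgy.mk d n (i n a) = a := LinearMap.congr_fun (hi n) a
  have hdi (n m : ℤ) (h : m + 1 = n) (a : Hlgy d n) : d n m h (i n a) = 0 := by
    obtain rfl : m = n - 1 := by omega
    exact (i n a).2
  have hpd (n m : ℤ) (h : m + 1 = n) (x : X n) : p m (d n m h x) = 0 := by
    subst h
    rw [hp' m ⟨d (m + 1) m rfl x, dd _ _ _ _ _ _⟩]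
    exact Hlgy.mk_eq_zero d m _ x rfl
  -- a section of the differential with values in the kernel of `p`
  have hr (n m : ℤ) (h : n + 1 = m) : ∃ r : LinearMap.range (d m n h) →ₗ[k] X m,
      (∀ b, d m n h (r b) = b) ∧ ∀ b, p m (r b) = 0 := by
    subst h
    -- Replacing a section `s` of `d` by `s - ips` keeps it a section, since `di = 0`, and makes `p`
    -- vanish on it, since `pi = 1`.
    refine ⟨s n - (Cyc d (n + 1)).subtype.comp ((i (n + 1)).comp ((p (n + 1)).comp (s n))),
      fun b => ?_, fun b => ?_⟩
    · simp only [LinearMap.sub_apply, LinearMap.comp_apply, Submodule.subtype_apply, map_sub, hdi,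
        sub_zero]
      exact congrArg Subtype.val (LinearMap.congr_fun (hs n) b)
    · simp only [LinearMap.sub_apply, LinearMap.comp_apply, Submodule.subtype_apply, map_sub, hp',
        hi', sub_self]
  choose r hdr hpr using hr
  -- the projection to the boundaries
  let q (n : ℤ) : X n →ₗ[k] X n := LinearMap.id - (Cyc d n).subtype.comp ((i n).comp (p n)) -
    (r (n - 1) n (Int.sub_add_cancel n 1)).comp (d n (n - 1) (Int.sub_add_cancel n 1)).rangeRestrict
  have hq (n : ℤ) (x : X n) : q n x = x - i n (p n x) - r (n - 1) n (Int.sub_add_cancel n 1)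
      ⟨d n (n - 1) (Int.sub_add_cancel n 1) x, ⟨x, rfl⟩⟩ := rfl
  have hqc (n : ℤ) (x : X n) : q n x ∈ Cyc d n := by
    rw [LinearMap.mem_ker, hq, map_sub, map_sub, hdi, hdr]
    simp
  have hqb (n m : ℤ) (h : n + 1 = m) (x : X n) : q n x ∈ LinearMap.range (d m n h) := by
    subst h
    refine Hlgy.exists_of_mk_eq_zero d n ⟨_, hqc n x⟩ ?_
    rw [← hp']
    change p n (q n x) = 0
    rw [hq, map_sub, map_sub, hpr, hp', hi', sub_self, sub_zero]
  -- From `dr = 1` one gets `dh = q`. As `q` fixes boundaries, `hd = rd`, and the sum is `q + rd = 1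
  -- - ip`.
  refine ⟨⟨p, i, fun n m h => (r n m h).comp ((q n).codRestrict _ (hqb n m h)), hp', hi',
    fun n m l hm hl x => ?_⟩⟩
  obtain rfl : l = n - 1 := by omega
  have h₁ : q (n - 1) (d n (n - 1) hl x) = d n (n - 1) hl x := by
    have h₂ := hpd n (n - 1) hl x
    have h₃ : d (n - 1) (n - 1 - 1) (Int.sub_add_cancel _ 1) (d n (n - 1) hl x) = 0 :=
      dd _ _ _ _ _ _
    rw [hq, h₂, map_zero]
    have h₄ : (⟨d (n - 1) (n - 1 - 1) (Int.sub_add_cancel _ 1) (d n (n - 1) hl x), ⟨_, rfl⟩⟩ :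
      LinearMap.range (d (n - 1) (n - 1 - 1) (Int.sub_add_cancel _ 1))) = 0 := Subtype.ext h₃
    rw [h₄, map_zero, Submodule.coe_zero, sub_zero, sub_zero]
  have h₅ : (q (n - 1)).codRestrict _ (hqb (n - 1) n hl) (d n (n - 1) hl x) =
      ⟨d n (n - 1) hl x, ⟨x, rfl⟩⟩ := Subtype.ext h₁
  rw [LinearMap.comp_apply, LinearMap.comp_apply, h₅, hdr]
  change q n x + _ = _
  rw [hq, sub_add_cancel]

namespace Splitting

variable {d} (S : Splitting d)

theorem d_i {n m : ℤ} (h : m + 1 = n) (a : Hlgy d n) : d n m h (S.i n a) = 0 := by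
  obtain rfl : m = n - 1 := by omega
  exact (S.i n a).2

theorem p_d (dd : ∀ (n m l : ℤ) (h : m + 1 = n) (h' : l + 1 = m) (x : X n),
    d m l h' (d n m h x) = 0) {n m : ℤ} (h : m + 1 = n) (x : X n) : S.p m (d n m h x) = 0 := by
  subst h
  rw [S.p_cyc m ⟨d (m + 1) m rfl x, dd _ _ _ _ _ _⟩]
  exact Hlgy.mk_eq_zero d m _ x rfl

/-- The chosen representing cycle of a homology class, with a free degree. -/
def lift {a b : ℤ} (h : a = b) : Hlgy d a →ₗ[k] X b := by
  subst h
  exact (Cyc d a).subtype.comp (S.i a)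

theorem d_lift {a b c : ℤ} (h : a = b) (hc : c + 1 = b) (y : Hlgy d a) :
    d b c hc (S.lift h y) = 0 := by
  subst h
  exact S.d_i hc y

theorem p_lift {t a b : ℤ} (y : ∀ m, Hlgy d (m - t)) (e : a = b) (h : a - t = b - t) :
    S.p (b - t) (S.lift h (y a)) = y b := by
  subst e
  exact (S.p_cyc _ _).trans (S.mk_i _ _)

end Splitting

end Splitting

/-! ### The Künneth map -/

section Kunneth

open GrBimod DGBimod

variable {k : Type uk} [Field k]

namespace DGCat

variable (A : DGCat.{uk, u, v} k)

/-- A splitting of the morphism space `A(x, y)`. -/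
noncomputable def splitting (x y : A.Obj) : Splitting (A.d x y) :=
  (exists_splitting (A.d x y) (A.d_d x y)).some

/-- The chosen representative of a homology class. -/
noncomputable def rep (x y : A.Obj) (n : ℤ) : Hlgy (A.d x y) n →ₗ[k] A.Hom x y n :=
  (Cyc (A.d x y) n).subtype.comp ((A.splitting x y).i n)

/-- The string of the projections of the entries of a string to homology. -/
noncomputable def proj : ∀ {s : ℕ} {x y : A.Obj} {n : ℤ},
    A.toGrCat.Str s x y n → GrCat.Str A.homology s x y n
  | _, _, _, _, .nil x => GrCat.Str.nil (A := A.homology) x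
  | _, _, y, _, @GrCat.Str.cons _ _ _ _ _ z _ i _ _ f σ h =>
      GrCat.Str.cons (A := A.homology) ((A.splitting z y).p i f) (proj σ) h

/-- The string of the chosen representatives of the entries of a string of homology classes. -/
noncomputable def sect : ∀ {s : ℕ} {x y : A.Obj} {n : ℤ},
    GrCat.Str A.homology s x y n → A.toGrCat.Str s x y n
  | _, _, _, _, .nil x => .nil (A := A.toGrCat) x
  | _, _, y, _, @GrCat.Str.cons _ _ _ _ _ z _ i _ _ f σ h =>
      .cons (A := A.toGrCat) (A.rep z y i f) (sect σ) h

variable {A}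

theorem proj_isAdd {s : ℕ} {x y : A.Obj} {n : ℤ} {σ τ ρ : A.toGrCat.Str s x y n}
    (h : GrCat.Str.IsAdd σ τ ρ) : GrCat.Str.IsAdd (A.proj σ) (A.proj τ) (A.proj ρ) := by
  induction h with
  | head f g σ h =>
    rw [proj, proj, proj, map_add]
    exact .head _ _ _ _
  | tail f h _ ih => exact .tail _ _ ih

theorem proj_isSMul {c : k} {s : ℕ} {x y : A.Obj} {n : ℤ} {σ τ : A.toGrCat.Str s x y n}
    (h : GrCat.Str.IsSMul c σ τ) : GrCat.Str.IsSMul c (A.proj σ) (A.proj τ) := by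
  induction h with
  | head f σ h =>
    rw [proj, proj, map_smul]
    exact .head _ _ _
  | tail f h _ ih => exact .tail _ _ ih

theorem isAdd_rep {s : ℕ} {x z y : A.Obj} {i j n : ℤ} (f g : Hlgy (A.d z y) i)
    (σ : A.toGrCat.Str s x z j) (h : i + j = n) :
    GrCat.Str.IsAdd (.cons (A.rep z y i f) σ h) (.cons (A.rep z y i g) σ h)
      (.cons (A.rep z y i (f + g)) σ h) := by
  rw [map_add]
  exact .head _ _ _ h

theorem isSMul_rep {s : ℕ} {x z y : A.Obj} {i j n : ℤ} (c : k) (f : Hlgy (A.d z y) i)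
    (σ : A.toGrCat.Str s x z j) (h : i + j = n) :
    GrCat.Str.IsSMul c (.cons (A.rep z y i f) σ h) (.cons (A.rep z y i (c • f)) σ h) := by
  rw [map_smul]
  exact .head _ _ h

theorem Represents.cons_rep {s : ℕ} {x z y : A.Obj} {i j n : ℤ} (f : Hlgy (A.d z y) i)
    {σ : A.toGrCat.Str s x z j} {τ : GrCat.Str A.homology s x z j} (h : i + j = n)
    (hσ : A.Represents σ τ) : A.Represents (.cons (A.rep z y i f) σ h)
      (GrCat.Str.cons (A := A.homology) f τ h) := by
  have := Represents.cons (A := A) ((A.splitting z y).i i f) h hσ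
  rwa [(A.splitting z y).mk_i i f] at this

theorem sect_isAdd : ∀ {s : ℕ} {x y : A.Obj} {n : ℤ} {σ τ ρ : GrCat.Str A.homology s x y n},
    GrCat.Str.IsAdd σ τ ρ → GrCat.Str.IsAdd (A.sect σ) (A.sect τ) (A.sect ρ)
  | _, _, _, _, _, _, _, .head f g σ h => isAdd_rep f g (A.sect σ) h
  | _, _, _, _, _, _, _, .tail _ h e => .tail _ h (sect_isAdd e)

theorem sect_isSMul {c : k} : ∀ {s : ℕ} {x y : A.Obj} {n : ℤ}
    {σ τ : GrCat.Str A.homology s x y n},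
    GrCat.Str.IsSMul c σ τ → GrCat.Str.IsSMul c (A.sect σ) (A.sect τ)
  | _, _, _, _, _, _, .head f σ h => isSMul_rep c f (A.sect σ) h
  | _, _, _, _, _, _, .tail _ h e => .tail _ h (sect_isSMul e)

theorem represents_sect : ∀ {s : ℕ} {x y : A.Obj} {n : ℤ} (τ : GrCat.Str A.homology s x y n),
    A.Represents (A.sect τ) τ
  | _, _, _, _, .nil x => .nil x
  | _, _, _, _, .cons f σ h => .cons_rep f h (represents_sect σ)

theorem Represents.proj_eq {s : ℕ} {x y : A.Obj} {n : ℤ} {σ : A.toGrCat.Str s x y n}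
    {τ : GrCat.Str A.homology s x y n} (h : A.Represents σ τ) : A.proj σ = τ := by
  induction h with
  | nil x => rfl
  | cons f h _ ih => rw [proj, ih, (A.splitting _ _).p_cyc]

end DGCat

namespace DGBimod

variable {A : DGCat.{uk, u, v} k} (M : DGBimod.{uk, u, v, w} A)

/-- A splitting of the space `M(x, y)`. -/
noncomputable def splitting (x y : A.Obj) : Splitting (M.d x y) :=
  (exists_splitting (M.d x y) (M.d_d x y)).some

variable {M}

/-- The contracting homotopy on functions on strings. -/
noncomputable def htpy {y : A.Obj} : ∀ {s : ℕ} {x z : A.Obj} {n : ℤ}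
    (_ : A.toGrCat.Str s x z n) (m : ℤ)
    (_ : ∀ (x : A.Obj) (n m : ℤ), A.toGrCat.Str s x z n → M.obj x y m), M.obj x y m
  | _, _, _, _, .nil _, _, _ => 0
  | _, x, z', _, @GrCat.Str.cons _ _ _ _ _ z _ i j _ f σ _, m, φ =>
      pre (M := M.toGrBimod) ((A.splitting z z').h i (i + 1) rfl f) φ x j m σ +
        sgn k i • htpy (z := z) σ m (pre (M := M.toGrBimod)
          (A.rep z z' i ((A.splitting z z').p i f)) φ)

end DGBimod

end Kunneth

/-! ### The homotopy on strings and its defining identity. -/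

section Kunneth

open GrBimod DGBimod

variable {k : Type uk} [Field k]

namespace DGBimod

variable {A : DGCat.{uk, u, v} k} {M : DGBimod.{uk, u, v, w} A}

/-- The contracting homotopy, as an operation on functions. -/
noncomputable def hFun {s : ℕ} {y z : A.Obj}
    (φ : ∀ (x : A.Obj) (n m : ℤ), A.toGrCat.Str s x z n → M.obj x y m) :
    ∀ (x : A.Obj) (n m : ℤ), A.toGrCat.Str s x z n → M.obj x y m :=
  fun _ _ m σ => htpy σ m φ

theorem pre_hFun {s : ℕ} {x₀ y z : A.Obj} {i : ℤ} (f : A.Hom y z i)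
    (φ : ∀ (x : A.Obj) (n m : ℤ), A.toGrCat.Str (s + 1) x z n → M.obj x x₀ m) :
    pre (M := M.toGrBimod) f (hFun φ) =
      pre (M := M.toGrBimod) ((A.splitting y z).h i (i + 1) rfl f) φ +
        sgn k i • hFun (pre (M := M.toGrBimod) (A.rep y z i ((A.splitting y z).p i f)) φ) := rfl

theorem htpy_add {s : ℕ} {x y z : A.Obj} {n : ℤ} (σ : A.toGrCat.Str s x z n) (m : ℤ)
    (φ ψ : ∀ (x : A.Obj) (n m : ℤ), A.toGrCat.Str s x z n → M.obj x y m) :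
    htpy σ m (φ + ψ) = htpy σ m φ + htpy σ m ψ := by
  induction σ with
  | nil x => exact (add_zero _).symm
  | @cons s x z' z i j n f σ h ih =>
    have := ih (pre (M := M.toGrBimod) (A.rep z' z i ((A.splitting z' z).p i f)) φ)
      (pre (M := M.toGrBimod) (A.rep z' z i ((A.splitting z' z).p i f)) ψ)
    refine (congrArg (fun a => pre (M := M.toGrBimod) ((A.splitting z' z).h i (i + 1) rfl f)
      (φ + ψ) x j m σ + sgn k i • a) this).trans ?_
    rw [smul_add]
    exact add_add_add_comm _ _ _ _

theorem htpy_smul {s : ℕ} {x y z : A.Obj} {n : ℤ} (c : k) (σ : A.toGrCat.Str s x z n) (m : ℤ)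
    (φ : ∀ (x : A.Obj) (n m : ℤ), A.toGrCat.Str s x z n → M.obj x y m) :
    htpy σ m (c • φ) = c • htpy σ m φ := by
  induction σ with
  | nil x => exact (smul_zero _).symm
  | @cons s x z' z i j n f σ h ih =>
    have := ih (pre (M := M.toGrBimod) (A.rep z' z i ((A.splitting z' z).p i f)) φ)
    refine (congrArg (fun a => pre (M := M.toGrBimod) ((A.splitting z' z).h i (i + 1) rfl f)
      (c • φ) x j m σ + sgn k i • a) this).trans ?_
    rw [smul_comm]
    exact (smul_add _ _ _).symm

theorem hFun_add {s : ℕ} {y z : A.Obj}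
    (φ ψ : ∀ (x : A.Obj) (n m : ℤ), A.toGrCat.Str s x z n → M.obj x y m) :
    hFun (φ + ψ) = hFun φ + hFun ψ := by
  funext x n m σ
  exact htpy_add σ m φ ψ

theorem hFun_smul {s : ℕ} {y z : A.Obj} (c : k)
    (φ : ∀ (x : A.Obj) (n m : ℤ), A.toGrCat.Str s x z n → M.obj x y m) :
    hFun (c • φ) = c • hFun φ := by
  funext x n m σ
  exact htpy_smul c σ m φ

theorem hFun_zero {s : ℕ} {y z : A.Obj} :
    hFun (0 : ∀ (x : A.Obj) (n m : ℤ), A.toGrCat.Str s x z n → M.obj x y m) = 0 := by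
  have := hFun_smul (M := M) (0 : k)
    (0 : ∀ (x : A.Obj) (n m : ℤ), A.toGrCat.Str s x z n → M.obj x y m)
  rwa [zero_smul, zero_smul] at this

theorem pre_zero {s : ℕ} {x₀ y z : A.Obj} {i : ℤ}
    {φ : ∀ (x : A.Obj) (n m : ℤ), A.toGrCat.Str (s + 1) x z n → M.obj x x₀ m}
    (h : Additive' (M := M.toGrBimod) φ) :
    pre (M := M.toGrBimod) (0 : A.Hom y z i) φ = 0 := by
  funext x n m σ
  exact additive_zero h σ rfl m

theorem pre_sub {s : ℕ} {x₀ y z : A.Obj} {i : ℤ} (f g : A.Hom y z i)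
    {φ : ∀ (x : A.Obj) (n m : ℤ), A.toGrCat.Str (s + 1) x z n → M.obj x x₀ m}
    (h : Additive' (M := M.toGrBimod) φ) : pre (M := M.toGrBimod) (f - g) φ =
      pre (M := M.toGrBimod) f φ - pre (M := M.toGrBimod) g φ := by
  rw [eq_sub_iff_add_eq, ← h.pre_add, sub_add_cancel]

theorem pre_h_degree_eq {s : ℕ} {x₀ y z : A.Obj} {i m m' : ℤ}
    (φ : ∀ (x : A.Obj) (n m : ℤ), A.toGrCat.Str (s + 1) x z n → M.obj x x₀ m) (f : A.Hom y z i)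
    (h : i + 1 = m) (h' : i + 1 = m') :
    pre (M := M.toGrBimod) ((A.splitting y z).h i m h f) φ =
      pre (M := M.toGrBimod) ((A.splitting y z).h i m' h' f) φ := by
  subst h h'
  rfl

theorem pre_d_degree_eq {s : ℕ} {x₀ y z : A.Obj} {i m m' : ℤ}
    (φ : ∀ (x : A.Obj) (n m : ℤ), A.toGrCat.Str (s + 1) x z n → M.obj x x₀ m) (f : A.Hom y z i)
    (h : m + 1 = i) (h' : m' + 1 = i) :
    pre (M := M.toGrBimod) (A.d y z i m h f) φ = pre (M := M.toGrBimod) (A.d y z i m' h' f) φ := by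
  obtain rfl : m = m' := by omega
  rfl

theorem d_rep {y z : A.Obj} {i j : ℤ} (h : j + 1 = i) (f : Hlgy (A.d y z) i) :
    A.d y z i j h (A.rep y z i f) = 0 :=
  (A.splitting y z).d_i h f

/-- On strings this reads `φ(Hd + dH) = φ - φ(ip ⊗ ⋯ ⊗ ip)`. Induct on the length with `H(f ⊗ τ) =
hf ⊗ τ + (-1)^{|f|} ipf ⊗ Hτ`. The terms `± hf ⊗ dτ` cancel, the identity `dh + hd = 1 - ip` handles
the first entry, and the induction hypothesis for partial evaluation at `ipf` handles the tail. -/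
theorem sourceTerm_hFun_add {s : ℕ} {y z : A.Obj}
    {φ : ∀ (x : A.Obj) (n m : ℤ), A.toGrCat.Str s x z n → M.obj x y m}
    (h : Additive' (M := M.toGrBimod) φ) (h' : Homog (M := M.toGrBimod) φ)
    (x : A.Obj) (n m : ℤ) (σ : A.toGrCat.Str s x z n) :
    M.sourceTerm (hFun φ) x n m σ + hFun (M.sourceTerm φ) x n m σ =
      φ x n m σ - φ x n m (A.sect (A.proj σ)) := by
  induction σ with
  | nil x =>
    rw [sourceTerm_nil, zero_add]
    exact (sub_self _).symm
  | @cons s x z' z i j n f τ e ih =>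
    set S := A.splitting z' z with hS
    set P := A.rep z' z i (S.p i f) with hP
    have ih' := ih (h.pre P) (h'.pre P)
    have e₁ : ∀ ψ : ∀ (x : A.Obj) (n m : ℤ), A.toGrCat.Str (s + 1) x z n → M.obj x y m,
      ψ x n m (.cons f τ e) = pre (M := M.toGrBimod) f ψ x j m τ :=
      fun ψ => pre_eq (M := M.toGrBimod) f ψ x j n m τ e
    have e₂ : φ x n m (A.sect (A.proj (.cons f τ e))) =
        pre (M := M.toGrBimod) P φ x j m (A.sect (A.proj τ)) :=
      pre_eq (M := M.toGrBimod) P φ x j n m (A.sect (A.proj τ)) e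
    have hd : i - 1 + 1 = i := Int.sub_add_cancel i 1
    -- As `p` kills boundaries, `H(df ⊗ τ)` consists of the term `hdf ⊗ τ` alone.
    have hP0 : A.rep z' z (i - 1) (S.p (i - 1) (A.d z' z i (i - 1) hd f)) = 0 := by
      rw [S.p_d (A.d_d z' z), map_zero]
    have hom : pre (M := M.toGrBimod) (A.d z' z (i + 1) i rfl (S.h i (i + 1) rfl f)) φ +
        pre (M := M.toGrBimod) (S.h (i - 1) i hd (A.d z' z i (i - 1) hd f)) φ =
        pre (M := M.toGrBimod) f φ - pre (M := M.toGrBimod) P φ := by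
      rw [← h.pre_add, S.homotopy, pre_sub _ _ h]
      rfl
    have e₃ : pre (M := M.toGrBimod) f (M.sourceTerm (hFun φ)) =
        pre (M := M.toGrBimod) (S.h (i - 1) i hd (A.d z' z i (i - 1) hd f)) φ +
        (sgn k i • M.sourceTerm (pre (M := M.toGrBimod) (S.h i (i + 1) rfl f) φ) +
          M.sourceTerm (hFun (pre (M := M.toGrBimod) P φ))) := by
      rw [pre_sourceTerm, pre_hFun, pre_hFun, hP0, pre_zero h, hFun_zero, smul_zero, add_zero,
        pre_h_degree_eq φ _ rfl hd]
      congr 1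
      funext x' n' m' σ'
      rw [Pi.smul_apply, Pi.smul_apply, Pi.smul_apply, Pi.smul_apply, sourceTerm_add,
        sourceTerm_smul, smul_add, smul_smul, sgn_mul_self, one_smul]
      rfl
    have e₄ : pre (M := M.toGrBimod) f (hFun (M.sourceTerm φ)) =
        pre (M := M.toGrBimod) (A.d z' z (i + 1) i rfl (S.h i (i + 1) rfl f)) φ -
        sgn k i • M.sourceTerm (pre (M := M.toGrBimod) (S.h i (i + 1) rfl f) φ) +
          hFun (M.sourceTerm (pre (M := M.toGrBimod) P φ)) := by
      rw [pre_hFun, pre_sourceTerm, pre_sourceTerm, d_rep, pre_zero h, zero_add, hFun_smul,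
        smul_smul, sgn_mul_self, one_smul, sgn_add, sgn_one, mul_neg_one, neg_smul, ← sub_eq_add_neg,
        pre_d_degree_eq φ _ _ rfl]
    rw [e₁ (M.sourceTerm (hFun φ)), e₁ (hFun (M.sourceTerm φ)), e₁ φ, e₂, e₃, e₄]
    have hom' := congrFun (congrFun (congrFun (congrFun hom x) j) m) τ
    simp only [Pi.add_apply, Pi.sub_apply] at hom' ⊢
    rw [add_comm, ← sub_eq_zero] at hom'
    rw [← sub_eq_zero] at ih' ⊢
    rw [← add_zero (0 : M.obj x y m)]
    nth_rewrite 1 [← hom']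
    rw [← ih']
    abel

end DGBimod

end Kunneth

/-! ### Cochains and the homotopy on strings of cycles. -/

section Kunneth

open GrBimod DGBimod

variable {k : Type uk} [Field k]

namespace Splitting

variable {X : ℤ → Type v} [∀ n, AddCommGroup (X n)] [∀ n, Module k (X n)]
  {d : ∀ n m : ℤ, m + 1 = n → (X n →ₗ[k] X m)} (S : Splitting d)

theorem h_degree_eq {a b c : ℤ} (e : a = b) (h : a + 1 = c) (x : ∀ n, X n) :
    S.h a c h (x a) = S.h b c (by omega) (x b) := by
  subst e
  rfl

end Splitting

namespace DGCat

variable {A : DGCat.{uk, u, v} k}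

/-- A string with a zero entry is the sum of two copies of itself in that entry. An additive
function then satisfies `a = a + a` on it and vanishes; in this form no separate notion of a zero
string is needed. -/
theorem isAdd_self_zero {s : ℕ} {x z y : A.Obj} {i j n : ℤ} (σ : GrCat.Str A.homology s x z j)
    (h : i + j = n) {f : Hlgy (A.d z y) i} (hf : f = 0) :
    GrCat.Str.IsAdd (GrCat.Str.cons (A := A.homology) (x := x) (y := y) f σ h)
      (GrCat.Str.cons (A := A.homology) (y := y) f σ h)
      (GrCat.Str.cons (A := A.homology) (y := y) f σ h) := by
  have := GrCat.Str.IsAdd.head (A := A.homology) (x := x) (y := y) f f σ h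
  have e : f + f = f := by rw [hf, add_zero]
  exact (congrArg (fun g : Hlgy (A.d z y) i => GrCat.Str.IsAdd
    (GrCat.Str.cons (A := A.homology) (x := x) (y := y) f σ h)
      (GrCat.Str.cons (A := A.homology) (y := y) f σ h)
      (GrCat.Str.cons (A := A.homology) (y := y) g σ h)) e).mp this

theorem proj_dAt_isAdd_self : ∀ {s : ℕ} {x y : A.Obj} {n : ℤ} (p : Fin s)
    (σ : A.toGrCat.Str s x y n),
    GrCat.Str.IsAdd (A.proj (A.dAt p σ)) (A.proj (A.dAt p σ)) (A.proj (A.dAt p σ))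
  | _ + 1, _, y, _, ⟨0, _⟩, @GrCat.Str.cons _ _ _ _ _ z _ i _ _ f σ h =>
      isAdd_self_zero (A.proj σ) _ ((A.splitting z y).p_d (A.d_d z y) _ f)
  | _ + 1, _, _, _, ⟨p + 1, hp⟩, .cons f σ h => .tail _ _ (proj_dAt_isAdd_self ⟨p, by omega⟩ σ)

theorem Represents.dAt_isAdd_self {s : ℕ} {x y : A.Obj} {n : ℤ} {σ : A.toGrCat.Str s x y n}
    {τ : GrCat.Str A.homology s x y n} (h : A.Represents σ τ) (p : Fin s) :
    GrCat.Str.IsAdd (A.dAt p σ) (A.dAt p σ) (A.dAt p σ) := by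
  induction h with
  | nil x => exact p.elim0
  | @cons s x z y i j n f σ τ h _ ih =>
    match p with
    | ⟨0, _⟩ =>
      have := GrCat.Str.IsAdd.head (A := A.toGrCat) (0 : A.Hom z y (i - 1)) 0 σ
        (show i - 1 + j = n - 1 by omega)
      rw [add_zero] at this
      have e : A.d z y i (i - 1) (Int.sub_add_cancel i 1) f = 0 := f.2
      rw [dAt, e]
      exact this
    | ⟨p + 1, hp⟩ => exact .tail _ _ (ih ⟨p, by omega⟩)

end DGCat

namespace DGBimod

variable {A : DGCat.{uk, u, v} k} {M : DGBimod.{uk, u, v, w} A}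

theorem sourceTerm_eq_zero_of_represents {s : ℕ} {y z : A.Obj}
    {φ : ∀ (x : A.Obj) (n m : ℤ), A.toGrCat.Str s x z n → M.obj x y m}
    (hφ : Additive' (M := M.toGrBimod) φ) {x : A.Obj} {n : ℤ} (m : ℤ)
    {σ : A.toGrCat.Str s x z n} {τ : GrCat.Str A.homology s x z n} (h : A.Represents σ τ) :
    M.sourceTerm φ x n m σ = 0 :=
  Finset.sum_eq_zero fun p _ => by
    rw [left_eq_add.1 (hφ x _ m _ _ _ (h.dAt_isAdd_self p)), smul_zero]

theorem sourceTerm_proj {s : ℕ} {y z : A.Obj}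
    (ξ : ∀ (x : A.Obj) (n m : ℤ), GrCat.Str A.homology s x z n → M.obj x y m)
    (hξ : ∀ (x : A.Obj) (n m : ℤ) (σ τ ρ : GrCat.Str A.homology s x z n),
      GrCat.Str.IsAdd σ τ ρ → ξ x n m ρ = ξ x n m σ + ξ x n m τ)
    (x : A.Obj) (n m : ℤ) (σ : A.toGrCat.Str s x z n) :
    M.sourceTerm (fun x n m σ => ξ x n m (A.proj σ)) x n m σ = 0 :=
  Finset.sum_eq_zero fun p _ => (congrArg _
    (left_eq_add.1 (hξ x _ m _ _ _ (DGCat.proj_dAt_isAdd_self p σ)))).trans (smul_zero _)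

theorem hFun_cons {s : ℕ} {x₀ x y z : A.Obj} {i j n : ℤ}
    (φ : ∀ (x : A.Obj) (n m : ℤ), A.toGrCat.Str (s + 1) x z n → M.obj x x₀ m)
    (f : A.Hom y z i) (σ : A.toGrCat.Str s x y j) (h : i + j = n) (m : ℤ) :
    hFun φ x n m (.cons f σ h) =
      pre (M := M.toGrBimod) ((A.splitting y z).h i (i + 1) rfl f) φ x j m σ +
        sgn k i • hFun (pre (M := M.toGrBimod) (A.rep y z i ((A.splitting y z).p i f)) φ) x j m σ :=
  rfl

theorem hFun_additive {s : ℕ} {x₀ z : A.Obj}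
    {φ : ∀ (x : A.Obj) (n m : ℤ), A.toGrCat.Str s x z n → M.obj x x₀ m}
    (h : Additive' (M := M.toGrBimod) φ) : Additive' (M := M.toGrBimod) (hFun φ) := by
  intro x n m σ τ ρ e
  induction e with
  | head f g σ h' =>
    rw [hFun_cons, hFun_cons, hFun_cons, map_add, map_add, map_add, h.pre_add, h.pre_add, hFun_add]
    simp only [Pi.add_apply, smul_add]
    abel
  | tail f h' e ih =>
    rw [hFun_cons, hFun_cons, hFun_cons, ih (h.pre _), h.pre _ _ _ _ _ _ _ e, smul_add]
    abel

theorem hFun_homog {s : ℕ} {x₀ z : A.Obj}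
    {φ : ∀ (x : A.Obj) (n m : ℤ), A.toGrCat.Str s x z n → M.obj x x₀ m}
    (h : Homog (M := M.toGrBimod) φ) : Homog (M := M.toGrBimod) (hFun φ) := by
  intro c x n m σ τ e
  induction e with
  | head f σ h' =>
    rw [hFun_cons, hFun_cons, map_smul, map_smul, map_smul, h.pre_smul, h.pre_smul, hFun_smul]
    simp only [Pi.smul_apply]
    module
  | tail f h' e ih =>
    rw [hFun_cons, hFun_cons, ih (h.pre _), h.pre _ _ _ _ _ _ _ e]
    module

/-- `H` raises the degree of a string by one, so composition with it lowers the internal degree by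
one. -/
theorem hFun_eq_zero {s : ℕ} {x₀ x z : A.Obj} {n t : ℤ} (σ : A.toGrCat.Str s x z n) (m : ℤ)
    {φ : ∀ (x : A.Obj) (n m : ℤ), A.toGrCat.Str s x z n → M.obj x x₀ m}
    (h : ∀ x n m σ, m + t ≠ n → φ x n m σ = 0) (hm : m + t ≠ n + 1) : hFun φ x n m σ = 0 := by
  induction σ generalizing t with
  | nil x => rfl
  | @cons s x z' z i j n f σ e ih =>
    -- Fixing a first entry of degree `i` leaves a function of internal degree `t - i`; this is why
    -- `t` is generalized.
    have ih' := ih (t := t - i) (φ := pre (M := M.toGrBimod)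
      (A.rep z' z i ((A.splitting z' z).p i f)) φ) (fun x n m σ h' => h _ _ _ _ (by omega))
      (by omega)
    rw [hFun_cons, ih', smul_zero, add_zero]
    exact h _ _ _ _ (by omega)

/-- `H` acts on the arguments and `d` on the values, so they commute without a sign. -/
theorem hFun_d {s : ℕ} {x₀ x z : A.Obj} {n : ℤ} (σ : A.toGrCat.Str s x z n) (m : ℤ)
    (φ : ∀ (x : A.Obj) (n m : ℤ), A.toGrCat.Str s x z n → M.obj x x₀ m) :
    hFun (fun x n m τ => M.d x x₀ (m + 1) m rfl (φ x n (m + 1) τ)) x n m σ =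
      M.d x x₀ (m + 1) m rfl (hFun φ x n (m + 1) σ) := by
  induction σ with
  | nil x => exact (map_zero _).symm
  | cons f σ e ih =>
    rw [hFun_cons, hFun_cons, map_add, map_smul, ← ih]
    rfl

theorem additive_of_mem {s : ℕ} {t : ℤ} (φ : M.toGrBimod.cochain s t) (y : A.Obj) :
    Additive' (M := M.toGrBimod) (fun x n m τ => φ.1 x y n m τ) :=
  fun x n m _ _ _ e => φ.2.1 x y n m _ _ _ e

theorem homog_of_mem {s : ℕ} {t : ℤ} (φ : M.toGrBimod.cochain s t) (y : A.Obj) :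
    Homog (M := M.toGrBimod) (fun x n m τ => φ.1 x y n m τ) :=
  fun c x n m _ _ e => φ.2.2.1 c x y n m _ _ e

theorem d_apply_of_cocycle {s : ℕ} {t : ℤ} {φ : M.toGrBimod.cochain s t}
    (h : M.dInt s t (t + 1) rfl φ = 0) {x y : A.Obj} {n m m' : ℤ} (hm : m' + 1 = m)
    (σ : A.toGrCat.Str s x y n) : M.d x y m m' hm (φ.1 x y n m σ) =
      sgn k t • M.sourceTerm (fun x' n' m' τ => φ.1 x' y n' m' τ) x n m' σ := by
  subst hm
  have := congrFun (congrFun (congrFun (congrFun (congrFun (congrArg Subtype.val h) x) y) n) m') σ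
  exact sub_eq_zero.1 this

theorem d_apply_of_represents {s : ℕ} {t : ℤ} {φ : M.toGrBimod.cochain s t}
    (h : M.dInt s t (t + 1) rfl φ = 0) {x y : A.Obj} {n m m' : ℤ} (hm : m' + 1 = m)
    {σ : A.toGrCat.Str s x y n} {τ : GrCat.Str A.homology s x y n} (hσ : A.Represents σ τ) :
    M.d x y m m' hm (φ.1 x y n m σ) = 0 := by
  rw [d_apply_of_cocycle h, sourceTerm_eq_zero_of_represents (additive_of_mem φ y) _ hσ, smul_zero]

theorem hFun_sourceTerm_of_cocycle {s : ℕ} {t : ℤ} {φ : M.toGrBimod.cochain s t}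
    (h : M.dInt s t (t + 1) rfl φ = 0) {x y : A.Obj} {n : ℤ} (m : ℤ)
    (σ : A.toGrCat.Str s x y n) :
    hFun (M.sourceTerm fun x' n' m' τ => φ.1 x' y n' m' τ) x n m σ =
      sgn k t • M.d x y (m + 1) m rfl (hFun (fun x' n' m' τ => φ.1 x' y n' m' τ) x n (m + 1) σ) := by
  have e : (M.sourceTerm fun x' n' m' τ => φ.1 x' y n' m' τ) =
      sgn k t • fun x' n' m' τ => M.d x' y (m' + 1) m' rfl (φ.1 x' y n' (m' + 1) τ) := by
    funext x' n' m' τ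
    rw [Pi.smul_apply, Pi.smul_apply, Pi.smul_apply, Pi.smul_apply, d_apply_of_cocycle h, smul_smul,
      sgn_mul_self, one_smul]
  rw [e, hFun_smul]
  exact congrArg (sgn k t • ·) (hFun_d σ m fun x' n' m' τ => φ.1 x' y n' m' τ)

end DGBimod

end Kunneth

/-! ### The Künneth isomorphism and its compatibility with `b`. -/

section Kunneth

open GrBimod DGBimod

variable {k : Type uk} [Field k]

namespace Hlgy

section

variable {X : ℤ → Type*} [∀ n, AddCommGroup (X n)] [∀ n, Module k (X n)]
  {d : ∀ n m : ℤ, m + 1 = n → (X n →ₗ[k] X m)} {n : ℤ}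

variable (d) in
/-- The vector `x` is a cycle in the homology class `c`. -/
def IsRep (x : X n) (c : Hlgy d n) : Prop := ∃ h : x ∈ Cyc d n, c = mk d n ⟨x, h⟩

theorem IsRep.add {x y : X n} {a b : Hlgy d n} (hx : IsRep d x a) (hy : IsRep d y b) :
    IsRep d (x + y) (a + b) := by
  obtain ⟨hx, rfl⟩ := hx
  obtain ⟨hy, rfl⟩ := hy
  exact ⟨add_mem hx hy, (map_add _ _ _).symm⟩

theorem IsRep.smul (c : k) {x : X n} {a : Hlgy d n} (hx : IsRep d x a) :
    IsRep d (c • x) (c • a) := by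
  obtain ⟨hx, rfl⟩ := hx
  exact ⟨Submodule.smul_mem _ c hx, (map_smul _ _ _).symm⟩

theorem IsRep.neg {x : X n} {a : Hlgy d n} (hx : IsRep d x a) : IsRep d (-x) (-a) := by
  obtain ⟨hx, rfl⟩ := hx
  exact ⟨neg_mem hx, (map_neg _ _).symm⟩

theorem IsRep.sub {x y : X n} {a b : Hlgy d n} (hx : IsRep d x a) (hy : IsRep d y b) :
    IsRep d (x - y) (a - b) := by
  rw [sub_eq_add_neg, sub_eq_add_neg]
  exact hx.add hy.neg

theorem IsRep.congr {x x' : X n} {a a' : Hlgy d n} (hx : x = x') (ha : a = a')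
    (h : IsRep d x' a') : IsRep d x a := by
  rwa [hx, ha]

theorem IsRep.unique {x : X n} {a b : Hlgy d n} (ha : IsRep d x a) (hb : IsRep d x b) : a = b := by
  obtain ⟨_, rfl⟩ := ha
  obtain ⟨_, rfl⟩ := hb
  rfl

end

theorem IsRep.pair {X Y Z : ℤ → Type*} [∀ n, AddCommGroup (X n)] [∀ n, Module k (X n)]
    [∀ n, AddCommGroup (Y n)] [∀ n, Module k (Y n)]
    [∀ n, AddCommGroup (Z n)] [∀ n, Module k (Z n)]
    {dX : ∀ n m : ℤ, m + 1 = n → (X n →ₗ[k] X m)}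
    {dY : ∀ n m : ℤ, m + 1 = n → (Y n →ₗ[k] Y m)}
    {dZ : ∀ n m : ℤ, m + 1 = n → (Z n →ₗ[k] Z m)}
    {μ : ∀ i j n : ℤ, i + j = n → (X i →ₗ[k] Y j →ₗ[k] Z n)}
    (hμ : Leibniz dX dY dZ μ) {i j n : ℤ} (h : i + j = n) {x : X i} {y : Y j} {a : Hlgy dX i}
    {b : Hlgy dY j} (hx : IsRep dX x a) (hy : IsRep dY y b) :
    IsRep dZ (μ i j n h x y) (Hlgy.pair hμ i j n h a b) := by
  obtain ⟨hx, rfl⟩ := hx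
  obtain ⟨hy, rfl⟩ := hy
  exact ⟨(pairCyc hμ i j n h ⟨x, hx⟩ ⟨y, hy⟩).2, rfl⟩

end Hlgy

namespace DGBimod

variable {A : DGCat.{uk, u, v} k} {M : DGBimod.{uk, u, v, w} A}

/-- The function `ψ` on strings in `H_• A` is induced by the function `φ` on strings in `A`; both
are functions on the strings with a fixed target. -/
def InducesFix (M : DGBimod.{uk, u, v, w} A) (t : ℤ) {s : ℕ} {y z : A.Obj}
    (φ : ∀ (x : A.Obj) (n m : ℤ), A.toGrCat.Str s x z n → M.obj x y m)
    (ψ : ∀ (x : A.Obj) (n m : ℤ), GrCat.Str A.homology s x z n → Hlgy (M.d x y) (m - t)) : Prop :=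
  ∀ (x : A.Obj) (n m : ℤ) (σ : A.toGrCat.Str s x z n) (τ : GrCat.Str A.homology s x z n),
    A.Represents σ τ → Hlgy.IsRep (M.d x y) (φ x n (m - t) σ) (ψ x n m τ)

/-- Composition and right action in homology are computed on representatives, so merging
neighbouring cycles represents merging their classes. The recursion for the inner terms reduces the
claim to these two facts. -/
theorem InducesFix.innerTerm {s : ℕ} {t : ℤ} {y z : A.Obj}
    {φ : ∀ (x : A.Obj) (n m : ℤ), A.toGrCat.Str s x z n → M.obj x y m}
    {ψ : ∀ (x : A.Obj) (n m : ℤ), GrCat.Str A.homology s x z n → Hlgy (M.d x y) (m - t)}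
    (h : M.InducesFix t φ ψ) : M.InducesFix t (M.innerTerm φ)
      (GrBimod.innerTerm (A := A.homology) (y := y) (M.homology.shift t) ψ) := by
  intro x n m σ τ hσ
  induction s generalizing z n with
  | zero =>
    cases hσ with
    | @cons _ _ z' _ i j _ f σ τ e hσ =>
      cases hσ with
      | nil _ =>
        refine .congr (innerTerm_one (M := M.toGrBimod) φ f.1 n (m - t) e)
          (innerTerm_one (A := A.homology) (M := M.homology.shift t) (x₀ := y) ψ
            (Hlgy.mk (A.d x z) i f) n m e) (.neg ?_)
        refine .congr (right_degree_eq (M := M.toGrBimod) (j' := m - i - t) _ (by omega) f.1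
          (fun j => φ z 0 j (.nil z))) rfl ?_
        exact Hlgy.IsRep.pair (M.leibniz_right _ _ _) _ (h z 0 (m - i) _ _ (.nil z)) ⟨f.2, rfl⟩
  | succ s ih =>
    cases hσ with
    | @cons _ _ z₁ _ a j _ f σ τ e hσ =>
      cases hσ with
      | @cons _ _ z₂ _ b c _ g σ τ e' hσ =>
        refine .congr (innerTerm_succ (M := M.toGrBimod) φ f.1 g.1 σ e' e (m - t))
          (innerTerm_succ (A := A.homology) (M := M.homology.shift t) (x₀ := y) ψ
            (Hlgy.mk (A.d z₁ z) a f) (Hlgy.mk (A.d z₂ z₁) b g) τ e' e m) (.sub (.neg ?_) ?_)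
        · exact h x n m _ _ (.cons (Hlgy.pairCyc (A.leibniz z₂ z₁ z) a b (a + b) rfl f g) _ hσ)
        · exact ih (φ := pre (M := M.toGrBimod) f.1 φ)
            (ψ := pre (A := A.homology) (M := M.homology.shift t) (x₀ := y)
              (Hlgy.mk (A.d z₁ z) a f) ψ)
            (fun x' n' m' σ' τ' h' => h x' (a + n') m' _ _ (.cons f rfl h')) _ _ _ (.cons g e' hσ)

/-- Here the suspension is needed. The left term of a cochain of internal degree `t` carries
`(-1)^{t|f_1|}`. On homology the cochain has internal degree `0` and no such sign, and the left
action on `Σ^t` supplies it instead. -/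
theorem InducesFix.leftTerm {s : ℕ} {t : ℤ} {φ : M.toGrBimod.Raw s}
    {ψ : (M.homology.shift t).Raw s}
    (h : ∀ y : A.Obj, M.InducesFix t (fun x n m σ => φ x y n m σ)
      (fun x n m τ => ψ x y n m τ)) (y : A.Obj) :
    M.InducesFix t (fun x n m σ => GrBimod.leftTerm t φ x y n m σ)
      (fun x n m τ => GrBimod.leftTerm (M := M.homology.shift t) 0 ψ x y n m τ) := by
  intro x n m σ τ hσ
  cases hσ with
  | @cons _ _ z _ i j _ f σ τ e hσ =>
    have e₁ : GrBimod.leftTerm (M := M.homology.shift t) 0 ψ x y n m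
        (GrCat.Str.cons (A := A.homology) (Hlgy.mk (A.d z y) i f) τ e) =
        sgn k (t * i) • Hlgy.pair (M.leibniz_left x z y) i (m - i - t) (m - t) (by omega)
          (Hlgy.mk (A.d z y) i f) (ψ x z j (m - i) τ) := by
      have e₂ : sgn k (0 * i) • sgn k (i * t) • Hlgy.pair (M.leibniz_left x z y) i (m - i - t)
          (m - t) (by omega) (Hlgy.mk (A.d z y) i f) (ψ x z j (m - i) τ) =
          sgn k (t * i) • Hlgy.pair (M.leibniz_left x z y) i (m - i - t) (m - t) (by omega)
          (Hlgy.mk (A.d z y) i f) (ψ x z j (m - i) τ) := by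
        rw [zero_mul, sgn_zero, one_smul, mul_comm]
      exact e₂
    refine .congr rfl e₁ (.smul _ (.congr (left_degree_eq (M := M.toGrBimod) (j' := m - i - t) _
      (by omega) f.1 (fun l => φ x z j l σ)) rfl ?_))
    exact Hlgy.IsRep.pair (M.leibniz_left x z y) _ ⟨f.2, rfl⟩ (h z x j (m - i) σ τ hσ)

theorem InducesFix.bRaw {s : ℕ} {t : ℤ} {φ : M.toGrBimod.Raw s}
    {ψ : (M.homology.shift t).Raw s}
    (h : ∀ y : A.Obj, M.InducesFix t (fun x n m σ => φ x y n m σ)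
      (fun x n m τ => ψ x y n m τ)) (y : A.Obj) :
    M.InducesFix t (fun x n m σ => GrBimod.bRaw t φ x y n m σ)
      (fun x n m τ => GrBimod.bRaw (M := M.homology.shift t) 0 ψ x y n m τ) :=
  fun x n m σ τ hσ => (InducesFix.leftTerm h y x n m σ τ hσ).add ((h y).innerTerm x n m σ τ hσ)

/-- The Künneth map: evaluation of a cochain on representatives, projected to homology. -/
noncomputable def kunneth (M : DGBimod.{uk, u, v, w} A) (s : ℕ) (t : ℤ) :
    M.toGrBimod.cochain s t →ₗ[k] (M.homology.shift t).cochain s 0 where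
  toFun φ := ⟨fun (x y : A.Obj) n m τ => (M.splitting x y).p (m - t) (φ.1 x y n (m - t) (A.sect τ)),
    fun (x y : A.Obj) n m _ _ _ e => (congrArg ((M.splitting x y).p (m - t))
      (φ.2.1 x y n (m - t) _ _ _ (DGCat.sect_isAdd e))).trans (map_add _ _ _),
    fun c (x y : A.Obj) n m _ _ e => (congrArg ((M.splitting x y).p (m - t))
      (φ.2.2.1 c x y n (m - t) _ _ (DGCat.sect_isSMul e))).trans (map_smul _ _ _),
    fun (x y : A.Obj) n m _ e => (congrArg ((M.splitting x y).p (m - t))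
      (φ.2.2.2 x y n (m - t) _ (by omega))).trans (map_zero _)⟩
  map_add' φ ψ := by
    refine Subtype.ext ?_
    funext (x : A.Obj) (y : A.Obj) n m τ
    exact map_add ((M.splitting x y).p (m - t)) _ _
  map_smul' c φ := by
    refine Subtype.ext ?_
    funext (x : A.Obj) (y : A.Obj) n m τ
    exact map_smul ((M.splitting x y).p (m - t)) _ _

/-- Independence of representatives: for a cocycle `φ` and a string `σ` of cycles, the term `φ(Hdσ)`
vanishes and `φ(dHσ)` is a boundary up to sign. So `φ(σ)` and its value on the chosen
representatives differ by a boundary, which `p` kills. -/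
theorem p_eq_of_cocycle {s : ℕ} {t : ℤ} {φ : M.toGrBimod.cochain s t}
    (h : M.dInt s t (t + 1) rfl φ = 0) {x y : A.Obj} {n : ℤ} (m : ℤ)
    {σ : A.toGrCat.Str s x y n} {τ : GrCat.Str A.homology s x y n} (hσ : A.Represents σ τ) :
    (M.splitting x y).p m (φ.1 x y n m σ) = (M.splitting x y).p m (φ.1 x y n m (A.sect τ)) := by
  have := sourceTerm_hFun_add (additive_of_mem φ y) (homog_of_mem φ y) x n m σ
  rw [sourceTerm_eq_zero_of_represents (hFun_additive (additive_of_mem φ y)) m hσ,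
    hFun_sourceTerm_of_cocycle h, hσ.proj_eq, zero_add] at this
  rw [← sub_eq_zero, ← map_sub, ← this, map_smul, (M.splitting x y).p_d (M.d_d x y), smul_zero]

theorem inducesFix_kunneth {s : ℕ} {t : ℤ} {φ : M.toGrBimod.cochain s t}
    (h : M.dInt s t (t + 1) rfl φ = 0) (y : A.Obj) :
    M.InducesFix t (fun x n m σ => φ.1 x y n m σ) (fun x n m τ => (M.kunneth s t φ).1 x y n m τ) :=
  fun x n m σ τ hσ => by
    have hc : φ.1 x y n (m - t) σ ∈ Cyc (M.d x y) (m - t) := d_apply_of_represents h _ hσ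
    exact ⟨hc, (p_eq_of_cocycle h (m - t) hσ).symm.trans ((M.splitting x y).p_cyc _ ⟨_, hc⟩)⟩

theorem induces_kunneth {s : ℕ} {t : ℤ} {φ : M.toGrBimod.cochain s t}
    (h : M.dInt s t (t + 1) rfl φ = 0) : M.Induces φ (M.kunneth s t φ) :=
  fun x y n σ τ hσ => inducesFix_kunneth h y x n n σ τ hσ

/-- Both sides are induced by `bφ`, and an induced cochain is determined by its values on the chosen
representatives. -/
theorem b_kunneth {s : ℕ} {t : ℤ} {φ : M.toGrBimod.cochain s t}
    (h : M.dInt s t (t + 1) rfl φ = 0) :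
    (M.homology.shift t).b s 0 (M.kunneth s t φ) = M.kunneth (s + 1) t (M.toGrBimod.b s t φ) := by
  have h' : M.dInt (s + 1) t (t + 1) rfl (M.toGrBimod.b s t φ) = 0 := by
    have := M.doubleComplex.comm s t (t + 1) rfl φ
    exact this.symm.trans ((congrArg _ h).trans (map_zero _))
  refine Subtype.ext ?_
  funext (x : A.Obj) (y : A.Obj) n m τ
  exact (InducesFix.bRaw (fun y => inducesFix_kunneth h y) y x n m _ τ
    (DGCat.represents_sect τ)).unique
      (inducesFix_kunneth h' y x n m _ τ (DGCat.represents_sect τ))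

/-- A preimage of `ψ` is `i ∘ ψ ∘ (p ⊗ ⋯ ⊗ p)`. It is an internal cocycle because `i` takes values
in cycles and `p` kills boundaries, and `pi = 1` recovers `ψ`. -/
theorem exists_kunneth_eq {s : ℕ} {t : ℤ} (ψ : (M.homology.shift t).cochain s 0) :
    ∃ φ : M.toGrBimod.cochain s t, M.dInt s t (t + 1) rfl φ = 0 ∧ M.kunneth s t φ = ψ := by
  let ξ (x y : A.Obj) (n m : ℤ) (τ : GrCat.Str A.homology s x y n) : M.obj x y m :=
    (M.splitting x y).lift (Int.add_sub_cancel m t) (ψ.1 x y n (m + t) τ)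
  have hξ (x y : A.Obj) (n m : ℤ) (σ τ ρ : GrCat.Str A.homology s x y n)
      (e : GrCat.Str.IsAdd σ τ ρ) : ξ x y n m ρ = ξ x y n m σ + ξ x y n m τ :=
    (congrArg ((M.splitting x y).lift _) (ψ.2.1 x y n (m + t) σ τ ρ e)).trans (map_add _ _ _)
  refine ⟨⟨fun x y n m σ => ξ x y n m (A.proj σ), fun x y n m σ τ ρ e => ?_,
    fun c x y n m σ τ e => ?_, fun x y n m σ e => ?_⟩, ?_, ?_⟩
  · exact hξ x y n m _ _ _ (DGCat.proj_isAdd e)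
  · exact (congrArg ((M.splitting x y).lift _) (ψ.2.2.1 c x y n (m + t) _ _
      (DGCat.proj_isSMul e))).trans (map_smul _ _ _)
  · exact (congrArg ((M.splitting x y).lift _) (ψ.2.2.2 x y n (m + t) _ (by omega))).trans
      (map_zero _)
  · refine Subtype.ext ?_
    funext x y n m σ
    change M.d x y (m + 1) m rfl (ξ x y n (m + 1) (A.proj σ)) -
      sgn k t • M.sourceTerm (fun x' n' m' τ => ξ x' y n' m' (A.proj τ)) x n m σ = 0
    rw [sourceTerm_proj (fun x' n' m' τ => ξ x' y n' m' τ) (fun x n m => hξ x y n m),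
      smul_zero, sub_zero]
    exact (M.splitting x y).d_lift _ _ _
  · refine Subtype.ext ?_
    funext (x : A.Obj) (y : A.Obj) n m τ
    change (M.splitting x y).p (m - t) (ξ x y n (m - t) (A.proj (A.sect τ))) = ψ.1 x y n m τ
    rw [(DGCat.represents_sect τ).proj_eq]
    exact (M.splitting x y).p_lift (fun m => ψ.1 x y n m τ) (Int.sub_add_cancel m t) _

/-- The part `dχ` is killed by `p`, and `χd` vanishes because the chosen representatives are cycles.
-/
theorem kunneth_dInt {s : ℕ} {t' t : ℤ} (ht : t' + 1 = t) (χ : M.toGrBimod.cochain s t') :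
    M.kunneth s t (M.dInt s t' t ht χ) = 0 := by
  refine Subtype.ext ?_
  funext (x : A.Obj) (y : A.Obj) n m τ
  change (M.splitting x y).p (m - t) (M.d x y (m - t + 1) (m - t) rfl _ -
    sgn k t' • M.sourceTerm (fun x' n' m' τ => χ.1 x' y n' m' τ) x n (m - t) (A.sect τ)) = 0
  rw [sourceTerm_eq_zero_of_represents (additive_of_mem χ y) _ (DGCat.represents_sect τ),
    smul_zero, sub_zero, (M.splitting x y).p_d (M.d_d x y)]

/-- The cochain that bounds an internal cocycle in the kernel of the Künneth map. -/
noncomputable def bounding {s : ℕ} {t : ℤ} (φ : M.toGrBimod.cochain s t) :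
    M.toGrBimod.cochain s (t - 1) := by
  -- The first summand `(-1)^t φH` bounds `φ - φ(ip ⊗ ⋯ ⊗ ip)`; the second applies the homotopy of
  -- `M` to the values of `φ(ip ⊗ ⋯ ⊗ ip)`.
  refine sgn k t • ⟨fun x y n m σ => hFun (fun x' n' m' τ => φ.1 x' y n' m' τ) x n m σ,
    fun x y n m σ τ ρ e => hFun_additive (additive_of_mem φ y) x n m σ τ ρ e,
    fun c x y n m σ τ e => hFun_homog (homog_of_mem φ y) c x n m σ τ e,
    fun x y n m σ e => hFun_eq_zero σ m (t := t) (fun x n m σ h => φ.2.2.2 x y n m σ h)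
      (by omega)⟩ +
    ⟨fun x y n m σ => (M.splitting x y).h (m - 1) m (Int.sub_add_cancel m 1)
      (φ.1 x y n (m - 1) (A.sect (A.proj σ))),
    fun x y n m _ _ _ e => (congrArg ((M.splitting x y).h (m - 1) m _)
      (φ.2.1 x y n _ _ _ _ (DGCat.sect_isAdd (DGCat.proj_isAdd e)))).trans (map_add _ _ _),
    fun c x y n m _ _ e => (congrArg ((M.splitting x y).h (m - 1) m _)
      (φ.2.2.1 c x y n _ _ _ (DGCat.sect_isSMul (DGCat.proj_isSMul e)))).trans (map_smul _ _ _),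
    fun x y n m _ e => (congrArg ((M.splitting x y).h (m - 1) m _)
      (φ.2.2.2 x y n _ _ (by omega))).trans (map_zero _)⟩

/-- If the Künneth image vanishes, `φ(ip ⊗ ⋯ ⊗ ip)` takes values in cycles of class zero, for which
`dh = 1`. Its source term drops out since `p` kills boundaries. The remaining part of `φ` is bounded
by the homotopy on strings. -/
theorem dInt_bounding {s : ℕ} {t : ℤ} {φ : M.toGrBimod.cochain s t}
    (h : M.dInt s t (t + 1) rfl φ = 0) (h' : M.kunneth s t φ = 0) :
    M.dInt s (t - 1) t (Int.sub_add_cancel t 1) (bounding φ) = φ := by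
  refine Subtype.ext ?_
  funext x y n m σ
  let φ' (x' : A.Obj) (n' m' : ℤ) (τ : A.toGrCat.Str s x' y n') : M.obj x' y m' := φ.1 x' y n' m' τ
  let ξ (x' : A.Obj) (n' m' : ℤ) (τ : GrCat.Str A.homology s x' y n') : M.obj x' y m' :=
    (M.splitting x' y).h (m' - 1) m' (Int.sub_add_cancel m' 1) (φ.1 x' y n' (m' - 1) (A.sect τ))
  have hξ (x' : A.Obj) (n' m' : ℤ) (σ τ ρ : GrCat.Str A.homology s x' y n')
      (e : GrCat.Str.IsAdd σ τ ρ) : ξ x' n' m' ρ = ξ x' n' m' σ + ξ x' n' m' τ :=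
    (congrArg ((M.splitting x' y).h _ _ _) (φ.2.1 x' y n' _ _ _ _ (DGCat.sect_isAdd e))).trans
      (map_add _ _ _)
  have hp : (M.splitting x y).p m (φ.1 x y n m (A.sect (A.proj σ))) = 0 := by
    obtain ⟨l, rfl⟩ : ∃ l, m = l - t := ⟨m + t, by omega⟩
    exact congrFun (congrFun (congrFun (congrFun (congrFun (congrArg Subtype.val h') x) y) n) l)
      (A.proj σ)
  have hd : M.d x y (m + 1) m rfl (ξ x n (m + 1) (A.proj σ)) =
      φ.1 x y n m (A.sect (A.proj σ)) := by
    have e₁ := (M.splitting x y).homotopy m (m + 1) (m - 1) rfl (Int.sub_add_cancel m 1)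
      (φ.1 x y n m (A.sect (A.proj σ)))
    rw [hp, d_apply_of_represents h _ (DGCat.represents_sect _), map_zero, map_zero, add_zero,
      Submodule.coe_zero, sub_zero] at e₁
    rw [← e₁]
    exact congrArg _ ((M.splitting x y).h_degree_eq (by omega) _
      (fun l => φ.1 x y n l (A.sect (A.proj σ))))
  have e₂ := sourceTerm_hFun_add (additive_of_mem φ y) (homog_of_mem φ y) x n m σ
  rw [hFun_sourceTerm_of_cocycle h] at e₂
  change M.d x y (m + 1) m rfl (sgn k t • hFun φ' x n (m + 1) σ + ξ x n (m + 1) (A.proj σ)) -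
    sgn k (t - 1) • M.sourceTerm (sgn k t • hFun φ' + fun x' n' m' τ => ξ x' n' m' (A.proj τ))
      x n m σ = φ.1 x y n m σ
  rw [sourceTerm_add, sourceTerm_proj ξ hξ, sourceTerm_smul, map_add, hd, map_smul, add_zero,
    sgn_sub_one, neg_smul, smul_smul, sgn_mul_self, one_smul, sub_neg_eq_add, add_right_comm,
    add_comm (sgn k t • _)]
  exact (congrArg (· + φ.1 x y n m (A.sect (A.proj σ))) e₂).trans (sub_add_cancel _ _)

/-- The Künneth map on the vertical cocycles of the Hochschild double complex. -/
noncomputable def kunnethCocycle (M : DGBimod.{uk, u, v, w} A) (t : ℤ) (s : ℕ) :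
    LinearMap.ker (M.doubleComplex.dv s t (t + 1) rfl) →ₗ[k]
      ((M.homology.shift t).hochschildComplex 0).X s :=
  (M.kunneth s t).comp (Submodule.subtype _)

theorem computesVerticalCohomology_kunneth (M : DGBimod.{uk, u, v, w} A) (t : ℤ) :
    M.doubleComplex.ComputesVerticalCohomology (M.kunnethCocycle t) where
  surjective s ψ := by
    obtain ⟨φ, h, h'⟩ := exists_kunneth_eq (M := M) (s := s) (t := t) ψ
    exact ⟨⟨φ, h⟩, h'⟩
  eq_zero_iff s φ := by
    refine ⟨fun h => ⟨bounding φ.1, dInt_bounding φ.2 h⟩, fun ⟨χ, h⟩ => ?_⟩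
    exact (congrArg (M.kunneth s t) h.symm).trans (kunneth_dInt (Int.sub_add_cancel t 1) χ)
  comm s φ χ h := by
    have : ((M.homology.shift t).hochschildComplex 0).d s (s + 1) =
        ModuleCat.ofHom ((M.homology.shift t).b s 0) :=
      CochainComplex.of_d (fun s => ModuleCat.of k ((M.homology.shift t).cochain s 0))
        (fun s => ModuleCat.ofHom ((M.homology.shift t).b s 0)) s
    rw [this]
    exact (b_kunneth φ.2).trans (congrArg (M.kunneth (s + 1) t) h)

end DGBimod

end Kunneth

/-! ### The spectral sequences of a bimodule and of an automorphism. -/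

theorem mainTheorem1 {k : Type uk} [Field k] (A : DGCat.{uk, u, v} k)
    (M : DGBimod.{uk, u, v, w} A) :
    (∃ (E : CategoryTheory.CohomologicalSpectralSequence (ModuleCat.{max u v w} k) 0)
        (S : M.doubleComplex.ColumnFiltrationData E),
      (∀ (r : ℤ) (hr : 0 ≤ r) (s t : ℤ), s < 0 →
        CategoryTheory.Limits.IsZero ((E.page r hr).X (s, t))) ∧
      (∀ (s : ℕ) (t : ℤ),
        ∃ ε : (E.page 2 (by decide)).X ((s : ℤ), t) ≃ₗ[k] (M.homology.shift t).HHgr s 0,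
          ∀ x : M.doubleComplex.Z 2 s (s + t), ∃ ψ : (M.homology.shift t).cochain s 0,
            M.Induces ((x : M.doubleComplex.Tot (s + t)) ⟨(s, t), rfl⟩) ψ ∧
            (M.homology.shift t).IsClassOf ψ (ε (S.π 2 (by decide) s t (s + t) rfl x))) ∧
      M.doubleComplex.ConvergesTo M.HHdg) ∧
    (∀ T : A.Auto,
      ∃ (E : CategoryTheory.CohomologicalSpectralSequence (ModuleCat.{max u v} k) 0)
        (_ : T.doubleComplex.ColumnFiltrationData E),
      (∀ (r : ℤ) (hr : 0 ≤ r) (s t : ℤ), s < 0 →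
        CategoryTheory.Limits.IsZero ((E.page r hr).X (s, t))) ∧
      (∀ (s : ℕ) (t : ℤ), Nonempty ((E.page 2 (by decide)).X ((s : ℤ), t) ≃ₗ[k]
        (T.doubleComplex.verticalCohomology t).homology s)) ∧
      T.doubleComplex.ConvergesTo T.HHdg) := by
  refine ⟨⟨M.doubleComplex.spectralSequence, M.doubleComplex.spectralSequenceData,
    fun r _ s t hs => M.doubleComplex.isZero_page r s t hs, fun s t => ?_, fun _ => rfl,
    M.doubleComplex.converges⟩, fun T => ⟨T.doubleComplex.spectralSequence,
    T.doubleComplex.spectralSequenceData, fun r _ s t hs => T.doubleComplex.isZero_page r s t hs,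
    fun s t => ⟨(T.doubleComplex.computesVerticalCohomology_columnClass t).secondPageEquiv s⟩,
    fun _ => rfl, T.doubleComplex.converges⟩⟩
  -- For a bimodule the model of the vertical cohomology is the graded Hochschild complex, so the
  -- isomorphism sends the class of `x` to the Künneth image of its leading component.
  have hκ := M.computesVerticalCohomology_kunneth t
  refine ⟨hκ.secondPageEquiv s, fun x => ⟨M.kunnethCocycle t s
    (M.doubleComplex.leading s t (s + t) rfl x), ?_, hκ.secondPageEquiv_toPage s x⟩⟩
  exact DGBimod.induces_kunneth (M.doubleComplex.leading s t (s + t) rfl x).2
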